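/- A channel $(\mathbb{Z}_4,\mathcal{Y},W)$ is a discrete memoryless channel with input alphabet $\mathbb{Z}_4$, finite output alphabet $\mathcal{Y}$ and transition probabilities $W(y|x)$; information and rates are in bits. Define $$W^-(y_1,y_2|u_1)=\sum_{u_2\in\mathbb{Z}_4}\tfrac14 W(y_1|u_1+u_2)W(y_2|u_2),\qquad W^+(y_1,y_2,u_1|u_2)=\tfrac14 W(y_1|u_1+u_2)W(y_2|u_2),$$ and for bits $b_1,\dots,b_n$ let $W^{b_1\cdots b_n}$ be the channel obtained by applying these transforms successively ($+$ for bit $1$, $-$ for bit $0$, first $b_1$, last $b_n$). Let $I(W)=I(X;Y)$, $I_2(W)=I(X_1;Y)$ and $I_2'(W)=I(X_1';Y)$ be the mutual information between input and output of $W$ when the input is uniform on $\mathbb{Z}_4$, on $\{0,2\}$ and on $\{1,3\}$ respectively. For i.i.d. fair bits $b_1,b_2,\dots$ put $(I_2+I_2')^n=I_2(W^{b_1\cdots b_n})+I_2'(W^{b_1\cdots b_n})$. A rate $R$ is achievable using group codes if for every $\epsilon>0$ and all sufficiently large $n$ there are a subgroup $\mathbb{C}\le\mathbb{Z}_4^n$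 used as codebook and a decoder such that $\frac1n\log_2|\mathbb{C}|\ge R-\epsilon$ and the average block error probability is at most $\epsilon$; the group capacity is the maximum of these rates. For $N=2^n$ and $A\subseteq\{1,\dots,N\}$ the standard polar code with information set $A$ is the group code $\{uG_N : u\in\mathbb{Z}_4^N,\ u_i=0 \text{ for } i\notin A\}$, where $G_N=B_NF^{\otimes n}$, $F=\begin{pmatrix}1&0\\1&1\end{pmatrix}$ and $B_N$ is the bit-reversal permutation of the rows; its rate is $\frac1N\log_2$ of its cardinality. The $i$-th synthesized channel is $W_N^{(i)}=W^{b_1\cdots b_n}$ with $i-1=\sum_k b_k2^{n-k}$. Standard polar codes reach the rate $R$ (a) *through perfect channels*, if for every $\epsilon>0$ and all sufficiently large $n$ there is $A$ with $I(W_N^{(i)})\ge 2-\epsilon$ for all $i\in A$ whose standard polar code has rate at least $R-\epsilon$; (b) *under successive cancellation decoding*, if for every $\epsilon>0$ and all sufficiently large $n$ there are $A$, whose standard polar code has rate at least $R-\epsilon$, and a decoder that decides $u_i$, $i\in A$, successively from the channel output and $u_1,\dots,u_{i-1}$, such that the block error probability, averaged over uniform information symbols and over uniform fixed symbols at the positions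 outside $A$ known to the decoder, is at most $\epsilon$. **Statement.** 1. For every channel $(\mathbb{Z}_4,\mathcal{Y},W)$ the process $(I_2+I_2')^n$, $n=0,1,2,\dots$, is a supermartingale with respect to the filtration $\sigma(b_1,\dots,b_n)$. 2. Let $W$ be Channel 3 with $\lambda=0.2$, that is, the channel with binary output and $W(0|0)=1$, $W(1|1)=1$, $W(0|2)=1-\lambda$, $W(1|2)=\lambda$, $W(1|3)=1-\lambda$, $W(0|3)=\lambda$. To four decimals $I(W)=0.6390$. The group capacity of $W$ equals $C=(I_2+I_2')^0=0.2161$ to four decimals. Every rate reached by standard polar codes over $W$, in the sense (a) or (b), is at most $\mathbb{E}\{(I_2+I_2')^1\}$, which equals $0.2053$ to four decimals, and $\mathbb{E}\{(I_2+I_2')^1\}<C$. 3. Consequently standard polar codes do not in general achieve the group capacity: there is a channel with input $\mathbb{Z}_4$ whose group capacity is reached by standard polar codes neither in the sense (a) nor in the sense (b). -/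

import Mathlib

open MeasureTheory ProbabilityTheory Filter

universe u v

noncomputable section

/-! ## Discrete memoryless channels and mutual information (in bits) -/

/-- A discrete memoryless channel with input alphabet `G` and a finite output alphabet `Out`;
`prob x y` is `W(y|x)`. -/
structure Channel (G : Type) where
  Out : Type u
  [fintypeOut : Fintype Out]
  prob : G → Out → ℝ
  prob_nonneg : ∀ x y, 0 ≤ prob x y
  sum_prob : ∀ x, ∑ y, prob x y = 1

attribute [instance] Channel.fintypeOut

/-- The uniform distribution on the finite set `S`. -/
def uniformWeight {G : Type} [DecidableEq G] (S : Finset G) (x : G) : ℝ :=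
  if x ∈ S then (1 : ℝ) / S.card else 0

namespace Channel

variable {G : Type} [Fintype G]

/-- `I(X;Y)` in bits, for the input `X` distributed according to `p` and the output `Y`. -/
def mutualInfo (W : Channel.{u} G) (p : G → ℝ) : ℝ :=
  ∑ x, ∑ y, p x * W.prob x y * Real.logb 2 (W.prob x y / ∑ x', p x' * W.prob x' y)

/-- The symmetric capacity: `I(X;Y)` with `X` uniform on the whole input alphabet. -/
def symmetricCapacity [DecidableEq G] (W : Channel.{u} G) : ℝ :=
  W.mutualInfo (uniformWeight Finset.univ)

/-- `W^-(y₁,y₂|u₁) = ∑_{u₂} (1/q) W(y₁|u₁+u₂) W(y₂|u₂)`. -/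
def minus [AddCommGroup G] (W : Channel.{u} G) : Channel.{u} G where
  Out := W.Out × W.Out
  prob u₁ y := ∑ u₂ : G, (1 / (Fintype.card G : ℝ)) * W.prob (u₁ + u₂) y.1 * W.prob u₂ y.2
  prob_nonneg u₁ y := Finset.sum_nonneg fun u₂ _ =>
    mul_nonneg (mul_nonneg (by positivity) (W.prob_nonneg _ _)) (W.prob_nonneg _ _)
  sum_prob u₁ := by
    rw [Finset.sum_comm]
    simp only [Fintype.sum_prod_type, ← Finset.mul_sum, W.sum_prob, mul_one]
    simp

/-- `W^+(y₁,y₂,u₁|u₂) = (1/q) W(y₁|u₁+u₂) W(y₂|u₂)`. -/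
def plus [AddCommGroup G] (W : Channel.{u} G) : Channel.{u} G where
  Out := W.Out × W.Out × G
  prob u₂ z := (1 / (Fintype.card G : ℝ)) * W.prob (z.2.2 + u₂) z.1 * W.prob u₂ z.2.1
  prob_nonneg u₂ z :=
    mul_nonneg (mul_nonneg (by positivity) (W.prob_nonneg _ _)) (W.prob_nonneg _ _)
  sum_prob u₂ := by
    simp only [Fintype.sum_prod_type]
    have h : ∀ y₁ : W.Out, ∑ y₂ : W.Out, ∑ u₁ : G,
        1 / (Fintype.card G : ℝ) * W.prob (u₁ + u₂) y₁ * W.prob u₂ y₂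
        = ∑ u₁ : G, 1 / (Fintype.card G : ℝ) * W.prob (u₁ + u₂) y₁ := by
      intro y₁
      rw [Finset.sum_comm]
      simp only [← Finset.mul_sum, W.sum_prob, mul_one]
    simp only [h]
    rw [Finset.sum_comm]
    simp only [← Finset.mul_sum, W.sum_prob, mul_one]
    simp

/-- The synthesized channel `W^{b₁b₂⋯bₙ} = (⋯((W^{b₁})^{b₂})⋯)^{bₙ}`, where the bit `1` (`true`)
stands for `+` and the bit `0` (`false`) for `-`. -/
def synth [AddCommGroup G] (W : Channel.{u} G) {n : ℕ} (b : Fin n → Bool) : Channel.{u} G :=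
  (List.ofFn b).foldl (fun V s => if s then V.plus else V.minus) W

/-- Block transition probabilities `∏ᵢ W(yᵢ|xᵢ)` of the memoryless channel. -/
def blockProb {ι : Type} [Fintype ι] (W : Channel.{u} G) (x : ι → G) (y : ι → W.Out) : ℝ :=
  ∏ i, W.prob (x i) (y i)

/-! ## Channels with input `ℤ/4` -/

/-- `I₂ = I(X₁;Y)` with `X₁` uniform on `H₁ = {0,2}`. -/
def I2 (W : Channel.{u} (ZMod 4)) : ℝ := W.mutualInfo (uniformWeight {0, 2})

/-- `I₂' = I(X₁';Y)` with `X₁'` uniform on `1 + H₁ = {1,3}`. -/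
def I2' (W : Channel.{u} (ZMod 4)) : ℝ := W.mutualInfo (uniformWeight {1, 3})

/-- `I₂ + I₂'`. -/
def I2Sum (W : Channel.{u} (ZMod 4)) : ℝ := W.I2 + W.I2'

end Channel

/-- The process with values `(I₂ + I₂')ⁿ = (I₂ + I₂')(W^{b₁⋯bₙ})`; the bit `b_{k+1}` is `B k`. -/
def I2SumSeq {Ω : Type v} (W : Channel.{u} (ZMod 4)) (B : ℕ → Ω → Bool) (n : ℕ) (ω : Ω) : ℝ :=
  (W.synth fun k : Fin n => B k ω).I2Sum

/-- The filtration `ℱₙ = σ(b₁,…,bₙ)`. -/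
def bitFiltration {Ω : Type v} [mΩ : MeasurableSpace Ω] (B : ℕ → Ω → Bool)
    (hB : ∀ k, Measurable (B k)) : Filtration ℕ mΩ where
  seq n := ⨆ k : Fin n, MeasurableSpace.comap (B k) inferInstance
  mono' _ n hmn := iSup_le fun k =>
    le_iSup (fun j : Fin n => MeasurableSpace.comap (B j) inferInstance) (Fin.castLE hmn k)
  le' _ := iSup_le fun k => (hB k).comap_le

/-! ## Rates of group codes -/

/-- Average error probability `(1/M) ∑ₘ Wⁿ(d(Yⁿ) ≠ m | Xⁿ = e(m))`. -/
def blockErrorProb {G : Type} [Fintype G] (W : Channel.{u} G) {n M : ℕ}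
    (e : Fin M → Fin n → G) (d : (Fin n → W.Out) → Fin M) : ℝ :=
  (1 / (M : ℝ)) * ∑ m, ∑ y, if d y ≠ m then W.blockProb (e m) y else 0

/-- The rate `R` is achievable over `W` using group codes, that is, with codebooks that are
subgroups of `Gⁿ`. -/
def IsGroupAchievable {G : Type} [Fintype G] [AddCommGroup G] (W : Channel.{u} G) (R : ℝ) : Prop :=
  ∀ ε > 0, ∀ᶠ n : ℕ in atTop,
    ∃ (C : AddSubgroup (Fin n → G)) (M : ℕ) (e : Fin M → Fin n → G) (d : (Fin n → W.Out) → Fin M),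
      Function.Injective e ∧ Set.range e = (C : Set (Fin n → G)) ∧
      R - ε ≤ Real.logb 2 M / n ∧ blockErrorProb W e d ≤ ε

/-- `C` is the group capacity of `W`: the maximum rate achievable using group codes. -/
def IsGroupCapacity {G : Type} [Fintype G] [AddCommGroup G] (W : Channel.{u} G) (C : ℝ) : Prop :=
  IsGreatest {R | IsGroupAchievable W R} C

/-! ## Standard polar codes

The positions `1, …, N = 2ⁿ` are identified with their binary expansions `b₁⋯bₙ` (most significant
bit first, `i - 1 = ∑ bₖ 2^{n-k}`), so that their order is the lexicographic one and the `i`-th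
synthesized channel `W_N^{(i)}` is `W^{b₁⋯bₙ}`. -/

/-- The kernel `F = [[1,0],[1,1]]`. -/
def polarKernel (r c : Bool) : ℕ := if c ≤ r then 1 else 0

/-- The generator matrix `G_N = B_N F^{⊗n}`, with `B_N` the bit reversal permutation of the rows. -/
def polarMatrix (n : ℕ) (b c : Fin n → Bool) : ℕ := ∏ k, polarKernel (b k.rev) (c k)

/-- The polar transform `u ↦ u G_N` on `G^N`. -/
def polarEncode (G : Type) [AddCommGroup G] (n : ℕ) :
    ((Fin n → Bool) → G) →+ ((Fin n → Bool) → G) where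
  toFun u c := ∑ b, polarMatrix n b c • u b
  map_zero' := by funext c; simp
  map_add' u v := by funext c; simp [Finset.sum_add_distrib]

/-- The standard polar code with information set `A`: the group code
`{u G_N | uᵢ = 0 for i ∉ A}`. -/
def standardPolarCode (G : Type) [AddCommGroup G] (n : ℕ) (A : Finset (Fin n → Bool)) :
    AddSubgroup ((Fin n → Bool) → G) :=
  AddSubgroup.map (polarEncode G n)
    { carrier := {u | ∀ b, b ∉ A → u b = 0}
      zero_mem' := fun _ _ => rfl
      add_mem' := fun {u v} hu hv b hb => by simp [hu b hb, hv b hb]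
      neg_mem' := fun {u} hu b hb => by simp [hu b hb] }

/-- The rate `log₂ |C| / N` of the standard polar code with information set `A`. -/
def standardPolarCodeRate (G : Type) [AddCommGroup G] (n : ℕ) (A : Finset (Fin n → Bool)) : ℝ :=
  Real.logb 2 (Nat.card (standardPolarCode G n A)) / 2 ^ n

/-- The rate `R` is attained by standard polar codes for `W`: for every tolerance `ε` and all large
`n`, the rate `R - ε` is available when information symbols (ranging over all of `G`) are sent only
through synthesized channels that are perfect up to `ε` bits and all other positions are fixed. -/
def IsStandardPolarRate {G : Type} [Fintype G] [DecidableEq G] [AddCommGroup G]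
    (W : Channel.{u} G) (R : ℝ) : Prop :=
  ∀ ε > 0, ∀ᶠ n : ℕ in atTop, ∃ A : Finset (Fin n → Bool),
    (∀ b ∈ A, Real.logb 2 (Fintype.card G) - ε ≤ (W.synth b).symmetricCapacity) ∧
    R - ε ≤ standardPolarCodeRate G n A

/-- A successive decision rule: the symbol at position `i` is decided from the channel outputs and
the symbols at the preceding positions. -/
def SCRule (G : Type) (Y : Type u) (n : ℕ) : Type u :=
  (i : Fin n → Bool) → ((Fin n → Bool) → Y) → ({j : Fin n → Bool // toLex j < toLex i} → G) → G

open Classical in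
/-- Block error probability of successive cancellation decoding with information set `A`, the fixed
symbols at the positions outside `A` being known to the decoder; average over uniform
information symbols and uniform fixed symbols. The decoder, which goes through the positions in
order and feeds its own decisions back, is wrong somewhere if and only if some decision on a
position of `A`, given the true past, is wrong. -/
def scErrorProb {G : Type} [Fintype G] [AddCommGroup G] (W : Channel.{u} G) (n : ℕ)
    (A : Finset (Fin n → Bool)) (f : SCRule G W.Out n) : ℝ :=
  ∑ u : (Fin n → Bool) → G, (1 / (Fintype.card G : ℝ) ^ (2 ^ n)) *
    ∑ y : (Fin n → Bool) → W.Out,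
      if ∃ i ∈ A, f i y (fun j => u j.1) ≠ u i then W.blockProb (polarEncode G n u) y else 0

/-- The rate `R` is achievable over `W` by standard polar codes (full-alphabet information symbols
on a set `A`, everything else fixed) under successive cancellation decoding. -/
def IsSCPolarAchievable {G : Type} [Fintype G] [AddCommGroup G] (W : Channel.{u} G) (R : ℝ) :
    Prop :=
  ∀ ε > 0, ∀ᶠ n : ℕ in atTop, ∃ (A : Finset (Fin n → Bool)) (f : SCRule G W.Out n),
    R - ε ≤ standardPolarCodeRate G n A ∧ scErrorProb W n A f ≤ ε

/-! ## Channel 3 -/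

/-- The transition matrix of Channel 3 (rows: inputs `0,1,2,3`; columns: the two outputs). Inputs
`0` and `1` are received without error as the first and the second output; inputs `2` and `3`
likewise, but with crossover probability `lam`. -/
def channel3Matrix (lam : ℝ) : Matrix (Fin 4) (Fin 2) ℝ :=
  !![1, 0; 0, 1; 1 - lam, lam; lam, 1 - lam]

/-- Channel 3 with parameter `lam`. -/
def channel3 (lam : ℝ) (h0 : 0 ≤ lam) (h1 : lam ≤ 1) : Channel.{0} (ZMod 4) where
  Out := Fin 2
  prob x y := channel3Matrix lam (x : Fin 4) y
  prob_nonneg x y := by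
    have h2 : 0 ≤ 1 - lam := sub_nonneg.2 h1
    change Fin 4 at x
    fin_cases x <;> fin_cases y <;> simp [channel3Matrix, h0, h1]
  sum_prob x := by
    change Fin 4 at x
    fin_cases x <;> simp [channel3Matrix]

/-- Channel 3 with `λ = 0.2`. -/
def channel3At : Channel.{0} (ZMod 4) := channel3 (1 / 5) (by norm_num) (by norm_num)

end

/-! Write x₁ = u₁ + u₂ and x₂ = u₂ for the two channel inputs of a polarization step, and call the
cosets {0,2} and {1,3} even and odd. `pairInfo` measures the information about a fair choice between
two likelihoods; I₂ + I₂' is half its sum over the outputs and the two cosets.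

Supermartingale. Once the cosets of x₁ and x₂ are fixed, the inputs are two independent bits and the
chain rule `pairInfo_chain` conserves their information. For W⁺ both cosets are known, since u₁ is
an output. For W⁻ only the coset of u₁ is known: the likelihoods of the coset pairs (even, even) and
(odd, odd) are added, and so are those of the two mixed pairs. By convexity (`pairInfo_add_le`) this
can only lose information, which gives `I2Sum_minus_add_plus_le`.

Polar codes. A synthesized channel used for a full symbol has I₂ + I₂' near 2: in the sense (a)
because the coset accounts for at most one of its two bits (`symmetricCapacity_le`), in the sense
(b) by Fano's inequality (`HasDecoder.le_I2Sum`), since decisions given the true past form a decoder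
for the synthesized channel (`hasDecoder_synth`). The average of the nonnegative I₂ + I₂' over all
positions is at most its mean after one step, which bounds the number of usable positions and hence
the rate.

Group capacity, converse. For a subgroup C with two-torsion T, |C| ≤ |T|². A decoder told every
symbol modulo {0,2} still has to resolve T, and each coordinate supplies at most (I₂ + I₂')/2 bits
when I₂ = I₂'. So log |T| is asymptotically at most n(I₂ + I₂')/2 (`fano_addSubgroup`).

Group capacity, achievability. A random matrix over ℤ/4 is used with a threshold decoder. A wrong
message u' = a u + β is governed by I(W) if β has an odd entry, by (I₂ + I₂')/2 if β is even and
nonzero, and by `MultiplesDetected` if β = 0. There are about 4^k, 2^k and 4 such messages, so I₂ +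
I₂' is reached whenever it does not exceed I(W).

For Channel 3 the remaining claims, including the strict loss in the first step, are numerical. -/

noncomputable section

/-! ### Information about a binary choice -/

theorem sum_zmod_four {M : Type*} [AddCommMonoid M] (f : ZMod 4 → M) :
    ∑ x, f x = f 0 + f 1 + f 2 + f 3 :=
  Fin.sum_univ_four f

/-- The unnormalized information (in bits) about a fair binary choice carried by an observation
whose likelihoods under the two alternatives are `a` and `b`. -/
def pairInfo (a b : ℝ) : ℝ :=
  a * Real.logb 2 (2 * a / (a + b)) + b * Real.logb 2 (2 * b / (a + b))

theorem pairInfo_smul {c : ℝ} (hc : 0 ≤ c) (a b : ℝ) :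
    pairInfo (c * a) (c * b) = c * pairInfo a b := by
  rcases hc.eq_or_lt with rfl | hc
  · simp [pairInfo]
  · have h : ∀ t, 2 * (c * t) / (c * a + c * b) = 2 * t / (a + b) := fun t => by
      rw [← mul_add, mul_left_comm, mul_div_mul_left _ _ hc.ne']
    simp only [pairInfo, h]
    ring

/-- Gibbs' inequality for a single term. -/
theorem sub_le_mul_log_div {p q : ℝ} (hp : 0 ≤ p) (hq : 0 ≤ q) (h : q = 0 → p = 0) :
    p - q ≤ p * Real.log (p / q) := by
  rcases hp.eq_or_lt with rfl | hp
  · simpa using hq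
  · have hq : 0 < q := lt_of_le_of_ne hq fun h0 => hp.ne' (h h0.symm)
    have h1 := Real.one_sub_inv_le_log_of_pos (div_pos hp hq)
    have h2 := mul_le_mul_of_nonneg_left h1 hp.le
    have h3 : p * (1 - (p / q)⁻¹) = p - q := by field_simp
    linarith

/-- The log-sum inequality for two terms. -/
theorem logsum_two {a₁ a₂ c₁ c₂ : ℝ} (ha₁ : 0 ≤ a₁) (ha₂ : 0 ≤ a₂) (hc₁ : 0 ≤ c₁) (hc₂ : 0 ≤ c₂)
    (h₁ : c₁ = 0 → a₁ = 0) (h₂ : c₂ = 0 → a₂ = 0) :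
    (a₁ + a₂) * Real.log ((a₁ + a₂) / (c₁ + c₂)) ≤
      a₁ * Real.log (a₁ / c₁) + a₂ * Real.log (a₂ / c₂) := by
  rcases ha₁.eq_or_lt with rfl | ha₁'
  · rcases ha₂.eq_or_lt with rfl | ha₂'
    · simp
    have hc₂' : 0 < c₂ := lt_of_le_of_ne hc₂ fun h0 => ha₂'.ne' (h₂ h0.symm)
    simp only [zero_add, zero_mul]
    gcongr
    linarith
  rcases ha₂.eq_or_lt with rfl | ha₂'
  · have hc₁' : 0 < c₁ := lt_of_le_of_ne hc₁ fun h0 => ha₁'.ne' (h₁ h0.symm)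
    simp only [add_zero, zero_mul]
    gcongr
    linarith
  have hc₁' : 0 < c₁ := lt_of_le_of_ne hc₁ fun h0 => ha₁'.ne' (h₁ h0.symm)
  have hc₂' : 0 < c₂ := lt_of_le_of_ne hc₂ fun h0 => ha₂'.ne' (h₂ h0.symm)
  set A := a₁ + a₂
  set C := c₁ + c₂
  have hA : 0 < A := by positivity
  have hC : 0 < C := by positivity
  have key : ∀ a c, 0 < a → 0 < c →
      a - c * (A / C) ≤ a * Real.log (a / c) - a * Real.log (A / C) := by
    intro a c ha hc
    have := sub_le_mul_log_div ha.le (q := c * (A / C)) (by positivity)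
      (fun h => absurd h (by positivity))
    rw [← div_div, Real.log_div (by positivity) (by positivity)] at this
    linarith
  have k1 := key a₁ c₁ ha₁' hc₁'
  have k2 := key a₂ c₂ ha₂' hc₂'
  have : c₁ * (A / C) + c₂ * (A / C) = A := by
    rw [← add_mul]
    change C * (A / C) = A
    field_simp
  have e : A * Real.log (A / C) = a₁ * Real.log (A / C) + a₂ * Real.log (A / C) := by
    rw [← add_mul]
  have : a₁ + a₂ = A := rfl
  linarith

theorem pairInfo_eq_log (a b : ℝ) : pairInfo a b =
    (a * Real.log (a / ((a + b) / 2)) + b * Real.log (b / ((a + b) / 2))) / Real.log 2 := by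
  have h : ∀ t, 2 * t / (a + b) = t / ((a + b) / 2) := fun t => by
    rw [div_div_eq_mul_div, mul_comm]
  simp only [pairInfo, Real.logb, h]
  ring

/-- Merging two observations loses information: the log-sum inequality is applied to each
alternative, against the mean of the two likelihoods. -/
theorem pairInfo_add_le {a₁ a₂ b₁ b₂ : ℝ} (ha₁ : 0 ≤ a₁) (ha₂ : 0 ≤ a₂) (hb₁ : 0 ≤ b₁)
    (hb₂ : 0 ≤ b₂) :
    pairInfo (a₁ + a₂) (b₁ + b₂) ≤ pairInfo a₁ b₁ + pairInfo a₂ b₂ := by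
  simp only [pairInfo_eq_log, ← add_div]
  refine div_le_div_of_nonneg_right ?_ (Real.log_pos (by norm_num)).le
  have h1 := logsum_two ha₁ ha₂ (c₁ := (a₁ + b₁) / 2) (c₂ := (a₂ + b₂) / 2)
    (by positivity) (by positivity) (fun h => by linarith) (fun h => by linarith)
  have h2 := logsum_two hb₁ hb₂ (c₁ := (a₁ + b₁) / 2) (c₂ := (a₂ + b₂) / 2)
    (by positivity) (by positivity) (fun h => by linarith) (fun h => by linarith)
  have e : (a₁ + b₁) / 2 + (a₂ + b₂) / 2 = (a₁ + a₂ + (b₁ + b₂)) / 2 := by ring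
  rw [e] at h1 h2
  linarith

/-- The chain rule for the information about two independent fair binary choices and their sum. -/
theorem pairInfo_chain {a a' b b' : ℝ} (ha : 0 ≤ a) (ha' : 0 ≤ a') (hb : 0 ≤ b) (hb' : 0 ≤ b') :
    pairInfo (a * b) (a' * b') + pairInfo (a * b') (a' * b)
      + pairInfo (a * b + a' * b') (a * b' + a' * b)
      = pairInfo a a' * (b + b') + pairInfo b b' * (a + a') := by
  -- For each outcome, the posterior of the pair given the parity of the two bits times the
  -- posterior of that parity is the product of the two single posteriors, because the total
  -- likelihood factors as (x + x')(y + y'). If the outcome has likelihood zero, both sides vanish.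
  have key : ∀ x x' y y' : ℝ, 0 ≤ x → 0 ≤ x' → 0 ≤ y → 0 ≤ y' →
      x * y * Real.logb 2 (2 * (x * y) / (x * y + x' * y'))
        + x * y * Real.logb 2 (2 * (x * y + x' * y') / ((x * y + x' * y') + (x * y' + x' * y)))
      = x * y * Real.logb 2 (2 * x / (x + x')) + x * y * Real.logb 2 (2 * y / (y + y')) := by
    intro x x' y y' hx hx' hy hy'
    rcases hx.eq_or_lt with rfl | hx
    · simp
    rcases hy.eq_or_lt with rfl | hy
    · simp
    rw [← mul_add, ← mul_add, ← Real.logb_mul (by positivity) (by positivity),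
      ← Real.logb_mul (by positivity) (by positivity)]
    congr 2
    have : (x * y + x' * y') + (x * y' + x' * y) = (x + x') * (y + y') := by ring
    rw [this]
    field_simp
  have k1 := key a a' b b' ha ha' hb hb'
  have k2 := key a' a b' b ha' ha hb' hb
  have k3 := key a a' b' b ha ha' hb' hb
  have k4 := key a' a b b' ha' ha hb hb'
  simp only [pairInfo]
  rw [add_comm (a' * b') (a * b), add_comm (a' * b) (a * b'), add_comm a' a,
    add_comm b' b] at k2
  rw [add_comm (a * b') (a' * b), add_comm b' b] at k3
  rw [add_comm (a' * b') (a * b), add_comm a' a] at k4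
  rw [add_comm (a * b') (a' * b)] at *
  rw [add_comm (a' * b + a * b') (a * b + a' * b')] at k3 k4
  linear_combination k1 + k2 + k3 + k4

/-! ### One polarization step does not increase I₂ + I₂' -/

namespace Channel

theorem I2_eq (W : Channel.{u} (ZMod 4)) :
    W.I2 = ∑ y, pairInfo (W.prob 0 y) (W.prob 2 y) / 2 := by
  have h0 : uniformWeight ({0, 2} : Finset (ZMod 4)) 0 = 1 / 2 := by
    rw [uniformWeight, if_pos (by decide)]; simp [show (0 : ZMod 4) ≠ 2 by decide]
  have h1 : uniformWeight ({0, 2} : Finset (ZMod 4)) 1 = 0 := if_neg (by decide)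
  have h2 : uniformWeight ({0, 2} : Finset (ZMod 4)) 2 = 1 / 2 := by
    rw [uniformWeight, if_pos (by decide)]; simp [show (0 : ZMod 4) ≠ 2 by decide]
  have h3 : uniformWeight ({0, 2} : Finset (ZMod 4)) 3 = 0 := if_neg (by decide)
  simp only [I2, mutualInfo, sum_zmod_four, h0, h1, h2, h3, zero_mul, add_zero,
    Finset.sum_const_zero, ← Finset.sum_add_distrib]
  refine Finset.sum_congr rfl fun y _ => ?_
  have e : ∀ t, t / (1 / 2 * W.prob 0 y + 1 / 2 * W.prob 2 y)
      = 2 * t / (W.prob 0 y + W.prob 2 y) := fun t => by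
    rw [← mul_add, one_div, inv_mul_eq_div, div_div_eq_mul_div, mul_comm]
  simp only [pairInfo, e]
  ring

theorem I2'_eq (W : Channel.{u} (ZMod 4)) :
    W.I2' = ∑ y, pairInfo (W.prob 1 y) (W.prob 3 y) / 2 := by
  have h0 : uniformWeight ({1, 3} : Finset (ZMod 4)) 0 = 0 := if_neg (by decide)
  have h1 : uniformWeight ({1, 3} : Finset (ZMod 4)) 1 = 1 / 2 := by
    rw [uniformWeight, if_pos (by decide)]; simp [show (1 : ZMod 4) ≠ 3 by decide]
  have h2 : uniformWeight ({1, 3} : Finset (ZMod 4)) 2 = 0 := if_neg (by decide)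
  have h3 : uniformWeight ({1, 3} : Finset (ZMod 4)) 3 = 1 / 2 := by
    rw [uniformWeight, if_pos (by decide)]; simp [show (1 : ZMod 4) ≠ 3 by decide]
  simp only [I2', mutualInfo, sum_zmod_four, h0, h1, h2, h3, zero_mul, add_zero, zero_add,
    Finset.sum_const_zero, ← Finset.sum_add_distrib]
  refine Finset.sum_congr rfl fun y _ => ?_
  have e : ∀ t, t / (1 / 2 * W.prob 1 y + 1 / 2 * W.prob 3 y)
      = 2 * t / (W.prob 1 y + W.prob 3 y) := fun t => by
    rw [← mul_add, one_div, inv_mul_eq_div, div_div_eq_mul_div, mul_comm]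
  simp only [pairInfo, e]
  ring

theorem I2Sum_eq (W : Channel.{u} (ZMod 4)) :
    W.I2Sum = ∑ y, (pairInfo (W.prob 0 y) (W.prob 2 y) + pairInfo (W.prob 1 y) (W.prob 3 y)) / 2 := by
  rw [I2Sum, I2_eq, I2'_eq, ← Finset.sum_add_distrib]
  exact Finset.sum_congr rfl fun y _ => by ring

theorem I2Sum_minus_add_plus_le (W : Channel.{u} (ZMod 4)) :
    W.minus.I2Sum + W.plus.I2Sum ≤ 2 * W.I2Sum := by
  have e10 : (1 + 1 : ZMod 4) = 2 := by decide
  have e : (1 + 2 : ZMod 4) = 3 := by decide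
  have e2 : (1 + 3 : ZMod 4) = 0 := by decide
  have e3 : (2 + 1 : ZMod 4) = 3 := by decide
  have e4 : (2 + 2 : ZMod 4) = 0 := by decide
  have e5 : (2 + 3 : ZMod 4) = 1 := by decide
  have e6 : (3 + 1 : ZMod 4) = 0 := by decide
  have e7 : (3 + 2 : ZMod 4) = 1 := by decide
  have e8 : (3 + 3 : ZMod 4) = 2 := by decide
  have c : (Fintype.card (ZMod 4) : ℝ) = 4 := by norm_num [ZMod.card]
  have hsum : ∀ x, ∑ y, W.prob x y = 1 := W.sum_prob
  set D : W.Out → ℝ := fun y =>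
    pairInfo (W.prob 0 y) (W.prob 2 y) + pairInfo (W.prob 1 y) (W.prob 3 y) with hD
  set T : W.Out → ℝ := fun y => W.prob 0 y + W.prob 1 y + W.prob 2 y + W.prob 3 y with hT
  have hTsum : ∑ y, T y = 4 := by
    simp only [hT, Finset.sum_add_distrib, hsum]; norm_num
  have hrhs : 2 * W.I2Sum = ∑ y₁, ∑ y₂, (D y₁ * T y₂ + D y₂ * T y₁) / 8 := by
    rw [I2Sum_eq]
    simp only [add_div, Finset.sum_add_distrib, ← Finset.sum_div, ← Finset.mul_sum,
      ← Finset.sum_mul, hTsum]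
    simp only [hD, Finset.sum_add_distrib]
    ring
  rw [hrhs, I2Sum_eq, I2Sum_eq]
  change (∑ y : W.Out × W.Out, _) + (∑ y : W.Out × W.Out × ZMod 4, _) ≤ _
  simp only [Fintype.sum_prod_type, ← Finset.sum_add_distrib]
  refine Finset.sum_le_sum fun y₁ _ => Finset.sum_le_sum fun y₂ _ => ?_
  have ha : ∀ x, 0 ≤ W.prob x y₁ := fun x => W.prob_nonneg x y₁
  have hb : ∀ x, 0 ≤ W.prob x y₂ := fun x => W.prob_nonneg x y₂
  simp only [minus, plus, sum_zmod_four, c, zero_add, add_zero, e10, e, e2, e3, e4, e5, e6, e7, e8,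
    mul_assoc, ← mul_add, pairInfo_smul (show (0 : ℝ) ≤ 1 / 4 by norm_num), hD, hT]
  set a0 := W.prob 0 y₁
  set a1 := W.prob 1 y₁
  set a2 := W.prob 2 y₁
  set a3 := W.prob 3 y₁
  set b0 := W.prob 0 y₂
  set b1 := W.prob 1 y₂
  set b2 := W.prob 2 y₂
  set b3 := W.prob 3 y₂
  have h0 : 0 ≤ a0 := ha 0
  have h1 : 0 ≤ a1 := ha 1
  have h2 : 0 ≤ a2 := ha 2
  have h3 : 0 ≤ a3 := ha 3
  have k0 : 0 ≤ b0 := hb 0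
  have k1 : 0 ≤ b1 := hb 1
  have k2 : 0 ≤ b2 := hb 2
  have k3 : 0 ≤ b3 := hb 3
  -- One chain rule for each pair of cosets of x₁ and x₂.
  have c00 := pairInfo_chain h0 h2 k0 k2
  have c01 := pairInfo_chain h0 h2 k1 k3
  have c10 := pairInfo_chain h1 h3 k0 k2
  have c11 := pairInfo_chain h1 h3 k1 k3
  -- W⁻ merges the coset pairs of equal parity when u₁ is even (`s0`) and those of opposite parity
  -- when u₁ is odd (`s1`).
  have s0 := pairInfo_add_le (a₁ := a0 * b0 + a2 * b2) (a₂ := a1 * b1 + a3 * b3)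
    (b₁ := a0 * b2 + a2 * b0) (b₂ := a1 * b3 + a3 * b1) (by positivity) (by positivity)
    (by positivity) (by positivity)
  have s1 := pairInfo_add_le (a₁ := a1 * b0 + a3 * b2) (a₂ := a2 * b1 + a0 * b3)
    (b₁ := a1 * b2 + a3 * b0) (b₂ := a2 * b3 + a0 * b1) (by positivity) (by positivity)
    (by positivity) (by positivity)
  have sym : ∀ a b, pairInfo a b = pairInfo b a := fun a b => by
    simp only [pairInfo, add_comm]
  have r0 : pairInfo (a0 * b0 + a1 * b1 + a2 * b2 + a3 * b3)
      (a2 * b0 + a3 * b1 + a0 * b2 + a1 * b3) = pairInfo (a0 * b0 + a2 * b2 + (a1 * b1 + a3 * b3))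
      (a0 * b2 + a2 * b0 + (a1 * b3 + a3 * b1)) := by congr 1 <;> ring
  have r1 : pairInfo (a1 * b0 + a2 * b1 + a3 * b2 + a0 * b3)
      (a3 * b0 + a0 * b1 + a1 * b2 + a2 * b3) = pairInfo (a1 * b0 + a3 * b2 + (a2 * b1 + a0 * b3))
      (a1 * b2 + a3 * b0 + (a2 * b3 + a0 * b1)) := by congr 1 <;> ring
  have r2 : pairInfo (a2 * b1 + a0 * b3) (a2 * b3 + a0 * b1)
      = pairInfo (a0 * b1 + a2 * b3) (a0 * b3 + a2 * b1) := by
    rw [sym]; congr 1 <;> ring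
  rw [r0, r1, sym (a2 * b0) (a0 * b2), sym (a3 * b1) (a1 * b3), sym (a3 * b0) (a1 * b2),
    sym (a2 * b1) (a0 * b3)]
  rw [r2] at s1
  linarith

end Channel

/-! ### Synthesized channels and the supermartingale property -/

namespace Channel

variable {G : Type} [Fintype G]

theorem synth_zero [AddCommGroup G] (W : Channel.{u} G) (b : Fin 0 → Bool) : W.synth b = W := by
  simp [synth]

/-- Splitting off the last transform serves conditioning on the past bits; splitting off the first
one (`synth_cons`) serves the inductions over the starting channel. -/
theorem synth_succ_last [AddCommGroup G] (W : Channel.{u} G) {n : ℕ} (b : Fin (n + 1) → Bool) :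
    W.synth b = if b (Fin.last n) then (W.synth fun k : Fin n => b k.castSucc).plus
      else (W.synth fun k : Fin n => b k.castSucc).minus := by
  simp only [synth, List.ofFn_succ', List.concat_eq_append, List.foldl_append, List.foldl_cons,
    List.foldl_nil]

theorem synth_cons [AddCommGroup G] (W : Channel.{u} G) {n : ℕ} (s : Bool) (b : Fin n → Bool) :
    W.synth (Fin.cons s b : Fin (n + 1) → Bool)
      = (if s then W.plus else W.minus).synth b := by
  simp only [synth, List.ofFn_succ, List.foldl_cons, Fin.cons_zero, Fin.cons_succ]

end Channel

section Bits

variable {Ω : Type v} [mΩ : MeasurableSpace Ω] {μ : Measure Ω} {B : ℕ → Ω → Bool}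

theorem stronglyMeasurable_bits (hB : ∀ k, Measurable (B k)) (n : ℕ) (Φ : (Fin n → Bool) → ℝ) :
    StronglyMeasurable[bitFiltration B hB n] fun ω => Φ fun k => B k ω := by
  have h : Measurable[bitFiltration B hB n] fun ω (k : Fin n) => B k ω :=
    @measurable_pi_lambda _ _ _ (bitFiltration B hB n) _ _ fun k =>
      (comap_measurable (B k)).mono (le_iSup
        (fun j : Fin n => MeasurableSpace.comap (B j) inferInstance) k) le_rfl
  exact ((Measurable.of_discrete (f := Φ)).comp h).stronglyMeasurable

theorem exists_bound_bits (n : ℕ) (Φ : (Fin n → Bool) → ℝ) : ∃ c, ∀ b, ‖Φ b‖ ≤ c := by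
  obtain ⟨c, hc⟩ := (Set.finite_range fun b => ‖Φ b‖).bddAbove
  exact ⟨c, fun b => hc ⟨b, rfl⟩⟩

theorem integrable_bits [IsProbabilityMeasure μ] (hB : ∀ k, Measurable (B k)) (n : ℕ) (Φ : (Fin n → Bool) → ℝ) :
    Integrable (fun ω => Φ fun k : Fin n => B k ω) μ := by
  obtain ⟨c, hc⟩ := exists_bound_bits n Φ
  exact Integrable.of_bound
    (((stronglyMeasurable_bits hB n Φ).mono ((bitFiltration B hB).le n)).aestronglyMeasurable) c
    (Eventually.of_forall fun ω => hc _)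

/-- The indicator of the bit `1`. -/
def bitIndicator (s : Bool) : ℝ := if s then 1 else 0

theorem integral_bitIndicator (hB : ∀ k, Measurable (B k))
    (hfair : ∀ k, μ {ω | B k ω = true} = 1 / 2) (n : ℕ) :
    ∫ ω, bitIndicator (B n ω) ∂μ = 1 / 2 := by
  have hs : MeasurableSet {ω | B n ω = true} := hB n (MeasurableSet.singleton true)
  have : (fun ω => bitIndicator (B n ω)) = {ω | B n ω = true}.indicator 1 := by
    funext ω
    by_cases h : B n ω = true <;> simp [bitIndicator, h]
  rw [this, integral_indicator_one hs, Measure.real, hfair]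
  simp

/-- `B n` is the bit with number n + 1, whereas the filtration at time n uses only the indices below
n. -/
theorem indep_bit_bitFiltration (hB : ∀ k, Measurable (B k)) (hindep : iIndepFun B μ) (n : ℕ) :
    Indep (MeasurableSpace.comap (B n) inferInstance) (bitFiltration B hB n) μ := by
  have h := indep_iSup_of_disjoint (fun k => (hB k).comap_le) hindep.iIndep
    (S := {n}) (T := Set.Iio n) (by simp)
  simp only [Set.mem_singleton_iff, iSup_iSup_eq_left] at h
  refine indep_of_indep_of_le_right h (iSup_le fun k => ?_)
  exact le_iSup₂_of_le (f := fun (k : ℕ) (_ : k ∈ Set.Iio n) =>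
    MeasurableSpace.comap (B k) inferInstance) (k : ℕ) k.2 le_rfl

theorem condExp_bitIndicator [IsProbabilityMeasure μ] (hB : ∀ k, Measurable (B k)) (hindep : iIndepFun B μ)
    (hfair : ∀ k, μ {ω | B k ω = true} = 1 / 2) (n : ℕ) :
    μ[fun ω => bitIndicator (B n ω) | bitFiltration B hB n] =ᵐ[μ] fun _ => (1 / 2 : ℝ) := by
  have h := condExp_indep_eq (hB n).comap_le ((bitFiltration B hB).le n)
    (f := fun ω => bitIndicator (B n ω))
    ((Measurable.of_discrete (f := bitIndicator)).comp (comap_measurable (B n))).stronglyMeasurable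
    (indep_bit_bitFiltration hB hindep n)
  rwa [integral_bitIndicator hB hfair] at h

/-- The process is affine in the newest bit with coefficients known at time n, so only the
conditional mean of a fair bit has to be computed. -/
theorem I2SumSeq_succ {Ω : Type v} {B : ℕ → Ω → Bool} (W : Channel.{u} (ZMod 4)) (n : ℕ) :
    I2SumSeq W B (n + 1) = (fun ω => (W.synth fun k : Fin n => B k ω).minus.I2Sum) +
      (fun ω => (W.synth fun k : Fin n => B k ω).plus.I2Sum
        - (W.synth fun k : Fin n => B k ω).minus.I2Sum) * fun ω => bitIndicator (B n ω) := by
  funext ω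
  simp only [I2SumSeq, Channel.synth_succ_last, Pi.add_apply, Pi.mul_apply, bitIndicator,
    Fin.val_last, Fin.val_castSucc]
  by_cases h : B n ω = true <;> simp [h]

theorem integrable_bitIndicator [IsProbabilityMeasure μ] (hB : ∀ k, Measurable (B k)) (n : ℕ) :
    Integrable (fun ω => bitIndicator (B n ω)) μ :=
  Integrable.of_bound
    ((Measurable.of_discrete (f := bitIndicator)).comp (hB n)).aestronglyMeasurable 1
    (Eventually.of_forall fun ω => by
      simp only [bitIndicator]; split_ifs <;> simp)

theorem condExp_I2SumSeq_succ [IsProbabilityMeasure μ] (W : Channel.{u} (ZMod 4)) (hB : ∀ k, Measurable (B k))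
    (hindep : iIndepFun B μ) (hfair : ∀ k, μ {ω | B k ω = true} = 1 / 2) (n : ℕ) :
    μ[I2SumSeq W B (n + 1) | bitFiltration B hB n] =ᵐ[μ] fun ω =>
      ((W.synth fun k : Fin n => B k ω).minus.I2Sum
        + (W.synth fun k : Fin n => B k ω).plus.I2Sum) / 2 := by
  rw [I2SumSeq_succ]
  set f := fun ω => (W.synth fun k : Fin n => B k ω).minus.I2Sum
  set g := fun ω => (W.synth fun k : Fin n => B k ω).plus.I2Sum
    - (W.synth fun k : Fin n => B k ω).minus.I2Sum
  have hf : StronglyMeasurable[bitFiltration B hB n] f :=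
    stronglyMeasurable_bits hB n fun b => (W.synth b).minus.I2Sum
  have hg : StronglyMeasurable[bitFiltration B hB n] g :=
    stronglyMeasurable_bits hB n fun b => (W.synth b).plus.I2Sum - (W.synth b).minus.I2Sum
  have hfi : Integrable f μ := integrable_bits hB n fun b => (W.synth b).minus.I2Sum
  obtain ⟨c, hc⟩ := exists_bound_bits n
    fun b => (W.synth b).plus.I2Sum - (W.synth b).minus.I2Sum
  have hb := integrable_bitIndicator (μ := μ) hB n
  have hgb : Integrable (g * fun ω => bitIndicator (B n ω)) μ :=
    hb.bdd_mul (hg.mono ((bitFiltration B hB).le n)).aestronglyMeasurable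
      (Eventually.of_forall fun ω => hc _)
  have h1 := condExp_add hfi hgb (bitFiltration B hB n)
  have h2 := condExp_mul_of_stronglyMeasurable_left hg hgb hb
  have h3 := condExp_of_stronglyMeasurable ((bitFiltration B hB).le n) hf hfi
  filter_upwards [h1, h2, condExp_bitIndicator hB hindep hfair n] with ω e1 e2 e3
  rw [e1, Pi.add_apply, h3, e2, Pi.mul_apply, e3]
  simp only [f, g]
  ring

theorem supermartingale_I2SumSeq [IsProbabilityMeasure μ] (W : Channel.{u} (ZMod 4)) (hB : ∀ k, Measurable (B k))
    (hindep : iIndepFun B μ) (hfair : ∀ k, μ {ω | B k ω = true} = 1 / 2) :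
    Supermartingale (I2SumSeq W B) (bitFiltration B hB) μ := by
  refine supermartingale_nat (fun n => stronglyMeasurable_bits hB n fun b => (W.synth b).I2Sum)
    (fun n => integrable_bits hB n fun b => (W.synth b).I2Sum) fun n => ?_
  filter_upwards [condExp_I2SumSeq_succ W hB hindep hfair n] with ω e
  rw [e]
  have := (W.synth fun k : Fin n => B k ω).I2Sum_minus_add_plus_le
  simp only [I2SumSeq]
  linarith

theorem integral_I2SumSeq_one [IsProbabilityMeasure μ] (W : Channel.{u} (ZMod 4)) (hB : ∀ k, Measurable (B k))
    (hfair : ∀ k, μ {ω | B k ω = true} = 1 / 2) :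
    ∫ ω, I2SumSeq W B 1 ω ∂μ = (W.minus.I2Sum + W.plus.I2Sum) / 2 := by
  rw [I2SumSeq_succ]
  simp only [Channel.synth_zero, Pi.add_apply, Pi.mul_apply]
  rw [integral_add (integrable_const _) ((integrable_bitIndicator hB 0).const_mul _),
    integral_const_mul, integral_bitIndicator hB hfair]
  simp
  ring

end Bits

/-! ### Rate bounds for standard polar codes -/

/-- Gibbs' inequality: scoring with a guessed posterior (p, 1 - p) in place of the true one gives at
most the true information. -/
theorem pairInfo_ge {a b p : ℝ} (ha : 0 ≤ a) (hb : 0 ≤ b) (hp0 : 0 < p) (hp1 : p < 1) :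
    a * Real.logb 2 (2 * p) + b * Real.logb 2 (2 * (1 - p)) ≤ pairInfo a b := by
  have key : ∀ t q, 0 ≤ t → 0 < q → t ≤ a + b →
      t - (a + b) * q ≤ t * Real.log (2 * t / (a + b)) - t * Real.log (2 * q) := by
    intro t q ht hq hle
    rcases ht.eq_or_lt with rfl | ht
    · simp only [zero_sub, zero_mul, sub_zero, Left.neg_nonpos_iff]
      positivity
    have hs : 0 < a + b := ht.trans_le hle
    have h := sub_le_mul_log_div ht.le (q := (a + b) * q) (by positivity)
      (fun h => absurd h (by positivity))
    have e : Real.log (t / ((a + b) * q)) = Real.log (2 * t / (a + b)) - Real.log (2 * q) := by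
      rw [← Real.log_div (by positivity) (by positivity)]
      congr 1
      field_simp
    rw [e, mul_sub] at h
    exact h
  have k1 := key a p ha hp0 (by linarith)
  have k2 := key b (1 - p) hb (by linarith) (by linarith)
  have hl : 0 < Real.log 2 := Real.log_pos (by norm_num)
  simp only [pairInfo, Real.logb, mul_div_assoc', ← add_div]
  refine div_le_div_of_nonneg_right ?_ hl.le
  linarith

theorem pairInfo_nonneg {a b : ℝ} (ha : 0 ≤ a) (hb : 0 ≤ b) : 0 ≤ pairInfo a b := by
  have h := pairInfo_ge ha hb (p := 1 / 2) (by norm_num) (by norm_num)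
  norm_num at h
  exact h

namespace Channel

theorem I2Sum_nonneg (W : Channel.{u} (ZMod 4)) : 0 ≤ W.I2Sum := by
  rw [I2Sum_eq]
  exact Finset.sum_nonneg fun y _ => div_nonneg
    (add_nonneg (pairInfo_nonneg (W.prob_nonneg _ _) (W.prob_nonneg _ _))
      (pairInfo_nonneg (W.prob_nonneg _ _) (W.prob_nonneg _ _))) (by norm_num)

theorem sum_cons {M : Type*} [AddCommMonoid M] {n : ℕ} (f : (Fin (n + 1) → Bool) → M) :
    ∑ b, f b = (∑ b : Fin n → Bool, f (Fin.cons true b)) + ∑ b : Fin n → Bool, f (Fin.cons false b) := by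
  rw [← Fintype.sum_equiv (Fin.consEquiv fun _ => Bool) (fun p => f (Fin.cons p.1 p.2)) f
    (fun p => rfl), Fintype.sum_prod_type, Fintype.sum_bool]

theorem sum_I2Sum_synth_le (n : ℕ) (W : Channel.{u} (ZMod 4)) :
    ∑ b : Fin n → Bool, (W.synth b).I2Sum ≤ 2 ^ n * W.I2Sum := by
  induction n generalizing W with
  | zero => simp [synth_zero]
  | succ n ih =>
    simp only [sum_cons, synth_cons, if_true, Bool.false_eq_true, if_false]
    have := W.I2Sum_minus_add_plus_le
    have h2 : (0 : ℝ) < 2 ^ n := by positivity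
    calc _ ≤ 2 ^ n * W.plus.I2Sum + 2 ^ n * W.minus.I2Sum := add_le_add (ih _) (ih _)
      _ = 2 ^ n * (W.minus.I2Sum + W.plus.I2Sum) := by ring
      _ ≤ 2 ^ n * (2 * W.I2Sum) := by gcongr
      _ = 2 ^ (n + 1) * W.I2Sum := by ring

/-- Only the transforms after the first are estimated, so the loss of the first step is kept
exactly. This needs at least one step. -/
theorem sum_I2Sum_synth_le_of_pos {n : ℕ} (hn : n ≠ 0) (W : Channel.{u} (ZMod 4)) :
    ∑ b : Fin n → Bool, (W.synth b).I2Sum ≤ 2 ^ n * ((W.minus.I2Sum + W.plus.I2Sum) / 2) := by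
  obtain ⟨n, rfl⟩ := Nat.exists_eq_succ_of_ne_zero hn
  simp only [Nat.succ_eq_add_one, sum_cons, synth_cons, if_true, Bool.false_eq_true, if_false]
  calc _ ≤ 2 ^ n * W.plus.I2Sum + 2 ^ n * W.minus.I2Sum :=
        add_le_add (sum_I2Sum_synth_le _ _) (sum_I2Sum_synth_le _ _)
    _ = _ := by ring

theorem symmetricCapacity_eq (W : Channel.{u} (ZMod 4)) :
    W.symmetricCapacity = ∑ y, ∑ x, 1 / 4 * (W.prob x y *
      Real.logb 2 (4 * W.prob x y / (W.prob 0 y + W.prob 1 y + W.prob 2 y + W.prob 3 y))) := by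
  have hu : ∀ x : ZMod 4, uniformWeight Finset.univ x = 1 / 4 := fun x => by
    simp [uniformWeight, ZMod.card]
  simp only [symmetricCapacity, mutualInfo, hu]
  rw [Finset.sum_comm]
  refine Finset.sum_congr rfl fun y _ => Finset.sum_congr rfl fun x _ => ?_
  rw [← Finset.mul_sum, sum_zmod_four (fun x => W.prob x y), mul_assoc, one_div_mul_eq_div,
    ← one_div_mul_eq_div, one_div, inv_mul_eq_div 4 (_ + _), div_div_eq_mul_div, mul_comm 4]

/-- The input consists of its coset modulo {0,2}, which is worth at most one bit, and of the symbol
inside the coset, which contributes (I₂ + I₂')/2. -/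
theorem symmetricCapacity_le (W : Channel.{u} (ZMod 4)) :
    W.symmetricCapacity ≤ W.I2Sum / 2 + 1 := by
  have h1 : ∑ y, (W.prob 0 y + W.prob 1 y + W.prob 2 y + W.prob 3 y) / 4 = 1 := by
    simp only [← Finset.sum_div, Finset.sum_add_distrib, W.sum_prob]
    norm_num
  rw [symmetricCapacity_eq, I2Sum_eq, Finset.sum_div]
  nth_rw 2 [← h1]
  rw [← Finset.sum_add_distrib]
  refine Finset.sum_le_sum fun y _ => ?_
  -- Replacing the full likelihood s by that of the coset, p + q, increases the logarithm; the
  -- factor 4 instead of 2 is the bit spent on the coset.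
  have key : ∀ p q s : ℝ, 0 ≤ p → 0 ≤ q → p + q ≤ s →
      p * Real.logb 2 (4 * p / s) ≤ p * Real.logb 2 (2 * p / (p + q)) + p := by
    intro p q s hp hq hs
    rcases hp.eq_or_lt with rfl | hp
    · simp
    have e : Real.logb 2 (2 * p / (p + q)) + 1 = Real.logb 2 (4 * p / (p + q)) := by
      have : (1 : ℝ) = Real.logb 2 2 := by simp
      rw [this, ← Real.logb_mul (by positivity) (by positivity)]
      congr 1
      ring
    calc p * Real.logb 2 (4 * p / s) ≤ p * Real.logb 2 (4 * p / (p + q)) := by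
          have hs' : 0 < s := by linarith
          gcongr
          norm_num
      _ = _ := by rw [← e]; ring
  rw [sum_zmod_four]
  have n0 := W.prob_nonneg 0 y
  have n1 := W.prob_nonneg 1 y
  have n2 := W.prob_nonneg 2 y
  have n3 := W.prob_nonneg 3 y
  set s := W.prob 0 y + W.prob 1 y + W.prob 2 y + W.prob 3 y with hs
  have k0 := key _ _ s n0 n2 (by linarith)
  have k1 := key _ _ s n1 n3 (by linarith)
  have k2 := key _ _ s n2 n0 (by linarith)
  have k3 := key _ _ s n3 n1 (by linarith)
  rw [add_comm (W.prob 2 y)] at k2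
  rw [add_comm (W.prob 3 y)] at k3
  simp only [pairInfo]
  linarith

open Classical in
/-- A decision about the uniformly distributed input of `V` is possible with error probability at
most `ε`. -/
def HasDecoder {G : Type} [Fintype G] (V : Channel.{u} G) (ε : ℝ) : Prop :=
  ∃ d : V.Out → G,
    1 / (Fintype.card G : ℝ) * ∑ x, ∑ y, (if d y ≠ x then V.prob x y else 0) ≤ ε

/-- Fano's inequality for the information about an input on a known coset of `{0,2}`. -/
theorem HasDecoder.le_I2Sum {V : Channel.{u} (ZMod 4)} {ε : ℝ} (h0 : 0 < ε) (h1 : ε < 1 / 2)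
    (h : V.HasDecoder ε) : 2 * (1 - Real.binEntropy ε / Real.log 2) ≤ V.I2Sum := by
  obtain ⟨d, hd⟩ := h
  set α := Real.logb 2 (2 * (1 - ε)) with hα
  set β := Real.logb 2 (2 * ε) with hβ
  have hα0 : 0 ≤ α := Real.logb_nonneg (by norm_num) (by linarith)
  have hβ0 : β ≤ 0 := Real.logb_nonpos (by norm_num) (by linarith) (by linarith)
  have hl : 0 < Real.log 2 := Real.log_pos (by norm_num)
  have hent : 1 - Real.binEntropy ε / Real.log 2 = (1 - ε) * α + ε * β := by
    rw [hα, hβ, Real.logb, Real.logb, Real.log_mul (by norm_num) (by linarith),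
      Real.log_mul (by norm_num) (by linarith), Real.binEntropy, Real.log_inv, Real.log_inv]
    field_simp
    ring
  have key : ∀ y, ∑ x, (α * V.prob x y - (α - β) * (if d y ≠ x then V.prob x y else 0)) ≤
      pairInfo (V.prob 0 y) (V.prob 2 y) + pairInfo (V.prob 1 y) (V.prob 3 y) := by
    intro y
    have n0 := V.prob_nonneg 0 y
    have n1 := V.prob_nonneg 1 y
    have n2 := V.prob_nonneg 2 y
    have n3 := V.prob_nonneg 3 y
    have a1 := pairInfo_ge n0 n2 (p := ε) (by linarith) (by linarith)
    have a2 := pairInfo_ge n0 n2 (p := 1 - ε) (by linarith) (by linarith)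
    have b1 := pairInfo_ge n1 n3 (p := ε) (by linarith) (by linarith)
    have b2 := pairInfo_ge n1 n3 (p := 1 - ε) (by linarith) (by linarith)
    rw [sub_sub_cancel] at a2 b2
    rw [← hα, ← hβ] at a1 a2 b1 b2
    have q0 := mul_le_mul_of_nonneg_left (hβ0.trans hα0) n0
    have q1 := mul_le_mul_of_nonneg_left (hβ0.trans hα0) n1
    rw [sum_zmod_four]
    have : ∀ x : ZMod 4, x = 0 ∨ x = 1 ∨ x = 2 ∨ x = 3 := by decide
    -- The guessed posterior gives 1 - ε to the decoded symbol inside its coset. In the other coset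
    -- either guess is good enough, because β ≤ α.
    rcases this (d y) with e | e | e | e <;> rw [e]
    · rw [if_neg (by decide), if_pos (by decide), if_pos (by decide), if_pos (by decide)]
      linarith
    · rw [if_pos (by decide), if_neg (by decide), if_pos (by decide), if_pos (by decide)]
      linarith
    · rw [if_pos (by decide), if_pos (by decide), if_neg (by decide), if_pos (by decide)]
      linarith
    · rw [if_pos (by decide), if_pos (by decide), if_pos (by decide), if_neg (by decide)]
      linarith
  have hsum := Finset.sum_le_sum fun y (_ : y ∈ Finset.univ) => key y
  rw [Finset.sum_comm] at hsum
  simp only [Finset.sum_sub_distrib, ← Finset.mul_sum, V.sum_prob] at hsum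
  have herr : 1 / (Fintype.card (ZMod 4) : ℝ) *
      ∑ x, ∑ y, (if d y ≠ x then V.prob x y else 0) ≤ ε := by convert hd
  have c : (Fintype.card (ZMod 4) : ℝ) = 4 := by norm_num [ZMod.card]
  rw [c] at herr
  rw [hent, I2Sum_eq, ← Finset.sum_div]
  have hc : ∑ _x : ZMod 4, (1 : ℝ) = 4 := by simp [ZMod.card]
  rw [hc] at hsum
  have hE := mul_le_mul_of_nonneg_left herr (sub_nonneg.2 (hβ0.trans hα0))
  linarith

end Channel

/-- A codeword comes from a vector that vanishes outside A, and there are at most 4^|A| of these.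
The reverse inequality is not required. -/
theorem standardPolarCodeRate_le (n : ℕ) (A : Finset (Fin n → Bool)) :
    standardPolarCodeRate (ZMod 4) n A ≤ 2 * A.card / 2 ^ n := by
  rw [standardPolarCodeRate]
  refine div_le_div_of_nonneg_right ?_ (by positivity)
  have h1 : Nat.card (standardPolarCode (ZMod 4) n A) ≤ 4 ^ A.card := by
    rw [standardPolarCode]
    refine (Nat.card_image_le (Set.toFinite _)).trans ?_
    have h2 := Nat.card_le_card_of_injective
      (fun (u : {u : (Fin n → Bool) → ZMod 4 | ∀ b, b ∉ A → u b = 0}) (a : A) => u.1 a.1)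
      (by
        intro u v huv
        ext b
        by_cases hb : b ∈ A
        · exact congrFun huv ⟨b, hb⟩
        · rw [u.2 b hb, v.2 b hb])
    refine h2.trans ?_
    simp [ZMod.card]
  have hpos : 0 < Nat.card (standardPolarCode (ZMod 4) n A) := Nat.card_pos
  have h3 : (Nat.card (standardPolarCode (ZMod 4) n A) : ℝ) ≤ 2 ^ (2 * A.card : ℝ) := by
    rw [Real.rpow_mul (by norm_num), Real.rpow_natCast]
    norm_num
    exact_mod_cast h1
  rw [Real.logb_le_iff_le_rpow (by norm_num) (by exact_mod_cast hpos)]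
  exact h3

/-- If, for a quality `κ ε` tending to `1` as `ε → 0`, standard polar codes of rate `R - ε` use only
synthesized channels with `I₂ + I₂' ≥ 2 κ(ε)`, then `R` is at most the mean of `I₂ + I₂'` after one
polarization step. -/
theorem le_of_synth_quality {W : Channel.{u} (ZMod 4)} {R : ℝ} {κ : ℝ → ℝ}
    (hκ : Tendsto κ (nhdsWithin 0 (Set.Ioi 0)) (nhds 1))
    (h : ∀ᶠ ε in nhdsWithin 0 (Set.Ioi 0), ∃ n ≠ 0, ∃ A : Finset (Fin n → Bool),
      (∀ b ∈ A, 2 * κ ε ≤ (W.synth b).I2Sum) ∧ R - ε ≤ standardPolarCodeRate (ZMod 4) n A) :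
    R ≤ (W.minus.I2Sum + W.plus.I2Sum) / 2 := by
  have hlim : Tendsto (fun ε : ℝ => (R - ε) * κ ε) (nhdsWithin 0 (Set.Ioi 0))
      (nhds ((R - 0) * 1)) :=
    ((tendsto_const_nhds.sub tendsto_id).mono_left nhdsWithin_le_nhds).mul hκ
  rw [sub_zero, mul_one] at hlim
  refine le_of_tendsto hlim ?_
  filter_upwards [h, hκ.eventually (lt_mem_nhds zero_lt_one)] with ε ⟨n, hn, A, hA, hR⟩ hpos
  have hR' := hR.trans (standardPolarCodeRate_le n A)
  have h2 : (0 : ℝ) < 2 ^ n := by positivity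
  rw [le_div_iff₀ h2] at hR'
  -- Positions outside A may be added for free because their information is nonnegative.
  have hs : (A.card : ℝ) * (2 * κ ε) ≤ 2 ^ n * ((W.minus.I2Sum + W.plus.I2Sum) / 2) :=
    calc (A.card : ℝ) * (2 * κ ε) = ∑ b ∈ A, 2 * κ ε := by rw [Finset.sum_const, nsmul_eq_mul]
      _ ≤ ∑ b ∈ A, (W.synth b).I2Sum := Finset.sum_le_sum hA
      _ ≤ ∑ b, (W.synth b).I2Sum :=
        Finset.sum_le_univ_sum_of_nonneg fun b => (W.synth b).I2Sum_nonneg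
      _ ≤ _ := W.sum_I2Sum_synth_le_of_pos hn
  refine le_of_mul_le_mul_left ?_ h2
  calc 2 ^ n * ((R - ε) * κ ε) = (R - ε) * 2 ^ n * κ ε := by ring
    _ ≤ 2 * A.card * κ ε := by gcongr
    _ = A.card * (2 * κ ε) := by ring
    _ ≤ _ := hs

theorem IsStandardPolarRate.le {W : Channel.{u} (ZMod 4)} {R : ℝ} (h : IsStandardPolarRate W R) :
    R ≤ (W.minus.I2Sum + W.plus.I2Sum) / 2 := by
  -- From 2 - ε ≤ I ≤ (I₂ + I₂')/2 + 1 one gets I₂ + I₂' ≥ 2(1 - ε).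
  refine le_of_synth_quality (W := W) (κ := fun ε => 1 - ε) ?_ ?_
  · have : Tendsto (fun ε : ℝ => 1 - ε) (nhds 0) (nhds (1 - 0)) :=
      tendsto_const_nhds.sub tendsto_id
    rw [sub_zero] at this
    exact this.mono_left nhdsWithin_le_nhds
  · filter_upwards [self_mem_nhdsWithin] with ε hε
    obtain ⟨n, ⟨A, hA, hR⟩, hn⟩ := ((h ε hε).and (eventually_ne_atTop 0)).exists
    refine ⟨n, hn, A, fun b hb => ?_, hR⟩
    have h1 := hA b hb
    have h2 := (W.synth b).symmetricCapacity_le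
    have h3 : Real.logb 2 (Fintype.card (ZMod 4)) = 2 := by
      rw [ZMod.card, Real.logb_eq_iff_rpow_eq (by norm_num) (by norm_num) (by norm_num)]
      norm_num
    rw [h3] at h1
    linarith

/-! ### Recursive structure of the polar transform -/

section PolarTransform

variable {G : Type}

/-- The vector indexed by `n+1` bits whose two halves, according to the first bit, are `v` and
`w`. -/
def joinFront {n : ℕ} (v w : (Fin n → Bool) → G) (b : Fin (n + 1) → Bool) : G :=
  if b 0 then w (Fin.tail b) else v (Fin.tail b)

/-- The vector indexed by `n+1` bits that pairs up, according to the last bit, the entries of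
`z`. -/
def joinBack {Y : Type*} {n : ℕ} (z : (Fin n → Bool) → Y × Y) (c : Fin (n + 1) → Bool) : Y :=
  if c (Fin.last n) then (z (Fin.init c)).2 else (z (Fin.init c)).1

/-- `joinFront` as an equivalence. -/
def joinFrontEquiv (n : ℕ) : ((Fin n → Bool) → G) × ((Fin n → Bool) → G) ≃
    ((Fin (n + 1) → Bool) → G) where
  toFun p := joinFront p.1 p.2
  invFun u := (fun b => u (Fin.cons false b), fun b => u (Fin.cons true b))
  left_inv p := by simp [joinFront]
  right_inv u := by
    funext b
    have hb : Fin.cons (b 0) (Fin.tail b) = b := Fin.cons_self_tail b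
    by_cases h : b 0 = true
    · rw [h] at hb; simp [joinFront, h, hb]
    · rw [Bool.not_eq_true] at h; rw [h] at hb; simp [joinFront, h, hb]

/-- `joinBack` as an equivalence. -/
def joinBackEquiv (Y : Type*) (n : ℕ) : ((Fin n → Bool) → Y × Y) ≃ ((Fin (n + 1) → Bool) → Y) where
  toFun := joinBack
  invFun y c := (y (Fin.snoc c false : Fin (n + 1) → Bool), y (Fin.snoc c true : Fin (n + 1) → Bool))
  left_inv z := by funext c; simp [joinBack]
  right_inv y := by
    funext c
    have hc : (Fin.snoc (Fin.init c) (c (Fin.last n)) : Fin (n + 1) → Bool) = c :=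
      Fin.snoc_init_self c
    by_cases h : c (Fin.last n) = true
    · rw [h] at hc; simp [joinBack, h, hc]
    · rw [Bool.not_eq_true] at h; rw [h] at hc; simp [joinBack, h, hc]

/-- Because of the bit reversal, the first bit of the row index meets the last bit of the column
index. -/
theorem polarMatrix_cons_snoc (n : ℕ) (s t : Bool) (b c : Fin n → Bool) :
    polarMatrix (n + 1) (Fin.cons t b : Fin (n + 1) → Bool) (Fin.snoc c s : Fin (n + 1) → Bool)
      = polarMatrix n b c * polarKernel t s := by
  rw [polarMatrix, Fin.prod_univ_castSucc]
  simp [polarMatrix, Fin.rev_castSucc]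

variable [AddCommGroup G]

theorem polarEncode_apply (n : ℕ) (u : (Fin n → Bool) → G) (c : Fin n → Bool) :
    polarEncode G n u c = ∑ b, polarMatrix n b c • u b := rfl

theorem polarEncode_joinFront_snoc (n : ℕ) (v w : (Fin n → Bool) → G) (c : Fin n → Bool)
    (s : Bool) :
    polarEncode G (n + 1) (joinFront v w) (Fin.snoc c s : Fin (n + 1) → Bool)
      = (if s then 0 else polarEncode G n v c) + polarEncode G n w c := by
  simp only [polarEncode_apply, Channel.sum_cons, polarMatrix_cons_snoc, joinFront, Fin.cons_zero,
    Fin.tail_cons]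
  cases s <;> simp [polarKernel, add_comm]

/-- Neighbouring channel uses, which differ in the last bit, carry u₁ + u₂ and u₂, where u₁ and u₂
are letters of the encoded halves. So the long transform is the short one applied to copies of the
basic step. -/
theorem polarEncode_joinFront (n : ℕ) (v w : (Fin n → Bool) → G) :
    polarEncode G (n + 1) (joinFront v w) =
      joinBack fun c => (polarEncode G n v c + polarEncode G n w c, polarEncode G n w c) := by
  funext c
  have h := polarEncode_joinFront_snoc n v w (Fin.init c) (c (Fin.last n))
  rw [Fin.snoc_init_self] at h
  rw [h, joinBack]
  by_cases h' : c (Fin.last n) = true <;> simp [h']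

theorem polarEncode_injective (n : ℕ) : Function.Injective (polarEncode G n) := by
  induction n with
  | zero =>
    intro u v h
    funext b
    have := congrFun h b
    simp only [polarEncode_apply, Fintype.sum_unique, polarMatrix, Finset.univ_eq_empty,
      Finset.prod_empty, one_smul] at this
    exact (congrArg u (Subsingleton.elim _ _)).trans (this.trans (congrArg v (Subsingleton.elim _ _)))
  | succ n ih =>
    intro u v h
    obtain ⟨⟨u0, u1⟩, rfl⟩ := (joinFrontEquiv n).surjective u
    obtain ⟨⟨v0, v1⟩, rfl⟩ := (joinFrontEquiv n).surjective v
    change polarEncode G (n + 1) (joinFront u0 u1) = polarEncode G (n + 1) (joinFront v0 v1) at h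
    rw [polarEncode_joinFront, polarEncode_joinFront] at h
    have hinj : Function.Injective (joinBack : ((Fin n → Bool) → G × G) → _) :=
      (joinBackEquiv G n).injective
    have h' := hinj h
    have h1 : u1 = v1 := ih (funext fun c => congrArg Prod.snd (congrFun h' c))
    subst h1
    have h0 : u0 = v0 := ih (funext fun c =>
      add_right_cancel (congrArg Prod.fst (congrFun h' c)))
    rw [h0]

theorem toLex_cons_lt {n : ℕ} {s t : Bool} {b c : Fin n → Bool} :
    toLex (Fin.cons s b : Fin (n + 1) → Bool) < toLex (Fin.cons t c : Fin (n + 1) → Bool) ↔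
      s < t ∨ s = t ∧ toLex b < toLex c :=
  Fin.pi_lex_lt_cons_cons (fun {_} a b => a < b)

theorem head_tail_of_lt_cons {n : ℕ} {t : Bool} {i : Fin n → Bool} {j : Fin (n + 1) → Bool}
    (h : toLex j < toLex (Fin.cons t i : Fin (n + 1) → Bool)) :
    j 0 < t ∨ j 0 = t ∧ toLex (Fin.tail j) < toLex i := by
  rw [← Fin.cons_self_tail j] at h
  exact toLex_cons_lt.1 h

end PolarTransform

/-! ### Successive decisions as decoders for synthesized channels -/

section SuccessiveCancellation

variable {G : Type}

/-- The past of a position in the first half, from the past of the corresponding position of the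
shorter transform. -/
def pastMinus {n : ℕ} (i : Fin n → Bool) (p : {j : Fin n → Bool // toLex j < toLex i} → G)
    (j : {j : Fin (n + 1) → Bool // toLex j < toLex (Fin.cons false i : Fin (n + 1) → Bool)}) : G :=
  p ⟨Fin.tail j.1, ((head_tail_of_lt_cons j.2).resolve_left (by simp)).2⟩

/-- The past of a position in the second half, from the first half and the past of the
corresponding position of the shorter transform. -/
def pastPlus {n : ℕ} (i : Fin n → Bool) (v : (Fin n → Bool) → G)
    (p : {j : Fin n → Bool // toLex j < toLex i} → G)
    (j : {j : Fin (n + 1) → Bool // toLex j < toLex (Fin.cons true i : Fin (n + 1) → Bool)}) : G :=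
  if h : j.1 0 = true then
    p ⟨Fin.tail j.1, ((head_tail_of_lt_cons j.2).resolve_left (by simp [h])).2⟩
  else v (Fin.tail j.1)

theorem pastMinus_eq {n : ℕ} (i : Fin n → Bool) (v w : (Fin n → Bool) → G) :
    pastMinus i (fun j => v j.1) = fun j => joinFront v w j.1 := by
  funext j
  have h : j.1 0 = false := ((head_tail_of_lt_cons j.2).resolve_left (by simp)).1
  simp [pastMinus, joinFront, h]

theorem pastPlus_eq {n : ℕ} (i : Fin n → Bool) (v w : (Fin n → Bool) → G) :
    pastPlus i v (fun j => w j.1) = fun j => joinFront v w j.1 := by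
  funext j
  by_cases h : j.1 0 = true <;> simp [pastPlus, joinFront, h]

variable [AddCommGroup G]

theorem blockProb_joinBack {G : Type} [Fintype G] (W : Channel.{u} G) {n : ℕ}
    (x : (Fin n → Bool) → G × G) (z : (Fin n → Bool) → W.Out × W.Out) :
    W.blockProb (joinBack x) (joinBack z)
      = ∏ c, W.prob (x c).1 (z c).1 * W.prob (x c).2 (z c).2 := by
  have h : ∀ f : (Fin (n + 1) → Bool) → ℝ, ∏ c, f c = ∏ c : Fin n → Bool,
      f (Fin.snoc c false : Fin (n + 1) → Bool) * f (Fin.snoc c true : Fin (n + 1) → Bool) := by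
    intro f
    rw [← Fintype.prod_equiv (Fin.snocEquiv fun _ => Bool) (fun p => f (Fin.snoc p.2 p.1)) f
      (fun p => rfl), Fintype.prod_prod_type, Fintype.prod_bool, mul_comm, ← Finset.prod_mul_distrib]
  rw [Channel.blockProb, h]
  simp [joinBack]

variable [Fintype G]

theorem blockProb_minus {ι : Type} [Fintype ι] [DecidableEq ι] (W : Channel.{u} G) (x : ι → G)
    (z : ι → W.Out × W.Out) : W.minus.blockProb x z = ∑ w : ι → G, ∏ c,
      (1 / (Fintype.card G : ℝ) * W.prob (x c + w c) (z c).1 * W.prob (w c) (z c).2) := by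
  have h := Finset.prod_univ_sum (fun _ : ι => (Finset.univ : Finset G)) (fun c g =>
    1 / (Fintype.card G : ℝ) * W.prob (x c + g) (z c).1 * W.prob g (z c).2)
  rw [Fintype.piFinset_univ] at h
  exact h

open Classical in
/-- The probability that the uniformly distributed input `u` of the polar transform and the channel
output `y` satisfy `E u y`. -/
def polarEventProb (W : Channel.{u} G) (n : ℕ)
    (E : ((Fin n → Bool) → G) → ((Fin n → Bool) → W.Out) → Prop) : ℝ :=
  ∑ u, ∑ y, if E u y then
    (1 / (Fintype.card G : ℝ) ^ 2 ^ n) * W.blockProb (polarEncode G n u) y else 0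

theorem polarEventProb_mono (W : Channel.{u} G) (n : ℕ)
    {E E' : ((Fin n → Bool) → G) → ((Fin n → Bool) → W.Out) → Prop} (h : ∀ u y, E u y → E' u y) :
    polarEventProb W n E ≤ polarEventProb W n E' := by
  classical
  unfold polarEventProb
  refine Finset.sum_le_sum fun u _ => Finset.sum_le_sum fun y _ => ?_
  have hW : 0 ≤ (1 / (Fintype.card G : ℝ) ^ 2 ^ n) * W.blockProb (polarEncode G n u) y :=
    mul_nonneg (by positivity) (Finset.prod_nonneg fun i _ => W.prob_nonneg _ _)
  split_ifs with h1 h2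
  · rfl
  · exact absurd (h _ _ h1) h2
  · exact hW
  · rfl

theorem scErrorProb_eq (W : Channel.{u} G) (n : ℕ) (A : Finset (Fin n → Bool))
    (f : SCRule G W.Out n) : scErrorProb W n A f =
      polarEventProb W n fun u y => ∃ i ∈ A, f i y (fun j => u j.1) ≠ u i := by
  unfold scErrorProb polarEventProb
  refine Finset.sum_congr rfl fun u _ => ?_
  rw [Finset.mul_sum]
  exact Finset.sum_congr rfl fun y _ => by
    rw [mul_ite, mul_zero]
    exact @if_congr _ _ _ (_) (_) _ _ _ _ Iff.rfl rfl rfl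

-- The two halves of the message and the paired outputs become the summation variables. Half of the
-- normalization is distributed over the 2^n letters, as the factors 1/q in the definitions of W⁻
-- and W⁺.
open Classical in
theorem polarEventProb_succ (W : Channel.{u} G) (n : ℕ)
    (E : ((Fin (n + 1) → Bool) → G) → ((Fin (n + 1) → Bool) → W.Out) → Prop) :
    polarEventProb W (n + 1) E =
      ∑ v : (Fin n → Bool) → G, ∑ w : (Fin n → Bool) → G, ∑ z : (Fin n → Bool) → W.Out × W.Out,
        if E (joinFront v w) (joinBack z) then
          (1 / (Fintype.card G : ℝ) ^ 2 ^ n) * ∏ c, (1 / (Fintype.card G : ℝ) *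
            W.prob (polarEncode G n v c + polarEncode G n w c) (z c).1
              * W.prob (polarEncode G n w c) (z c).2) else 0 := by
  unfold polarEventProb
  rw [← (joinFrontEquiv n).sum_comp, Fintype.sum_prod_type]
  refine Finset.sum_congr rfl fun v _ => Finset.sum_congr rfl fun w _ => ?_
  rw [← (joinBackEquiv W.Out n).sum_comp]
  refine Finset.sum_congr rfl fun z _ => ?_
  simp only [joinFrontEquiv, joinBackEquiv, Equiv.coe_fn_mk, polarEncode_joinFront,
    blockProb_joinBack, mul_assoc]
  congr 1
  rw [Finset.prod_mul_distrib (f := fun _ => 1 / (Fintype.card G : ℝ)), Finset.prod_const,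
    Finset.card_univ, ← mul_assoc]
  congr 1
  simp only [Fintype.card_fun, Fintype.card_fin, Fintype.card_bool, one_div, inv_pow]
  rw [pow_succ 2 n, pow_mul, pow_two, mul_inv]

/-- The event does not involve w. As the short encoder is bijective, summing over w is summing over
all words of letters u₂, which is the sum inside the definition of W⁻. -/
theorem polarEventProb_minus (W : Channel.{u} G) (n : ℕ)
    (E : ((Fin (n + 1) → Bool) → G) → ((Fin (n + 1) → Bool) → W.Out) → Prop)
    (E' : ((Fin n → Bool) → G) → ((Fin n → Bool) → W.Out × W.Out) → Prop)
    (h : ∀ v w z, E (joinFront v w) (joinBack z) ↔ E' v z) :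
    polarEventProb W.minus n E' = polarEventProb W (n + 1) E := by
  classical
  rw [polarEventProb_succ]
  unfold polarEventProb
  refine Finset.sum_congr rfl fun v _ => ?_
  rw [Finset.sum_comm]
  refine Finset.sum_congr rfl fun (z : (Fin n → Bool) → W.Out × W.Out) _ => ?_
  simp only [h]
  by_cases hE : E' v z
  · simp only [if_pos hE]
    rw [blockProb_minus, ← Finset.mul_sum]
    congr 1
    have hbij : Function.Bijective (polarEncode G n) :=
      Finite.injective_iff_bijective.1 (polarEncode_injective n)
    exact (hbij.sum_comp fun x => ∏ c, (1 / (Fintype.card G : ℝ) *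
      W.prob (polarEncode G n v c + x c) (z c).1 * W.prob (x c) (z c).2)).symm
  · simp only [if_neg hE, Finset.sum_const_zero]

/-- The letters of the encoded first half are the third output component of W⁺. Bijectivity of the
encoder turns the sum over v into the sum over that component. -/
theorem polarEventProb_plus (W : Channel.{u} G) (n : ℕ)
    (E : ((Fin (n + 1) → Bool) → G) → ((Fin (n + 1) → Bool) → W.Out) → Prop)
    (E' : ((Fin n → Bool) → G) → ((Fin n → Bool) → W.Out × W.Out × G) → Prop)
    (h : ∀ v w z, E (joinFront v w) (joinBack z) ↔
      E' w fun c => ((z c).1, (z c).2, polarEncode G n v c)) :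
    polarEventProb W.plus n E' = polarEventProb W (n + 1) E := by
  classical
  rw [polarEventProb_succ, Finset.sum_comm]
  unfold polarEventProb
  refine Finset.sum_congr rfl fun w _ => ?_
  have hbij : Function.Bijective (polarEncode G n) :=
    Finite.injective_iff_bijective.1 (polarEncode_injective n)
  let e : ((Fin n → Bool) → G) × ((Fin n → Bool) → W.Out × W.Out) ≃
      ((Fin n → Bool) → W.Out × W.Out × G) :=
    { toFun := fun p c => ((p.2 c).1, (p.2 c).2, p.1 c)
      invFun := fun q => (fun c => (q c).2.2, fun c => ((q c).1, (q c).2.1))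
      left_inv := fun p => rfl
      right_inv := fun q => rfl }
  change ∑ z : (Fin n → Bool) → W.Out × W.Out × G, _ = _
  rw [← e.sum_comp, Fintype.sum_prod_type, ← hbij.sum_comp]
  refine Finset.sum_congr rfl fun v _ => Finset.sum_congr rfl fun z _ => ?_
  exact if_congr (h v w z).symm rfl rfl

/-- The decision rule for `W⁻` induced by a decision rule for `W`. -/
def SCRule.minus {W : Channel.{u} G} {n : ℕ} (f : SCRule G W.Out (n + 1)) :
    SCRule G W.minus.Out n :=
  fun i z p => f (Fin.cons false i : Fin (n + 1) → Bool)
    (joinBack (z : (Fin n → Bool) → W.Out × W.Out)) (pastMinus i p)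

/-- The decision rule for `W⁺` induced by a decision rule for `W`. -/
def SCRule.plus {W : Channel.{u} G} {n : ℕ} (f : SCRule G W.Out (n + 1)) :
    SCRule G W.plus.Out n :=
  fun i z p => f (Fin.cons true i : Fin (n + 1) → Bool)
    (joinBack fun c => ((z c).1, (z c).2.1))
    (pastPlus i (Function.invFun (polarEncode G n) fun c => (z c).2.2) p)

theorem scErrorProb_singleton (W : Channel.{u} G) (n : ℕ) (i : Fin n → Bool)
    (f : SCRule G W.Out n) : scErrorProb W n {i} f =
      polarEventProb W n fun u y => f i y (fun j => u j.1) ≠ u i := by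
  rw [scErrorProb_eq]
  refine congrArg _ (funext fun u => funext fun y => ?_)
  simp only [Finset.mem_singleton]
  exact propext ⟨fun ⟨_, h, h'⟩ => h ▸ h', fun h => ⟨i, rfl, h⟩⟩

theorem scErrorProb_minus (W : Channel.{u} G) (n : ℕ) (i : Fin n → Bool)
    (f : SCRule G W.Out (n + 1)) : scErrorProb W.minus n {i} f.minus =
      scErrorProb W (n + 1) {(Fin.cons false i : Fin (n + 1) → Bool)} f := by
  rw [scErrorProb_singleton, scErrorProb_singleton]
  refine polarEventProb_minus W n _ _ fun v w z => ?_
  rw [← pastMinus_eq]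
  have h : joinFront v w (Fin.cons false i : Fin (n + 1) → Bool) = v i := by simp [joinFront]
  rw [h]
  rfl

theorem scErrorProb_plus (W : Channel.{u} G) (n : ℕ) (i : Fin n → Bool)
    (f : SCRule G W.Out (n + 1)) : scErrorProb W.plus n {i} f.plus =
      scErrorProb W (n + 1) {(Fin.cons true i : Fin (n + 1) → Bool)} f := by
  rw [scErrorProb_singleton, scErrorProb_singleton]
  refine polarEventProb_plus W n _ _ fun v w z => ?_
  rw [← pastPlus_eq]
  have h : joinFront v w (Fin.cons true i : Fin (n + 1) → Bool) = w i := by simp [joinFront]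
  have h' : Function.invFun (polarEncode G n) (polarEncode G n v) = v :=
    Function.leftInverse_invFun (polarEncode_injective n) v
  rw [h]
  nth_rw 1 [← h']
  rfl

theorem scErrorProb_mono (W : Channel.{u} G) (n : ℕ) {A A' : Finset (Fin n → Bool)} (hA : A ⊆ A')
    (f : SCRule G W.Out n) : scErrorProb W n A f ≤ scErrorProb W n A' f := by
  rw [scErrorProb_eq, scErrorProb_eq]
  exact polarEventProb_mono W n fun u y h => h.imp fun i hi => ⟨hA hi.1, hi.2⟩

/-- Induction along the first bit of the position. In the first half the past lies in the first half
and the rule acts on W⁻. In the second half the whole first half is known, being recoverable from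
the outputs of W⁺, and the rule acts on W⁺. -/
theorem hasDecoder_synth (n : ℕ) (W : Channel.{u} G) (i : Fin n → Bool)
    (f : SCRule G W.Out n) : (W.synth i).HasDecoder (scErrorProb W n {i} f) := by
  classical
  induction n generalizing W with
  | zero =>
    rw [Channel.synth_zero]
    have hi : ∀ j : Fin 0 → Bool, ¬ toLex j < toLex i := fun j => by
      rw [Subsingleton.elim j i]; exact lt_irrefl _
    refine ⟨fun y => f i (fun _ => y) fun j => absurd j.2 (hi j.1), le_of_eq ?_⟩
    rw [scErrorProb_singleton, polarEventProb, Finset.mul_sum,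
      ← (Equiv.funUnique (Fin 0 → Bool) G).symm.sum_comp]
    refine Finset.sum_congr rfl fun x _ => ?_
    rw [Finset.mul_sum, ← (Equiv.funUnique (Fin 0 → Bool) W.Out).symm.sum_comp]
    refine Finset.sum_congr rfl fun y _ => ?_
    have henc : polarEncode G 0 (fun _ => x) = fun _ => x := by
      funext c
      simp [polarEncode_apply, polarMatrix]
    have hb : W.blockProb (fun _ : Fin 0 → Bool => x) (fun _ => y) = W.prob x y := by
      simp [Channel.blockProb]
    rw [mul_ite, mul_zero]
    refine @if_congr _ _ _ (_) (_) _ _ _ _ ?_ ?_ rfl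
    · refine not_congr (Eq.congr ?_ rfl)
      exact congrArg _ (funext fun j => absurd j.2 (hi j.1))
    · change _ = _ * W.blockProb (polarEncode G 0 (fun _ => x)) (fun _ => y)
      rw [henc, hb]
      simp
  | succ n ih =>
    rw [← Fin.cons_self_tail i, Channel.synth_cons]
    cases i 0
    · rw [← scErrorProb_minus]
      exact ih W.minus _ f.minus
    · rw [← scErrorProb_plus]
      exact ih W.plus _ f.plus

end SuccessiveCancellation

theorem IsSCPolarAchievable.le {W : Channel.{u} (ZMod 4)} {R : ℝ} (h : IsSCPolarAchievable W R) :
    R ≤ (W.minus.I2Sum + W.plus.I2Sum) / 2 := by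
  -- The error at one position of A is at most the block error ε, so Fano's inequality gives the
  -- quality 1 - h(ε), with the binary entropy h in bits.
  refine le_of_synth_quality (W := W) (κ := fun ε => 1 - Real.binEntropy ε / Real.log 2) ?_ ?_
  · have : Tendsto (fun ε : ℝ => 1 - Real.binEntropy ε / Real.log 2) (nhds 0)
        (nhds (1 - Real.binEntropy 0 / Real.log 2)) :=
      (continuous_const.sub (Real.binEntropy_continuous.div_const _)).tendsto 0
    rw [Real.binEntropy_zero, zero_div, sub_zero] at this
    exact this.mono_left nhdsWithin_le_nhds
  · have hlt : ∀ᶠ ε : ℝ in nhdsWithin 0 (Set.Ioi 0), ε < 1 / 2 :=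
      nhdsWithin_le_nhds (gt_mem_nhds (by norm_num))
    filter_upwards [self_mem_nhdsWithin, hlt] with ε hε hε2
    obtain ⟨n, ⟨A, f, hR, hf⟩, hn⟩ := ((h ε hε).and (eventually_ne_atTop 0)).exists
    refine ⟨n, hn, A, fun b hb => ?_, hR⟩
    obtain ⟨d, hd⟩ := hasDecoder_synth n W b f
    exact Channel.HasDecoder.le_I2Sum hε hε2 ⟨d, hd.trans
      ((scErrorProb_mono W n (Finset.singleton_subset_iff.2 hb) f).trans hf)⟩

/-! ### Numerical values for Channel 3 -/

theorem pairInfo_comm (a b : ℝ) : pairInfo a b = pairInfo b a := by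
  simp only [pairInfo, add_comm]

theorem pairInfo_zero_left (b : ℝ) : pairInfo 0 b = b := by
  rcases eq_or_ne b 0 with rfl | hb
  · simp [pairInfo]
  · simp [pairInfo, hb]

theorem pairInfo_zero_right (a : ℝ) : pairInfo a 0 = a := by
  rw [pairInfo_comm, pairInfo_zero_left]

theorem pairInfo_self (a : ℝ) : pairInfo a a = 0 := by
  rcases eq_or_ne a 0 with rfl | ha
  · simp [pairInfo]
  · have : 2 * a / (a + a) = 1 := by rw [← two_mul]; exact div_self (by simpa using ha)
    simp [pairInfo, this]

/-! ### Bounds for logarithms -/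

/-- The values involve only the logarithms of 2, 3, 5, 7 and 41. The fractions 80/81, 125/128, 49/50
and 40/41 are so close to 1 that four terms of the series suffice, and together with bounds for log
2 they determine the other four logarithms. -/
theorem log_bounds :
    |4 * Real.log 2 + Real.log 5 - 4 * Real.log 3 + 0.0124225200| < 1e-7 ∧
    |3 * Real.log 5 - 7 * Real.log 2 + 0.0237165266| < 1e-7 ∧
    |2 * Real.log 7 - Real.log 2 - 2 * Real.log 5 + 0.0202027073| < 1e-7 ∧
    |3 * Real.log 2 + Real.log 5 - Real.log 41 + 0.0246926126| < 1e-7 := by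
  have key : ∀ (a b c : ℝ), 0 < a → 0 < b → |(1 - a / b)| < 1 → Real.log (a / b) = c →
      |∑ i ∈ Finset.range 4, (1 - a / b) ^ (i + 1) / (i + 1) + c| ≤
        |1 - a / b| ^ 5 / (1 - |1 - a / b|) := by
    intro a b c ha hb h hc
    have := Real.abs_log_sub_add_sum_range_le h 4
    rwa [sub_sub_cancel, hc] at this
  have e1 : Real.log (80 / 81) = 4 * Real.log 2 + Real.log 5 - 4 * Real.log 3 := by
    rw [Real.log_div (by norm_num) (by norm_num), show (80 : ℝ) = 2 ^ 4 * 5 by norm_num,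
      show (81 : ℝ) = 3 ^ 4 by norm_num, Real.log_mul (by norm_num) (by norm_num), Real.log_pow,
      Real.log_pow]
    norm_num
  have e2 : Real.log (125 / 128) = 3 * Real.log 5 - 7 * Real.log 2 := by
    rw [Real.log_div (by norm_num) (by norm_num), show (125 : ℝ) = 5 ^ 3 by norm_num,
      show (128 : ℝ) = 2 ^ 7 by norm_num, Real.log_pow, Real.log_pow]
    norm_num
  have e3 : Real.log (49 / 50) = 2 * Real.log 7 - Real.log 2 - 2 * Real.log 5 := by
    rw [Real.log_div (by norm_num) (by norm_num), show (49 : ℝ) = 7 ^ 2 by norm_num,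
      show (50 : ℝ) = 2 * 5 ^ 2 by norm_num, Real.log_mul (by norm_num) (by norm_num),
      Real.log_pow, Real.log_pow]
    norm_num
    ring
  have e4 : Real.log (40 / 41) = 3 * Real.log 2 + Real.log 5 - Real.log 41 := by
    rw [Real.log_div (by norm_num) (by norm_num), show (40 : ℝ) = 2 ^ 3 * 5 by norm_num,
      Real.log_mul (by norm_num) (by norm_num), Real.log_pow]
    norm_num
  have k1 := key 80 81 _ (by norm_num) (by norm_num) (by norm_num [abs_lt]) e1
  have k2 := key 125 128 _ (by norm_num) (by norm_num) (by norm_num [abs_lt]) e2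
  have k3 := key 49 50 _ (by norm_num) (by norm_num) (by norm_num [abs_lt]) e3
  have k4 := key 40 41 _ (by norm_num) (by norm_num) (by norm_num [abs_lt]) e4
  norm_num [Finset.sum_range_succ, abs_le] at k1 k2 k3 k4
  refine ⟨?_, ?_, ?_, ?_⟩ <;> rw [abs_lt] <;> constructor <;> norm_num <;> linarith

namespace Channel3

theorem prob_00 : channel3At.prob 0 (0 : Fin 2) = 1 := by
  change channel3Matrix (1 / 5) (0 : Fin 4) (0 : Fin 2) = _; norm_num [channel3Matrix]
theorem prob_01 : channel3At.prob 0 (1 : Fin 2) = 0 := by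
  change channel3Matrix (1 / 5) (0 : Fin 4) (1 : Fin 2) = _; norm_num [channel3Matrix]
theorem prob_10 : channel3At.prob 1 (0 : Fin 2) = 0 := by
  change channel3Matrix (1 / 5) (1 : Fin 4) (0 : Fin 2) = _; norm_num [channel3Matrix]
theorem prob_11 : channel3At.prob 1 (1 : Fin 2) = 1 := by
  change channel3Matrix (1 / 5) (1 : Fin 4) (1 : Fin 2) = _; norm_num [channel3Matrix]
theorem prob_20 : channel3At.prob 2 (0 : Fin 2) = 4 / 5 := by
  change 1 - 1 / 5 = (4 / 5 : ℝ); norm_num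
theorem prob_21 : channel3At.prob 2 (1 : Fin 2) = 1 / 5 := by
  change 1 / 5 = (1 / 5 : ℝ); norm_num
theorem prob_30 : channel3At.prob 3 (0 : Fin 2) = 1 / 5 := by
  change 1 / 5 = (1 / 5 : ℝ); norm_num
theorem prob_31 : channel3At.prob 3 (1 : Fin 2) = 4 / 5 := by
  change 1 - 1 / 5 = (4 / 5 : ℝ); norm_num

theorem sum_out (f : channel3At.Out → ℝ) : ∑ y, f y = f (0 : Fin 2) + f (1 : Fin 2) :=
  Fin.sum_univ_two f

theorem I2_eq : channel3At.I2 = pairInfo 1 (4 / 5) / 2 + 1 / 10 := by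
  rw [Channel.I2_eq, sum_out, prob_00, prob_01, prob_20, prob_21, pairInfo_zero_left]
  norm_num

theorem I2'_eq : channel3At.I2' = pairInfo 1 (4 / 5) / 2 + 1 / 10 := by
  rw [Channel.I2'_eq, sum_out, prob_10, prob_11, prob_30, prob_31, pairInfo_zero_left]
  ring

theorem I2Sum_eq : channel3At.I2Sum = pairInfo 1 (4 / 5) + 1 / 5 := by
  rw [Channel.I2Sum, I2_eq, I2'_eq]
  ring

/-- At each of the four outputs one of the two cosets has equal likelihoods and contributes nothing.
-/
theorem I2Sum_minus : channel3At.minus.I2Sum =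
    pairInfo (21 / 50) (2 / 5) + pairInfo (2 / 25) (1 / 10) := by
  have e : ∀ f : channel3At.Out × channel3At.Out → ℝ, ∑ y, f y =
    f ((0 : Fin 2), (0 : Fin 2)) + f ((0 : Fin 2), (1 : Fin 2)) +
      (f ((1 : Fin 2), (0 : Fin 2)) + f ((1 : Fin 2), (1 : Fin 2))) := fun f => by
    rw [Fintype.sum_prod_type, sum_out, sum_out, sum_out]
  rw [Channel.I2Sum_eq]
  refine (e _).trans ?_
  have c : (Fintype.card (ZMod 4) : ℝ) = 4 := by norm_num [ZMod.card]
  have e10 : (1 + 1 : ZMod 4) = 2 := by decide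
  have e1 : (1 + 2 : ZMod 4) = 3 := by decide
  have e2 : (1 + 3 : ZMod 4) = 0 := by decide
  have e3 : (2 + 1 : ZMod 4) = 3 := by decide
  have e4 : (2 + 2 : ZMod 4) = 0 := by decide
  have e5 : (2 + 3 : ZMod 4) = 1 := by decide
  have e6 : (3 + 1 : ZMod 4) = 0 := by decide
  have e7 : (3 + 2 : ZMod 4) = 1 := by decide
  have e8 : (3 + 3 : ZMod 4) = 2 := by decide
  simp only [Channel.minus, sum_zmod_four, c, zero_add, add_zero, e10, e1, e2, e3, e4, e5, e6, e7,
    e8, prob_00, prob_01, prob_10, prob_11, prob_20, prob_21, prob_30, prob_31]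
  norm_num [pairInfo_self]
  ring

theorem I2Sum_plus : channel3At.plus.I2Sum = 2 * pairInfo (1 / 4) (4 / 25) + 19 / 50 := by
  have e : ∀ f : channel3At.Out × channel3At.Out × ZMod 4 → ℝ, ∑ y, f y =
    ∑ s : ZMod 4, (f ((0 : Fin 2), (0 : Fin 2), s) + f ((0 : Fin 2), (1 : Fin 2), s) +
      (f ((1 : Fin 2), (0 : Fin 2), s) + f ((1 : Fin 2), (1 : Fin 2), s))) := fun f => by
    rw [Fintype.sum_prod_type, sum_out, Fintype.sum_prod_type, Fintype.sum_prod_type, sum_out,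
      sum_out]
    simp only [Finset.sum_add_distrib]
  rw [Channel.I2Sum_eq]
  refine (e _).trans ?_
  have c : (Fintype.card (ZMod 4) : ℝ) = 4 := by norm_num [ZMod.card]
  have e10 : (1 + 1 : ZMod 4) = 2 := by decide
  have e1 : (1 + 2 : ZMod 4) = 3 := by decide
  have e2 : (1 + 3 : ZMod 4) = 0 := by decide
  have e3 : (2 + 1 : ZMod 4) = 3 := by decide
  have e4 : (2 + 2 : ZMod 4) = 0 := by decide
  have e5 : (2 + 3 : ZMod 4) = 1 := by decide
  have e6 : (3 + 1 : ZMod 4) = 0 := by decide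
  have e7 : (3 + 2 : ZMod 4) = 1 := by decide
  have e8 : (3 + 3 : ZMod 4) = 2 := by decide
  simp only [Channel.plus, sum_zmod_four, c, zero_add, add_zero, e10, e1, e2, e3, e4, e5, e6, e7,
    e8, prob_00, prob_01, prob_10, prob_11, prob_20, prob_21, prob_30, prob_31]
  norm_num [pairInfo_self, pairInfo_zero_left, pairInfo_zero_right]
  ring

theorem pairInfo_one : pairInfo 1 (4 / 5) =
    (17 / 5 * Real.log 2 + Real.log 5 - 18 / 5 * Real.log 3) / Real.log 2 := by
  have h1 : Real.log (10 / 9) = Real.log 2 + Real.log 5 - 2 * Real.log 3 := by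
    rw [show (10 / 9 : ℝ) = 2 * 5 / 3 ^ 2 by norm_num, Real.log_div (by norm_num) (by norm_num),
      Real.log_mul (by norm_num) (by norm_num), Real.log_pow]
    norm_num
  have h2 : Real.log (8 / 9) = 3 * Real.log 2 - 2 * Real.log 3 := by
    rw [show (8 / 9 : ℝ) = 2 ^ 3 / 3 ^ 2 by norm_num, Real.log_div (by norm_num) (by norm_num),
      Real.log_pow, Real.log_pow]
    norm_num
  rw [pairInfo, Real.logb, Real.logb]
  norm_num
  rw [h1, h2]
  ring

theorem pairInfo_small : pairInfo (2 / 25) (1 / 10) =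
    (17 / 5 * Real.log 2 + Real.log 5 - 18 / 5 * Real.log 3) / Real.log 2 / 10 := by
  rw [← pairInfo_one, pairInfo_comm, show (1 / 10 : ℝ) = 1 / 10 * 1 by norm_num,
    show (2 / 25 : ℝ) = 1 / 10 * (4 / 5) by norm_num, pairInfo_smul (by norm_num)]
  ring

theorem pairInfo_mid : pairInfo (21 / 50) (2 / 5) =
    (81 / 50 * Real.log 2 + 21 / 50 * Real.log 3 + 2 / 5 * Real.log 5 + 21 / 50 * Real.log 7
      - 41 / 50 * Real.log 41) / Real.log 2 := by
  have h1 : Real.log (42 / 41) = Real.log 2 + Real.log 3 + Real.log 7 - Real.log 41 := by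
    rw [show (42 / 41 : ℝ) = 2 * 3 * 7 / 41 by norm_num, Real.log_div (by norm_num) (by norm_num),
      Real.log_mul (by norm_num) (by norm_num), Real.log_mul (by norm_num) (by norm_num)]
  have h2 : Real.log (40 / 41) = 3 * Real.log 2 + Real.log 5 - Real.log 41 := by
    rw [show (40 / 41 : ℝ) = 2 ^ 3 * 5 / 41 by norm_num, Real.log_div (by norm_num) (by norm_num),
      Real.log_mul (by norm_num) (by norm_num), Real.log_pow]
    norm_num
  rw [pairInfo, Real.logb, Real.logb]
  norm_num
  rw [h1, h2]
  ring

theorem pairInfo_plus : pairInfo (1 / 4) (4 / 25) =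
    (21 / 20 * Real.log 2 + 1 / 2 * Real.log 5 - 41 / 100 * Real.log 41) / Real.log 2 := by
  have h1 : Real.log (50 / 41) = Real.log 2 + 2 * Real.log 5 - Real.log 41 := by
    rw [show (50 / 41 : ℝ) = 2 * 5 ^ 2 / 41 by norm_num, Real.log_div (by norm_num) (by norm_num),
      Real.log_mul (by norm_num) (by norm_num), Real.log_pow]
    norm_num
  have h2 : Real.log (32 / 41) = 5 * Real.log 2 - Real.log 41 := by
    rw [show (32 / 41 : ℝ) = 2 ^ 5 / 41 by norm_num, Real.log_div (by norm_num) (by norm_num),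
      Real.log_pow]
    norm_num
  rw [pairInfo, Real.logb, Real.logb]
  norm_num
  rw [h1, h2]
  ring

theorem symmetricCapacity_eq : channel3At.symmetricCapacity =
    (9 / 5 * Real.log 2 - 1 / 2 * Real.log 5) / Real.log 2 := by
  have h1 : Real.log (8 / 5) = 3 * Real.log 2 - Real.log 5 := by
    rw [show (8 / 5 : ℝ) = 2 ^ 3 / 5 by norm_num, Real.log_div (by norm_num) (by norm_num),
      Real.log_pow]
    norm_num
  have h2 : Real.log (2 / 5) = Real.log 2 - Real.log 5 :=
    Real.log_div (by norm_num) (by norm_num)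
  have hl : 0 < Real.log 2 := Real.log_pos (by norm_num)
  rw [Channel.symmetricCapacity_eq, sum_out, sum_zmod_four, sum_zmod_four]
  rw [prob_00, prob_01, prob_10, prob_11, prob_20, prob_21, prob_30, prob_31]
  simp only [Real.logb]
  norm_num
  rw [h1, h2]
  field_simp
  ring

theorem abs_div_log_two_sub_lt {a c e : ℝ} (h1 : (c - e) * Real.log 2 < a)
    (h2 : a < (c + e) * Real.log 2) : |a / Real.log 2 - c| < e := by
  have hl : 0 < Real.log 2 := Real.log_pos (by norm_num)
  rw [abs_lt]
  constructor
  · have := (lt_div_iff₀ hl).2 h1; linarith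
  · have := (div_lt_iff₀ hl).2 h2; linarith

theorem I2Sum_approx : |channel3At.I2Sum - 0.2161| < 0.00005 := by
  obtain ⟨h1, h2, h3, h4⟩ := log_bounds
  have g1 := Real.log_two_gt_d9
  have g2 := Real.log_two_lt_d9
  rw [abs_lt] at h1 h2 h3 h4
  have e : channel3At.I2Sum =
      (18 / 5 * Real.log 2 + Real.log 5 - 18 / 5 * Real.log 3) / Real.log 2 := by
    rw [I2Sum_eq, pairInfo_one]
    field_simp
    ring
  rw [e]
  apply abs_div_log_two_sub_lt <;> norm_num at * <;> linarith

theorem mean_eq : (channel3At.minus.I2Sum + channel3At.plus.I2Sum) / 2 =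
    (111 / 50 * Real.log 2 + 3 / 100 * Real.log 3 + 3 / 4 * Real.log 5 + 21 / 100 * Real.log 7
      - 41 / 50 * Real.log 41) / Real.log 2 := by
  rw [I2Sum_minus, I2Sum_plus, pairInfo_mid, pairInfo_small, pairInfo_plus]
  field_simp
  ring

theorem mean_approx :
    |(channel3At.minus.I2Sum + channel3At.plus.I2Sum) / 2 - 0.2053| < 0.00005 := by
  obtain ⟨h1, h2, h3, h4⟩ := log_bounds
  have g1 := Real.log_two_gt_d9
  have g2 := Real.log_two_lt_d9
  rw [abs_lt] at h1 h2 h3 h4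
  rw [mean_eq]
  apply abs_div_log_two_sub_lt <;> norm_num at * <;> linarith

theorem symmetricCapacity_approx : |channel3At.symmetricCapacity - 0.6390| < 0.00005 := by
  obtain ⟨h1, h2, h3, h4⟩ := log_bounds
  have g1 := Real.log_two_gt_d9
  have g2 := Real.log_two_lt_d9
  rw [abs_lt] at h1 h2 h3 h4
  rw [symmetricCapacity_eq]
  apply abs_div_log_two_sub_lt <;> norm_num at * <;> linarith

theorem I2Sum_le_symmetricCapacity : channel3At.I2Sum ≤ channel3At.symmetricCapacity := by
  have h1 := (abs_lt.1 symmetricCapacity_approx).1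
  have h2 := (abs_lt.1 I2Sum_approx).2
  norm_num at h1 h2
  linarith

end Channel3

/-! ### Converse for group codes -/

section ProductSums

variable {ι : Type*} [Fintype ι] [DecidableEq ι] {Y : Type*} [Fintype Y]

theorem sum_pi_prod (h : ι → Y → ℝ) : ∑ y : ι → Y, ∏ i, h i (y i) = ∏ i, ∑ y, h i y := by
  have := Finset.prod_univ_sum (fun _ : ι => (Finset.univ : Finset Y)) h
  rw [Fintype.piFinset_univ] at this
  exact this.symm

theorem sum_pi_prod_mul {p : ι → Y → ℝ} (hp : ∀ i, ∑ y, p i y = 1) (i : ι) (f : Y → ℝ) :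
    ∑ y : ι → Y, (∏ j, p j (y j)) * f (y i) = ∑ y, p i y * f y := by
  have h1 : ∀ y : ι → Y, (∏ j, p j (y j)) * f (y i) =
      ∏ j, p j (y j) * (if j = i then f (y j) else 1) := fun y => by
    rw [Finset.prod_mul_distrib, Finset.prod_ite_eq' Finset.univ i, if_pos (Finset.mem_univ i)]
  simp only [h1]
  rw [sum_pi_prod (fun j y => p j y * (if j = i then f y else 1)), Finset.prod_eq_single i]
  · simp
  · intro j _ hj
    simp [hj, hp]
  · simp

/-- Independence of distinct coordinates; all the others sum to one. -/
theorem sum_pi_prod_mul_mul {p : ι → Y → ℝ} (hp : ∀ i, ∑ y, p i y = 1) {i j : ι} (hij : i ≠ j)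
    (f g : Y → ℝ) : ∑ y : ι → Y, (∏ k, p k (y k)) * (f (y i) * g (y j)) =
      (∑ y, p i y * f y) * ∑ y, p j y * g y := by
  have h1 : ∀ y : ι → Y, (∏ k, p k (y k)) * (f (y i) * g (y j)) =
      ∏ k, p k (y k) * ((if k = i then f (y k) else 1) * (if k = j then g (y k) else 1)) :=
    fun y => by
    rw [Finset.prod_mul_distrib, Finset.prod_mul_distrib, Finset.prod_ite_eq' Finset.univ i,
      Finset.prod_ite_eq' Finset.univ j, if_pos (Finset.mem_univ i), if_pos (Finset.mem_univ j)]
  simp only [h1]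
  rw [sum_pi_prod (fun k y => p k y * ((if k = i then f y else 1) * (if k = j then g y else 1))),
    ← Finset.mul_prod_erase _ _ (Finset.mem_univ i),
    ← Finset.mul_prod_erase _ _ (Finset.mem_erase.2 ⟨hij.symm, Finset.mem_univ j⟩),
    Finset.prod_eq_one, mul_one]
  · simp [hij, hij.symm]
  · intro k hk
    simp only [Finset.mem_erase] at hk
    simp [hk.1, hk.2.1, hp]

end ProductSums

namespace Channel

theorem sum_blockProb {G : Type} [Fintype G] {ι : Type} [Fintype ι] [DecidableEq ι]
    (W : Channel.{u} G) (x : ι → G) : ∑ y, W.blockProb x y = 1 := by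
  simp only [blockProb]
  rw [sum_pi_prod fun i y => W.prob (x i) y]
  simp [W.sum_prob]

theorem blockProb_nonneg {G : Type} [Fintype G] {ι : Type} [Fintype ι]
    (W : Channel.{u} G) (x : ι → G) (y : ι → W.Out) : 0 ≤ W.blockProb x y :=
  Finset.prod_nonneg fun _ _ => W.prob_nonneg _ _

/-- The output probability when the input is uniform on the coset of `x` modulo `{0,2}`. -/
def cosetProb (W : Channel.{u} (ZMod 4)) (x : ZMod 4) (y : W.Out) : ℝ :=
  (W.prob x y + W.prob (x + 2) y) / 2

theorem cosetProb_add_two (W : Channel.{u} (ZMod 4)) (x : ZMod 4) (y : W.Out) :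
    W.cosetProb (x + 2) y = W.cosetProb x y := by
  have : x + 2 + 2 = x := by rw [add_assoc, show (2 + 2 : ZMod 4) = 0 by decide, add_zero]
  rw [cosetProb, cosetProb, this, add_comm (W.prob _ y)]

theorem cosetProb_nonneg (W : Channel.{u} (ZMod 4)) (x : ZMod 4) (y : W.Out) :
    0 ≤ W.cosetProb x y :=
  div_nonneg (add_nonneg (W.prob_nonneg _ _) (W.prob_nonneg _ _)) (by norm_num)

theorem sum_cosetProb (W : Channel.{u} (ZMod 4)) (x : ZMod 4) : ∑ y, W.cosetProb x y = 1 := by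
  simp only [cosetProb, ← Finset.sum_div, Finset.sum_add_distrib, W.sum_prob]
  norm_num

theorem prob_le_two_mul_cosetProb (W : Channel.{u} (ZMod 4)) (x : ZMod 4) (y : W.Out) :
    W.prob x y ≤ 2 * W.cosetProb x y := by
  have := W.prob_nonneg (x + 2) y
  rw [cosetProb]
  linarith

/-- The divergence of the output distribution for the input `x` from the output distribution for
the input uniform on the coset of `x` modulo `{0,2}`. -/
def cosetInfo (W : Channel.{u} (ZMod 4)) (x : ZMod 4) : ℝ :=
  ∑ y, W.prob x y * Real.logb 2 (W.prob x y / W.cosetProb x y)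

theorem cosetInfo_add (W : Channel.{u} (ZMod 4)) (x : ZMod 4) :
    W.cosetInfo x + W.cosetInfo (x + 2) = ∑ y, pairInfo (W.prob x y) (W.prob (x + 2) y) := by
  simp only [cosetInfo, cosetProb_add_two, ← Finset.sum_add_distrib]
  refine Finset.sum_congr rfl fun y _ => ?_
  rw [pairInfo, cosetProb, div_div_eq_mul_div, div_div_eq_mul_div, mul_comm _ 2, mul_comm _ 2]

theorem cosetInfo_add_zero (W : Channel.{u} (ZMod 4)) :
    W.cosetInfo 0 + W.cosetInfo 2 = 2 * W.I2 := by
  have h := W.cosetInfo_add 0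
  rw [zero_add] at h
  rw [h, I2_eq, Finset.mul_sum]
  exact Finset.sum_congr rfl fun y _ => by ring

theorem cosetInfo_add_one (W : Channel.{u} (ZMod 4)) :
    W.cosetInfo 1 + W.cosetInfo 3 = 2 * W.I2' := by
  have h := W.cosetInfo_add 1
  rw [show (1 + 2 : ZMod 4) = 3 by decide] at h
  rw [h, I2'_eq, Finset.mul_sum]
  exact Finset.sum_congr rfl fun y _ => by ring

/-- With I₂ = I₂' it does not matter how a code distributes its symbols over the two cosets. -/
theorem cosetInfo_add_of_I2_eq {W : Channel.{u} (ZMod 4)} (h : W.I2 = W.I2') (x : ZMod 4) :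
    W.cosetInfo x + W.cosetInfo (x + 2) = W.I2Sum := by
  have h0 := W.cosetInfo_add_zero
  have h1 := W.cosetInfo_add_one
  have hx : x = 0 ∨ x = 1 ∨ x = 2 ∨ x = 3 := by revert x; decide
  rw [I2Sum]
  rcases hx with rfl | rfl | rfl | rfl
  · rw [zero_add]; linarith
  · rw [show (1 + 2 : ZMod 4) = 3 by decide]; linarith
  · rw [show (2 + 2 : ZMod 4) = 0 by decide]; linarith
  · rw [show (3 + 2 : ZMod 4) = 1 by decide]; linarith

end Channel

section GroupConverse

variable {n : ℕ} (C : AddSubgroup (Fin n → ZMod 4))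

theorem four_nsmul_eq_zero_pi (x : Fin n → ZMod 4) : (2 : ℕ) • (2 : ℕ) • x = 0 := by
  funext i
  have : ∀ a : ZMod 4, (2 : ℕ) • (2 : ℕ) • a = 0 := by decide
  exact this (x i)

/-- The elements of `C` of order at most two. -/
def twoTorsion : AddSubgroup C := (nsmulAddMonoidHom 2 : C →+ C).ker

/-- Doubling on C has kernel T, and its image lies in T because 4 annihilates the group. -/
theorem card_le_card_twoTorsion_sq : Nat.card C ≤ Nat.card (twoTorsion C) ^ 2 := by
  have h1 := (twoTorsion C).card_mul_index
  have h2 : (twoTorsion C).index = Nat.card (nsmulAddMonoidHom 2 : C →+ C).range :=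
    AddSubgroup.index_ker _
  have h3 : (nsmulAddMonoidHom 2 : C →+ C).range ≤ twoTorsion C := by
    rintro _ ⟨x, rfl⟩
    exact AddMonoidHom.mem_ker.2 (Subtype.ext (four_nsmul_eq_zero_pi x.1))
  have h4 : Nat.card (nsmulAddMonoidHom 2 : C →+ C).range ≤ Nat.card (twoTorsion C) :=
    Nat.card_le_card_of_injective _ (AddSubgroup.inclusion_injective h3)
  rw [← h1, h2, pow_two]
  exact Nat.mul_le_mul_left _ h4

theorem coord_of_mem_twoTorsion {τ : C} (hτ : τ ∈ twoTorsion C) (i : Fin n) :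
    τ.1 i = 0 ∨ τ.1 i = 2 := by
  have h : (2 : ℕ) • τ.1 i = 0 := congrFun (congrArg Subtype.val (AddMonoidHom.mem_ker.1 hτ)) i
  have : ∀ a : ZMod 4, (2 : ℕ) • a = 0 → a = 0 ∨ a = 2 := by decide
  exact this _ h

theorem exists_coord_eq_two {i : Fin n} (h : ∃ c : C, c.1 i ≠ 0) : ∃ c : C, c.1 i = 2 := by
  obtain ⟨c, hc⟩ := h
  have : ∀ a : ZMod 4, a ≠ 0 → a = 2 ∨ (2 : ℕ) • a = 2 := by decide
  rcases this _ hc with h | h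
  · exact ⟨c, h⟩
  · exact ⟨(2 : ℕ) • c, h⟩

open Classical in
/-- The output probability at coordinate `i` when the codeword of `C` is only known modulo
`{0,2}`. -/
def coordProb (W : Channel.{u} (ZMod 4)) (i : Fin n) (x : ZMod 4) (y : W.Out) : ℝ :=
  if ∃ c : C, c.1 i ≠ 0 then W.cosetProb x y else W.prob x y

variable {C} (W : Channel.{u} (ZMod 4))

theorem coordProb_nonneg (i : Fin n) (x : ZMod 4) (y : W.Out) : 0 ≤ coordProb C W i x y := by
  rw [coordProb]
  split_ifs
  exacts [W.cosetProb_nonneg _ _, W.prob_nonneg _ _]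

theorem sum_coordProb (i : Fin n) (x : ZMod 4) : ∑ y, coordProb C W i x y = 1 := by
  by_cases h : ∃ c : C, c.1 i ≠ 0
  · simp only [coordProb, if_pos h, W.sum_cosetProb]
  · simp only [coordProb, if_neg h, W.sum_prob]

theorem prob_eq_zero_of_coordProb {i : Fin n} {x : ZMod 4} {y : W.Out}
    (h : coordProb C W i x y = 0) : W.prob x y = 0 := by
  rw [coordProb] at h
  split_ifs at h
  · have h1 := W.prob_le_two_mul_cosetProb x y
    rw [h, mul_zero] at h1
    exact le_antisymm h1 (W.prob_nonneg _ _)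
  · exact h

theorem coordProb_add_twoTorsion (x : C) {τ : C} (hτ : τ ∈ twoTorsion C) (i : Fin n) (y : W.Out) :
    coordProb C W i ((x + τ : C).1 i) y = coordProb C W i (x.1 i) y := by
  have e : (x + τ : C).1 i = x.1 i + τ.1 i := rfl
  rw [e]
  rcases coord_of_mem_twoTorsion C hτ i with h | h
  · rw [h, add_zero]
  · have : ∃ c : C, c.1 i ≠ 0 := ⟨τ, by rw [h]; decide⟩
    rw [coordProb, coordProb, if_pos this, if_pos this, h, W.cosetProb_add_two]

/-- If C does not vanish at coordinate i, some codeword has the entry 2 there. Translation by it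
permutes C and exchanges the two symbols of each coset, so both are used equally often. A coordinate
where C vanishes contributes zero, because `coordProb` is then the true transition probability. -/
theorem sum_sum_logb_le {W : Channel.{u} (ZMod 4)} (hW : W.I2 = W.I2') [Fintype C] (i : Fin n) :
    ∑ x : C, ∑ y, W.prob (x.1 i) y * Real.logb 2 (W.prob (x.1 i) y / coordProb C W i (x.1 i) y) ≤
      Fintype.card C * (W.I2Sum / 2) := by
  by_cases h : ∃ c : C, c.1 i ≠ 0
  · obtain ⟨c, hc⟩ := exists_coord_eq_two C h
    simp only [coordProb, if_pos h]
    change ∑ x : C, W.cosetInfo (x.1 i) ≤ _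
    have h1 : ∑ x : C, W.cosetInfo (x.1 i) = ∑ x : C, W.cosetInfo (x.1 i + 2) := by
      rw [← Equiv.sum_comp (Equiv.addRight c)]
      refine Finset.sum_congr rfl fun x _ => ?_
      rw [← hc]
      rfl
    have h2 : ∑ x : C, W.cosetInfo (x.1 i) + ∑ x : C, W.cosetInfo (x.1 i + 2)
        = Fintype.card C * W.I2Sum := by
      rw [← Finset.sum_add_distrib]
      simp only [W.cosetInfo_add_of_I2_eq hW, Finset.sum_const, nsmul_eq_mul, Finset.card_univ]
    linarith
  · have h0 : ∀ x y, W.prob x y * Real.logb 2 (W.prob x y / coordProb C W i x y) = 0 := by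
      intro x y
      rw [coordProb, if_neg h]
      rcases eq_or_ne (W.prob x y) 0 with h | h
      · rw [h, zero_mul]
      · rw [div_self h, Real.logb_one, mul_zero]
    simp only [h0, Finset.sum_const_zero]
    have := W.I2Sum_nonneg
    positivity

theorem blockProb_mul_logb (x : Fin n → ZMod 4) (y : Fin n → W.Out) :
    W.blockProb x y * Real.logb 2 (W.blockProb x y / ∏ i, coordProb C W i (x i) (y i)) =
      ∑ i, W.blockProb x y *
        Real.logb 2 (W.prob (x i) (y i) / coordProb C W i (x i) (y i)) := by
  by_cases h : W.blockProb x y = 0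
  · simp [h]
  have h' : ∀ i, W.prob (x i) (y i) ≠ 0 := fun i => (Finset.prod_ne_zero_iff.1 h) i (Finset.mem_univ i)
  rw [← Finset.mul_sum, Channel.blockProb, ← Finset.prod_div_distrib, Real.logb_prod]
  exact fun i _ => div_ne_zero (h' i) fun h0 => h' i (prob_eq_zero_of_coordProb W h0)

theorem sum_blockProb_logb_le {W : Channel.{u} (ZMod 4)} (hW : W.I2 = W.I2') [Fintype C] :
    ∑ x : C, ∑ y, W.blockProb x.1 y *
        Real.logb 2 (W.blockProb x.1 y / ∏ i, coordProb C W i (x.1 i) (y i)) ≤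
      Fintype.card C * (n * (W.I2Sum / 2)) := by
  simp only [blockProb_mul_logb]
  have h : ∀ x : C, ∑ y, ∑ i, W.blockProb x.1 y *
      Real.logb 2 (W.prob (x.1 i) (y i) / coordProb C W i (x.1 i) (y i)) =
      ∑ i, ∑ y, W.prob (x.1 i) y *
        Real.logb 2 (W.prob (x.1 i) y / coordProb C W i (x.1 i) y) := by
    intro x
    rw [Finset.sum_comm]
    exact Finset.sum_congr rfl fun i _ => sum_pi_prod_mul (p := fun i y => W.prob (x.1 i) y)
      (fun i => W.sum_prob _) i
      fun y => Real.logb 2 (W.prob (x.1 i) y / coordProb C W i (x.1 i) y)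
  simp only [h]
  rw [Finset.sum_comm]
  calc _ ≤ ∑ _i : Fin n, (Fintype.card C : ℝ) * (W.I2Sum / 2) :=
        Finset.sum_le_sum fun i _ => sum_sum_logb_le hW i
    _ = _ := by
      rw [Finset.sum_const, nsmul_eq_mul, Finset.card_univ, Fintype.card_fin]; ring

theorem card_twoTorsion_mul_le [Fintype C] (x : C) (y : Fin n → W.Out) :
    (Nat.card (twoTorsion C) : ℝ) * ∏ i, coordProb C W i (x.1 i) (y i) ≤
      ∑ x : C, ∏ i, coordProb C W i (x.1 i) (y i) := by
  classical
  set F : C → ℝ := fun x => ∏ i, coordProb C W i (x.1 i) (y i) with hF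
  have hF0 : ∀ x, 0 ≤ F x := fun x => Finset.prod_nonneg fun i _ => coordProb_nonneg W i _ _
  have h0 : ∀ τ : C, τ ∈ twoTorsion C → F (x + τ) = F x := fun τ hτ =>
    Finset.prod_congr rfl fun i _ => coordProb_add_twoTorsion W x hτ i (y i)
  have h1 : (Nat.card (twoTorsion C) : ℝ) * F x =
      ∑ τ ∈ Finset.univ.filter (· ∈ twoTorsion C), F (x + τ) := by
    rw [Finset.sum_congr rfl fun τ hτ => h0 τ (Finset.mem_filter.1 hτ).2, Finset.sum_const,
      nsmul_eq_mul, ← Fintype.card_subtype, Nat.card_eq_fintype_card]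
  rw [h1, ← Equiv.sum_comp (Equiv.addLeft x) F]
  exact Finset.sum_le_univ_sum_of_nonneg fun τ => hF0 _

/-- When the outputs follow the product of the `coordProb`, the codewords in one coset of T are
indistinguishable. Hence every decoder is right with probability at most 1/|T|. -/
theorem sum_decoded_le [Fintype C] (d : (Fin n → W.Out) → C) :
    (Nat.card (twoTorsion C) : ℝ) * ∑ y, ∏ i, coordProb C W i ((d y).1 i) (y i) ≤
      Fintype.card C := by
  rw [Finset.mul_sum]
  refine (Finset.sum_le_sum fun y _ => card_twoTorsion_mul_le W (d y) y).trans ?_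
  rw [Finset.sum_comm]
  have h : ∀ x : C, ∑ y : Fin n → W.Out, ∏ i, coordProb C W i (x.1 i) (y i) = 1 := fun x => by
    rw [sum_pi_prod fun i y => coordProb C W i (x.1 i) y]
    simp only [sum_coordProb, Finset.prod_const_one]
  rw [Finset.sum_congr rfl fun x _ => h x]
  simp

end GroupConverse

/-- The variational lower bound for a divergence. -/
theorem sum_mul_logb_le {S : Type*} [Fintype S] {P Q L : S → ℝ} (hP : ∀ s, 0 ≤ P s)
    (hQ : ∀ s, 0 ≤ Q s) (hL : ∀ s, 0 < L s) (hPQ : ∀ s, Q s = 0 → P s = 0)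
    (h : ∑ s, Q s * L s ≤ ∑ s, P s) :
    ∑ s, P s * Real.logb 2 (L s) ≤ ∑ s, P s * Real.logb 2 (P s / Q s) := by
  have hl : 0 < Real.log 2 := Real.log_pos (by norm_num)
  have key : ∀ s, P s - Q s * L s ≤ P s * Real.log (P s / Q s) - P s * Real.log (L s) := by
    intro s
    rcases (hP s).eq_or_lt with h0 | h0
    · rw [← h0]
      have := mul_nonneg (hQ s) (hL s).le
      linarith
    have hq : 0 < Q s := lt_of_le_of_ne (hQ s) fun hq => h0.ne' (hPQ s hq.symm)
    have hLs := hL s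
    have h1 := sub_le_mul_log_div h0.le (q := Q s * L s) (by positivity)
      (fun h => absurd h (by positivity))
    rw [← div_div, Real.log_div (by positivity) (by positivity)] at h1
    linarith
  have hs := Finset.sum_le_sum fun s (_ : s ∈ Finset.univ) => key s
  rw [Finset.sum_sub_distrib, Finset.sum_sub_distrib] at hs
  simp only [Real.logb, mul_div_assoc', ← Finset.sum_div]
  exact div_le_div_of_nonneg_right (by linarith) hl.le

/-- Fano's inequality for codebooks that are subgroups. -/
theorem fano_addSubgroup {W : Channel.{u} (ZMod 4)} (hW : W.I2 = W.I2') {n : ℕ}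
    {C : AddSubgroup (Fin n → ZMod 4)} [Fintype C] [DecidableEq C] (d : (Fin n → W.Out) → C)
    {δ : ℝ} (hδ : ∑ x : C, ∑ y, (if d y ≠ x then W.blockProb x.1 y else 0) ≤ Fintype.card C * δ) :
    (1 - δ) * Real.logb 2 (Nat.card (twoTorsion C)) ≤ n * (W.I2Sum / 2) + 1 := by
  set t : ℝ := (Nat.card (twoTorsion C) : ℝ) with ht
  set M : ℝ := (Fintype.card C : ℝ) with hM
  have htpos : 1 ≤ t := by
    have : 0 < Nat.card (twoTorsion C) := Nat.card_pos
    rw [ht]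
    exact_mod_cast this
  have hMpos : 0 < M := by
    rw [hM]
    exact_mod_cast Fintype.card_pos
  have hsumP : ∑ s : C × (Fin n → W.Out), W.blockProb s.1.1 s.2 = M := by
    rw [Fintype.sum_prod_type]
    simp [W.sum_blockProb, hM]
  have hqsum := sum_decoded_le W d
  set Q : C × (Fin n → W.Out) → ℝ := fun s => ∏ i, coordProb C W i (s.1.1 i) (s.2 i) with hQ
  have hsumQ : ∑ s, Q s = M := by
    rw [Fintype.sum_prod_type]
    have h : ∀ x : C, ∑ y : Fin n → W.Out, Q (x, y) = 1 := fun x => by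
      change ∑ y : Fin n → W.Out, ∏ i, coordProb C W i (x.1 i) (y i) = 1
      rw [sum_pi_prod fun i y => coordProb C W i (x.1 i) y]
      simp only [sum_coordProb, Finset.prod_const_one]
    simp [h, hM]
  have hsel : ∀ f : C × (Fin n → W.Out) → ℝ,
      ∑ s, (if d s.2 = s.1 then f s else 0) = ∑ y, f (d y, y) := by
    intro f
    rw [Fintype.sum_prod_type, Finset.sum_comm]
    exact Finset.sum_congr rfl fun y _ => by simp
  -- The test function is t/2 on correct decisions and 1/2 elsewhere. Its mean under Q is at most 1,
  -- since a correct decision has Q-probability at most 1/t. Under the true distribution the mean of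
  -- its logarithm is log t times the success probability, minus one bit.
  have hvar := sum_mul_logb_le (S := C × (Fin n → W.Out)) (P := fun s => W.blockProb s.1.1 s.2)
    (Q := Q) (L := fun s => if d s.2 = s.1 then t / 2 else 1 / 2)
    (fun s => W.blockProb_nonneg _ _)
    (fun s => Finset.prod_nonneg fun i _ => coordProb_nonneg W i _ _)
    (fun s => by split_ifs <;> positivity)
    (fun s hs => by
      obtain ⟨i, _, hi⟩ := Finset.prod_eq_zero_iff.1 hs
      exact Finset.prod_eq_zero (Finset.mem_univ i) (prob_eq_zero_of_coordProb W hi))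
    (by
      have e : ∀ s, Q s * (if d s.2 = s.1 then t / 2 else 1 / 2) =
          1 / 2 * Q s + (if d s.2 = s.1 then (t - 1) / 2 * Q s else 0) := fun s => by
        split_ifs <;> ring
      simp only [e]
      rw [Finset.sum_add_distrib, ← Finset.mul_sum, hsumQ, hsel, ← Finset.mul_sum, hsumP]
      have h0 : 0 ≤ ∑ y, Q (d y, y) := Finset.sum_nonneg fun y _ =>
        Finset.prod_nonneg fun i _ => coordProb_nonneg W i _ _
      have h1 : t * ∑ y, Q (d y, y) ≤ M := hqsum
      linarith)
  have hup := sum_blockProb_logb_le hW (C := C)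
  have hlow : ∑ s : C × (Fin n → W.Out), W.blockProb s.1.1 s.2 *
      Real.logb 2 (if d s.2 = s.1 then t / 2 else 1 / 2) =
      (M - ∑ x : C, ∑ y, (if d y ≠ x then W.blockProb x.1 y else 0)) * Real.logb 2 t - M := by
    have hl2 : Real.logb 2 2 = 1 := by simp
    have e : ∀ s : C × (Fin n → W.Out), W.blockProb s.1.1 s.2 *
        Real.logb 2 (if d s.2 = s.1 then t / 2 else 1 / 2) =
        (W.blockProb s.1.1 s.2 - (if d s.2 ≠ s.1 then W.blockProb s.1.1 s.2 else 0))
          * Real.logb 2 t - W.blockProb s.1.1 s.2 := fun s => by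
      by_cases h : d s.2 = s.1
      · rw [if_pos h, if_neg (not_not.2 h), Real.logb_div (by positivity) (by norm_num), hl2]
        ring
      · rw [if_neg h, if_pos h, Real.logb_div (by norm_num) (by norm_num), hl2, Real.logb_one]
        ring
    rw [Finset.sum_congr rfl fun s _ => e s, Finset.sum_sub_distrib, ← Finset.sum_mul,
      Finset.sum_sub_distrib, hsumP, Fintype.sum_prod_type]
  rw [hlow, Fintype.sum_prod_type] at hvar
  have hlog : 0 ≤ Real.logb 2 t := Real.logb_nonneg (by norm_num) htpos
  have hmain := hvar.trans hup
  have h2 : M * ((1 - δ) * Real.logb 2 t) ≤ M * (n * (W.I2Sum / 2) + 1) := by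
    have := mul_le_mul_of_nonneg_right hδ hlog
    linarith
  exact le_of_mul_le_mul_left h2 hMpos

theorem fano_groupCode {W : Channel.{u} (ZMod 4)} (hW : W.I2 = W.I2') {n M : ℕ}
    {C : AddSubgroup (Fin n → ZMod 4)} {e : Fin M → Fin n → ZMod 4}
    {d : (Fin n → W.Out) → Fin M} (he : Function.Injective e)
    (hC : Set.range e = (C : Set (Fin n → ZMod 4))) {δ : ℝ} (hδ : blockErrorProb W e d ≤ δ)
    (hδ1 : δ ≤ 1) : (1 - δ) * Real.logb 2 M ≤ n * W.I2Sum + 2 := by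
  classical
  have : Fintype C := Fintype.ofFinite C
  let E : Fin M ≃ C := (Equiv.ofInjective e he).trans (Equiv.setCongr hC)
  have hE : ∀ m, (E m).1 = e m := fun m => rfl
  have hcard : Fintype.card C = M := by rw [← Fintype.card_congr E, Fintype.card_fin]
  have hMpos : 0 < M := hcard ▸ Fintype.card_pos
  have hMpos' : (0 : ℝ) < M := by exact_mod_cast hMpos
  have hF := fano_addSubgroup hW (C := C) (fun y => E (d y)) (δ := δ) (by
    rw [hcard, ← Equiv.sum_comp E]
    rw [blockErrorProb, one_div_mul_eq_div, div_le_iff₀ hMpos', mul_comm δ] at hδ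
    refine le_of_eq_of_le ?_ hδ
    refine Finset.sum_congr rfl fun m _ => Finset.sum_congr rfl fun y _ => ?_
    simp only [ne_eq, E.apply_eq_iff_eq, hE])
  have hsq := card_le_card_twoTorsion_sq C
  rw [Nat.card_eq_fintype_card, hcard] at hsq
  have hsq' : (M : ℝ) ≤ (Nat.card (twoTorsion C) : ℝ) ^ 2 := by exact_mod_cast hsq
  -- Passing from T to C doubles both the information term and the additive bit.
  have hlog : Real.logb 2 M ≤ 2 * Real.logb 2 (Nat.card (twoTorsion C)) := by
    rw [← Nat.cast_two (R := ℝ), ← Real.logb_pow]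
    exact Real.logb_le_logb_of_le (by norm_num) hMpos' hsq'
  have := mul_le_mul_of_nonneg_left hlog (sub_nonneg.2 hδ1)
  linarith

theorem IsGroupAchievable.le {W : Channel.{u} (ZMod 4)} (hW : W.I2 = W.I2') {R : ℝ}
    (hR : IsGroupAchievable W R) : R ≤ W.I2Sum := by
  -- For fixed ε the block length tends to infinity, which removes the term 2/n; then ε tends to
  -- zero.
  have hlim : Tendsto (fun ε : ℝ => (1 - ε) * (R - ε)) (nhdsWithin 0 (Set.Ioi 0))
      (nhds ((1 - 0) * (R - 0))) :=
    ((tendsto_const_nhds.sub tendsto_id).mul (tendsto_const_nhds.sub tendsto_id)).mono_left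
      nhdsWithin_le_nhds
  rw [sub_zero, sub_zero, one_mul] at hlim
  refine le_of_tendsto hlim ?_
  have h1 : ∀ᶠ ε : ℝ in nhdsWithin 0 (Set.Ioi 0), ε < 1 :=
    nhdsWithin_le_nhds (gt_mem_nhds (by norm_num))
  filter_upwards [self_mem_nhdsWithin, h1] with ε hε hε1
  have hlim2 : Tendsto (fun n : ℕ => W.I2Sum + 2 / (n : ℝ)) atTop (nhds (W.I2Sum + 0)) :=
    tendsto_const_nhds.add (tendsto_const_div_atTop_nhds_zero_nat 2)
  rw [add_zero] at hlim2
  refine ge_of_tendsto hlim2 ?_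
  filter_upwards [hR ε hε, eventually_gt_atTop 0] with n ⟨C, M, e, d, he, hC, hrate, herr⟩ hn
  have hn' : (0 : ℝ) < n := by exact_mod_cast hn
  have hF := fano_groupCode hW he hC herr hε1.le
  have h2 := mul_le_mul_of_nonneg_left hrate (sub_nonneg.2 hε1.le)
  refine h2.trans ?_
  rw [mul_div_assoc', div_le_iff₀ hn', add_mul, div_mul_cancel₀ _ hn'.ne']
  linarith

/-! ### Tools for achievability -/

/-- Chebyshev's inequality for the lower deviation of a sum of i.i.d. variables on a finite
alphabet. -/
theorem sum_lower_deviation_le {S : Type*} [Fintype S] {p : S → ℝ} (hp : ∀ s, 0 ≤ p s)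
    (hp1 : ∑ s, p s = 1) (f : S → ℝ) {m δ : ℝ} (hm : ∑ s, p s * f s = m) (hδ : 0 < δ) {n : ℕ}
    (hn : 0 < n) :
    ∑ s : Fin n → S, (if ∑ i, f (s i) < n * (m - δ) then ∏ i, p (s i) else 0) ≤
      (∑ s, p s * (f s - m) ^ 2) / (n * δ ^ 2) := by
  have hn' : (0 : ℝ) < n := by exact_mod_cast hn
  set g : S → ℝ := fun s => f s - m with hg
  have hg0 : ∑ s, p s * g s = 0 := by
    simp only [hg, mul_sub, Finset.sum_sub_distrib, hm, ← Finset.sum_mul, hp1]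
    ring
  have hpi : ∀ _i : Fin n, ∑ s, p s = 1 := fun _ => hp1
  have hsq : ∑ s : Fin n → S, (∏ i, p (s i)) * (∑ i, g (s i)) ^ 2 =
      n * ∑ s, p s * g s ^ 2 := by
    have e1 : ∀ s : Fin n → S, (∏ i, p (s i)) * (∑ i, g (s i)) ^ 2 =
        ∑ i, ∑ j, (∏ k, p (s k)) * (g (s i) * g (s j)) := fun s => by
      rw [pow_two, Finset.sum_mul_sum, Finset.mul_sum]
      exact Finset.sum_congr rfl fun i _ => by rw [Finset.mul_sum]
    simp only [e1]
    rw [Finset.sum_comm]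
    have e2 : ∀ i : Fin n, ∑ s : Fin n → S, ∑ j, (∏ k, p (s k)) * (g (s i) * g (s j)) =
        ∑ s, p s * g s ^ 2 := by
      intro i
      rw [Finset.sum_comm, Finset.sum_eq_single i]
      · have := sum_pi_prod_mul (p := fun _ : Fin n => p) hpi i fun s => g s * g s
        simp only [← pow_two] at this ⊢
        exact this
      · intro j _ hj
        rw [sum_pi_prod_mul_mul (p := fun _ : Fin n => p) hpi hj.symm g g, hg0, zero_mul]
      · simp
    rw [Finset.sum_congr rfl fun i _ => e2 i, Finset.sum_const, nsmul_eq_mul, Finset.card_univ,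
      Fintype.card_fin]
  have hterm : ∀ s : Fin n → S, (if ∑ i, f (s i) < n * (m - δ) then ∏ i, p (s i) else 0) ≤
      (∏ i, p (s i)) * (∑ i, g (s i)) ^ 2 / (n * δ) ^ 2 := by
    intro s
    have hP : 0 ≤ ∏ i, p (s i) := Finset.prod_nonneg fun i _ => hp _
    split_ifs with h
    · have h1 : ∑ i, g (s i) = ∑ i, f (s i) - n * m := by
        simp [hg, Finset.sum_sub_distrib]
      have h2 : n * δ ≤ -∑ i, g (s i) := by rw [h1]; linarith
      have h3 : (n * δ) ^ 2 ≤ (∑ i, g (s i)) ^ 2 := by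
        rw [← neg_sq (∑ i, g (s i))]
        exact pow_le_pow_left₀ (by positivity) h2 2
      rw [le_div_iff₀ (by positivity)]
      exact mul_le_mul_of_nonneg_left h3 hP
    · positivity
  refine (Finset.sum_le_sum fun s _ => hterm s).trans (le_of_eq ?_)
  rw [← Finset.sum_div, hsq, mul_pow, pow_two (n : ℝ), mul_assoc, mul_div_mul_left _ _ hn'.ne']

/-- A counting bound in the style of Markov's inequality. -/
theorem sum_indicator_le {X : Type*} [Fintype X] {f : X → ℝ} (hf : ∀ x, 0 ≤ f x) {s A K : ℝ}
    (hs : 0 ≤ s) (hA : 0 < A) (hK : 0 ≤ K) (h : ∑ x, f x ≤ K * s) (E : X → Prop)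
    [DecidablePred E] (hE : ∀ x, E x → 0 < f x ∧ A * s ≤ f x) :
    ∑ x, (if E x then (1 : ℝ) else 0) ≤ K / A := by
  -- For s = 0 the threshold is void. The requirement `0 < f x` then excludes every x, which is one
  -- reason for the positivity clause in `JointTypical`.
  rcases hs.eq_or_lt with rfl | hs
  · rw [mul_zero] at h
    have h0 : ∀ x, ¬ E x := fun x hx => by
      have h1 := Finset.single_le_sum (f := f) (fun y _ => hf y) (Finset.mem_univ x)
      have h2 := (hE x hx).1
      linarith
    simp only [h0, if_false, Finset.sum_const_zero]
    positivity
  · rw [le_div_iff₀ hA]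
    refine le_of_mul_le_mul_right ?_ hs
    refine le_trans ?_ h
    rw [Finset.sum_mul, Finset.sum_mul]
    refine Finset.sum_le_sum fun x _ => ?_
    split_ifs with hx
    · rw [one_mul]; exact (hE x hx).2
    · simpa using hf x

/-- Surjective homomorphisms of finite groups preserve the uniform distribution. -/
theorem card_mul_sum_comp {A B : Type*} [AddCommGroup A] [AddCommGroup B] [Fintype A] [Fintype B]
    (φ : A →+ B) (hφ : Function.Surjective φ) (F : B → ℝ) :
    (Fintype.card B : ℝ) * ∑ a, F (φ a) = Fintype.card A * ∑ b, F b := by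
  have h1 : ∀ b, ∑ a, F (φ a) = ∑ a, F (φ a + b) := fun b => by
    obtain ⟨a₀, rfl⟩ := hφ b
    rw [← Equiv.sum_comp (Equiv.addRight a₀)]
    simp
  have h2 : ∀ a, ∑ b, F (φ a + b) = ∑ b, F b := fun a => Equiv.sum_comp (Equiv.addLeft (φ a)) F
  calc (Fintype.card B : ℝ) * ∑ a, F (φ a) = ∑ b : B, ∑ a, F (φ a + b) := by
        rw [Finset.sum_congr rfl fun b _ => (h1 b).symm]
        simp
    _ = ∑ a : A, ∑ b, F b := by
        rw [Finset.sum_comm]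
        exact Finset.sum_congr rfl fun a _ => h2 a
    _ = _ := by simp

/-! ### Random linear encoders over ℤ/4 -/

section RandomCode

variable {k n : ℕ}

/-- The linear encoder with generator rows `g`. -/
def linEncode (g : Fin k → Fin n → ZMod 4) : (Fin k → ZMod 4) →+ (Fin n → ZMod 4) where
  toFun u := ∑ i, u i • g i
  map_zero' := by simp
  map_add' u v := by simp [add_smul, Finset.sum_add_distrib]

theorem linEncode_apply (g : Fin k → Fin n → ZMod 4) (u : Fin k → ZMod 4) :
    linEncode g u = ∑ i, u i • g i := rfl

theorem linEncode_smul (g : Fin k → Fin n → ZMod 4) (a : ZMod 4) (u : Fin k → ZMod 4) :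
    linEncode g (a • u) = a • linEncode g u := by
  simp [linEncode_apply, Finset.smul_sum, mul_smul]

/-- Evaluation of the encoder at `u`, as a function of the generator rows. -/
def evalRows (n : ℕ) (u : Fin k → ZMod 4) : (Fin k → Fin n → ZMod 4) →+ (Fin n → ZMod 4) where
  toFun g := linEncode g u
  map_zero' := by simp [linEncode_apply]
  map_add' g h := by simp [linEncode_apply, Finset.sum_add_distrib]

theorem evalRows_apply (u : Fin k → ZMod 4) (g : Fin k → Fin n → ZMod 4) :
    evalRows n u g = linEncode g u := rfl

theorem linEncode_single (u : Fin k → ZMod 4) (j : Fin k) (x : Fin n → ZMod 4) :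
    linEncode (Pi.single j x) u = u j • x := by
  rw [linEncode_apply, Finset.sum_eq_single j]
  · simp
  · intro i _ hi
    simp [Pi.single_eq_of_ne hi]
  · simp

/-- The odd residues modulo four. -/
def IsOdd4 (a : ZMod 4) : Prop := a = 1 ∨ a = 3

theorem IsOdd4.mul_self {a : ZMod 4} (h : IsOdd4 a) : a * a = 1 := by
  rcases h with rfl | rfl <;> decide

theorem evalRows_surjective {u : Fin k → ZMod 4} {j : Fin k} (hj : IsOdd4 (u j)) :
    Function.Surjective (evalRows n u) := by
  intro x
  refine ⟨Pi.single j (u j • x), ?_⟩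
  rw [evalRows_apply, linEncode_single, smul_smul, hj.mul_self, one_smul]

/-- Row i is chosen to send β to z; row j, which β does not see, then corrects the image of u. With
uniform rows the two codewords are therefore independent and uniform. -/
theorem evalRows_prod_surjective {u β : Fin k → ZMod 4} {j i : Fin k} (hj : IsOdd4 (u j))
    (hβ : β j = 0) (hi : IsOdd4 (β i)) :
    Function.Surjective ((evalRows n u).prod (evalRows n β)) := by
  rintro ⟨x, z⟩
  refine ⟨Pi.single i (β i • z) + Pi.single j (u j • (x - u i • β i • z)), ?_⟩
  rw [AddMonoidHom.prod_apply, map_add, map_add]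
  simp only [evalRows_apply, linEncode_single, hβ, zero_smul, add_zero]
  rw [smul_smul (β i), hi.mul_self, one_smul, smul_smul (u j), hj.mul_self, one_smul,
    add_sub_cancel]

theorem exists_two_smul {β : Fin k → ZMod 4} (h : ∀ i, ¬ IsOdd4 (β i)) :
    ∃ γ : Fin k → Bool, β = (2 : ZMod 4) • fun i => if γ i then 1 else 0 := by
  have h1 : ∀ a : ZMod 4, ¬ (a = 1 ∨ a = 3) → a = 2 * (if decide (a = 2) = true then 1 else 0) := by
    decide
  exact ⟨fun i => decide (β i = 2), funext fun i => h1 _ (h i)⟩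

end RandomCode

/-! ### Typicality and confusion probabilities -/

namespace Channel

variable (W : Channel.{u} (ZMod 4))

/-- The output distribution for the uniform input. -/
def outProb (y : W.Out) : ℝ := (W.prob 0 y + W.prob 1 y + W.prob 2 y + W.prob 3 y) / 4

theorem outProb_nonneg (y : W.Out) : 0 ≤ W.outProb y := by
  have h0 := W.prob_nonneg 0 y
  have h1 := W.prob_nonneg 1 y
  have h2 := W.prob_nonneg 2 y
  have h3 := W.prob_nonneg 3 y
  rw [outProb]
  positivity

theorem sum_prob_input (y : W.Out) : ∑ x, W.prob x y = 4 * W.outProb y := by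
  rw [sum_zmod_four (fun x => W.prob x y), outProb]
  ring

theorem prob_le_outProb (x : ZMod 4) (y : W.Out) : W.prob x y ≤ 4 * W.outProb y := by
  rw [← sum_prob_input]
  exact Finset.single_le_sum (f := fun x => W.prob x y) (fun x _ => W.prob_nonneg x y)
    (Finset.mem_univ x)

variable {n : ℕ}

/-- Threshold typicality of a channel input and output, both relative to the uniform input and
relative to the uniform input on a known coset of `{0,2}`. -/
def JointTypical (A B : ℝ) (x : Fin n → ZMod 4) (y : Fin n → W.Out) : Prop :=
  0 < W.blockProb x y ∧ A * ∏ i, W.outProb (y i) ≤ W.blockProb x y ∧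
    B * ∏ i, W.cosetProb (x i) (y i) ≤ W.blockProb x y

open Classical in
/-- The indicator of joint typicality. -/
def typInd (A B : ℝ) (x : Fin n → ZMod 4) (y : Fin n → W.Out) : ℝ :=
  if W.JointTypical A B x y then 1 else 0

theorem typInd_nonneg (A B : ℝ) (x : Fin n → ZMod 4) (y : Fin n → W.Out) :
    0 ≤ W.typInd A B x y := by
  rw [typInd]; split_ifs <;> norm_num

theorem card_pi_zmod_four : (Fintype.card (Fin n → ZMod 4) : ℝ) = 4 ^ n := by
  simp [ZMod.card]

theorem sum_typInd_le {A : ℝ} (hA : 0 < A) (B : ℝ) (y : Fin n → W.Out) :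
    ∑ x, W.typInd A B x y ≤ 4 ^ n / A := by
  classical
  refine sum_indicator_le (f := fun x => W.blockProb x y) (fun x => W.blockProb_nonneg x y)
    (s := ∏ i, W.outProb (y i)) (Finset.prod_nonneg fun i _ => W.outProb_nonneg _) hA (by positivity)
    (le_of_eq ?_) _ fun x hx => ⟨hx.1, hx.2.1⟩
  simp only [blockProb]
  rw [sum_pi_prod fun i x => W.prob x (y i)]
  simp only [sum_prob_input, Finset.prod_mul_distrib, Finset.prod_const, Finset.card_univ,
    Fintype.card_fin]

theorem sum_prob_coset (x : ZMod 4) (y : W.Out) :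
    ∑ z : ZMod 4, W.prob (x + 2 * z) y = 4 * W.cosetProb x y := by
  rw [sum_zmod_four fun z => W.prob (x + 2 * z) y, cosetProb, show (2 * 2 : ZMod 4) = 0 by decide,
    show (2 * 3 : ZMod 4) = 2 by decide, mul_zero, mul_one, add_zero]
  ring

theorem cosetProb_add_two_mul (x z : ZMod 4) (y : W.Out) :
    W.cosetProb (x + 2 * z) y = W.cosetProb x y := by
  have : ∀ z : ZMod 4, 2 * z = 0 ∨ 2 * z = 2 := by decide
  rcases this z with h | h
  · rw [h, add_zero]
  · rw [h, cosetProb_add_two]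

/-- Adding 2z changes the word only inside its cosets, so the coset likelihood is a common threshold
for all terms. -/
theorem sum_typInd_coset_le (A : ℝ) {B : ℝ} (hB : 0 < B) (x : Fin n → ZMod 4)
    (y : Fin n → W.Out) : ∑ z : Fin n → ZMod 4, W.typInd A B (x + (2 : ZMod 4) • z) y ≤ 4 ^ n / B := by
  classical
  refine sum_indicator_le (f := fun z : Fin n → ZMod 4 => W.blockProb (x + (2 : ZMod 4) • z) y)
    (fun z => W.blockProb_nonneg _ y) (s := ∏ i, W.cosetProb (x i) (y i))
    (Finset.prod_nonneg fun i _ => W.cosetProb_nonneg _ _) hB (by positivity)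
    (le_of_eq ?_) _ fun z hz => ⟨hz.1, le_of_eq_of_le ?_ hz.2.2⟩
  · simp only [blockProb, Pi.add_apply, Pi.smul_apply, smul_eq_mul]
    rw [sum_pi_prod fun i z => W.prob (x i + 2 * z) (y i)]
    simp only [sum_prob_coset, Finset.prod_mul_distrib, Finset.prod_const, Finset.card_univ,
      Fintype.card_fin]
  · simp only [Pi.add_apply, Pi.smul_apply, smul_eq_mul, cosetProb_add_two_mul]

/-- No multiple of the input other than the input itself is compatible with the output for sure: the
probability that it is, for a uniform input, is at most `ρ`. -/
def MultiplesDetected (ρ : ℝ) : Prop :=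
  ∀ a : ZMod 4, a ≠ 1 → ∑ x, ∑ y, (if 0 < W.prob (a * x) y then W.prob x y else 0) ≤ 4 * ρ

variable {W}

/-- Typicality of the multiple forces every letter to have positive transition probability, and
these conditions factor over the coordinates. -/
theorem sum_typInd_smul_le {ρ : ℝ} (hρ : W.MultiplesDetected ρ) {a : ZMod 4} (ha : a ≠ 1)
    (A B : ℝ) : ∑ x : Fin n → ZMod 4, ∑ y, W.blockProb x y * W.typInd A B (a • x) y ≤
      4 ^ n * ρ ^ n := by
  classical
  have hterm : ∀ (x : Fin n → ZMod 4) y, W.blockProb x y * W.typInd A B (a • x) y ≤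
      ∏ i, (if 0 < W.prob (a * x i) (y i) then W.prob (x i) (y i) else 0) := by
    intro x y
    have h0 : 0 ≤ ∏ i, (if 0 < W.prob (a * x i) (y i) then W.prob (x i) (y i) else 0) :=
      Finset.prod_nonneg fun i _ => by split_ifs; exacts [W.prob_nonneg _ _, le_rfl]
    rw [typInd]
    split_ifs with h
    · rw [mul_one]
      refine le_of_eq (Finset.prod_congr rfl fun i _ => ?_)
      have h1 : W.prob (a * x i) (y i) ≠ 0 :=
        (Finset.prod_ne_zero_iff.1 h.1.ne') i (Finset.mem_univ i)
      rw [if_pos (lt_of_le_of_ne (W.prob_nonneg _ _) h1.symm)]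
    · rwa [mul_zero]
  refine (Finset.sum_le_sum fun x _ => Finset.sum_le_sum fun y _ => hterm x y).trans ?_
  have h1 : ∀ x : Fin n → ZMod 4, ∑ y : Fin n → W.Out,
      ∏ i, (if 0 < W.prob (a * x i) (y i) then W.prob (x i) (y i) else 0) =
      ∏ i, ∑ y, (if 0 < W.prob (a * x i) y then W.prob (x i) y else 0) := fun x =>
    sum_pi_prod fun i y => if 0 < W.prob (a * x i) y then W.prob (x i) y else 0
  rw [Finset.sum_congr rfl fun x _ => h1 x,
    sum_pi_prod fun (_ : Fin n) x => ∑ y, (if 0 < W.prob (a * x) y then W.prob x y else 0),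
    Finset.prod_const, Finset.card_univ, Fintype.card_fin, ← mul_pow]
  refine pow_le_pow_left₀ (Finset.sum_nonneg fun x _ => Finset.sum_nonneg fun y _ => ?_) (hρ a ha) n
  split_ifs
  exacts [W.prob_nonneg _ _, le_rfl]

variable {k : ℕ} {A B ρ : ℝ}

/-- The mean number of generator matrices for which the output of the codeword of `u` is typical
with the codeword of `u'`. -/
def confusion (W : Channel.{u} (ZMod 4)) (n : ℕ) (A B : ℝ) (u u' : Fin k → ZMod 4) : ℝ :=
  ∑ g : Fin k → Fin n → ZMod 4, ∑ y,
    W.blockProb (linEncode g u) y * W.typInd A B (linEncode g u') y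

theorem sum_blockProb_mul_le {c : ℝ} {X : Type*} [Fintype X] (x : Fin n → ZMod 4)
    (F : X → (Fin n → W.Out) → ℝ) (hF : ∀ y, ∑ z, F z y ≤ c) :
    ∑ z, ∑ y, W.blockProb x y * F z y ≤ c := by
  rw [Finset.sum_comm]
  calc _ = ∑ y, W.blockProb x y * ∑ z, F z y :=
        Finset.sum_congr rfl fun y _ => by rw [Finset.mul_sum]
    _ ≤ ∑ y, W.blockProb x y * c := Finset.sum_le_sum fun y _ =>
        mul_le_mul_of_nonneg_left (hF y) (W.blockProb_nonneg x y)
    _ = c := by rw [← Finset.sum_mul, W.sum_blockProb, one_mul]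

/-- The codeword of β is uniform and independent of the one sent, so the competing codeword is a
fresh uniform word. -/
theorem confusion_le_of_odd (hA : 0 < A) {u β : Fin k → ZMod 4} {j i : Fin k}
    (hj : IsOdd4 (u j)) (hβ : β j = 0) (hi : IsOdd4 (β i)) (a : ZMod 4) :
    W.confusion n A B u (a • u + β) ≤ Fintype.card (Fin k → Fin n → ZMod 4) / A := by
  have h := card_mul_sum_comp _ (evalRows_prod_surjective (n := n) hj hβ hi)
    fun p => ∑ y, W.blockProb p.1 y * W.typInd A B (a • p.1 + p.2) y
  have e : W.confusion n A B u (a • u + β) = ∑ g, ∑ y,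
      W.blockProb (((evalRows n u).prod (evalRows n β)) g).1 y *
        W.typInd A B (a • (((evalRows n u).prod (evalRows n β)) g).1 +
          (((evalRows n u).prod (evalRows n β)) g).2) y := by
    simp only [confusion, map_add, linEncode_smul]
    rfl
  rw [← e, Fintype.card_prod, Nat.cast_mul, card_pi_zmod_four, Fintype.sum_prod_type] at h
  have hb : ∀ x : Fin n → ZMod 4, ∑ z : Fin n → ZMod 4, ∑ y,
      W.blockProb x y * W.typInd A B (a • x + z) y ≤ 4 ^ n / A := fun x =>
    sum_blockProb_mul_le x (fun z y => W.typInd A B (a • x + z) y) fun y =>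
      le_of_eq_of_le (Equiv.sum_comp (Equiv.addLeft (a • x)) fun z => W.typInd A B z y)
        (W.sum_typInd_le hA B y)
  have hs := Finset.sum_le_sum fun x (_ : x ∈ Finset.univ) => hb x
  rw [Finset.sum_const, nsmul_eq_mul, Finset.card_univ, card_pi_zmod_four] at hs
  have hq : (0 : ℝ) < 4 ^ n * 4 ^ n := by positivity
  refine le_of_mul_le_mul_left ?_ hq
  rw [h]
  refine (mul_le_mul_of_nonneg_left hs (Nat.cast_nonneg _)).trans (le_of_eq ?_)
  ring

/-- The competitor is uniform only on the coset of a times the codeword sent, so the threshold B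
takes the place of A. -/
theorem confusion_le_of_even (hB : 0 < B) {u γ : Fin k → ZMod 4} {j i : Fin k}
    (hj : IsOdd4 (u j)) (hγ : γ j = 0) (hi : IsOdd4 (γ i)) (a : ZMod 4) :
    W.confusion n A B u (a • u + (2 : ZMod 4) • γ) ≤
      Fintype.card (Fin k → Fin n → ZMod 4) / B := by
  have h := card_mul_sum_comp _ (evalRows_prod_surjective (n := n) hj hγ hi)
    fun p => ∑ y, W.blockProb p.1 y * W.typInd A B (a • p.1 + (2 : ZMod 4) • p.2) y
  have e : W.confusion n A B u (a • u + (2 : ZMod 4) • γ) = ∑ g, ∑ y,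
      W.blockProb (((evalRows n u).prod (evalRows n γ)) g).1 y *
        W.typInd A B (a • (((evalRows n u).prod (evalRows n γ)) g).1 +
          (2 : ZMod 4) • (((evalRows n u).prod (evalRows n γ)) g).2) y := by
    simp only [confusion, map_add, linEncode_smul]
    rfl
  rw [← e, Fintype.card_prod, Nat.cast_mul, card_pi_zmod_four, Fintype.sum_prod_type] at h
  have hb : ∀ x : Fin n → ZMod 4, ∑ z : Fin n → ZMod 4, ∑ y,
      W.blockProb x y * W.typInd A B (a • x + (2 : ZMod 4) • z) y ≤ 4 ^ n / B := fun x =>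
    sum_blockProb_mul_le x (fun z y => W.typInd A B (a • x + (2 : ZMod 4) • z) y) fun y =>
      W.sum_typInd_coset_le A hB (a • x) y
  have hs := Finset.sum_le_sum fun x (_ : x ∈ Finset.univ) => hb x
  rw [Finset.sum_const, nsmul_eq_mul, Finset.card_univ, card_pi_zmod_four] at hs
  have hq : (0 : ℝ) < 4 ^ n * 4 ^ n := by positivity
  refine le_of_mul_le_mul_left ?_ hq
  rw [h]
  refine (mul_le_mul_of_nonneg_left hs (Nat.cast_nonneg _)).trans (le_of_eq ?_)
  ring

/-- The competitor is a function of the codeword sent, so no randomness of the generator separates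
the two; only the channel itself can. -/
theorem confusion_le_of_smul (hρ : W.MultiplesDetected ρ) {u : Fin k → ZMod 4} {j : Fin k}
    (hj : IsOdd4 (u j)) {a : ZMod 4} (ha : a ≠ 1) :
    W.confusion n A B u (a • u) ≤ Fintype.card (Fin k → Fin n → ZMod 4) * ρ ^ n := by
  have h := card_mul_sum_comp _ (evalRows_surjective (n := n) hj)
    fun x => ∑ y, W.blockProb x y * W.typInd A B (a • x) y
  have e : W.confusion n A B u (a • u) = ∑ g, ∑ y,
      W.blockProb (evalRows n u g) y * W.typInd A B (a • evalRows n u g) y := by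
    simp only [confusion, linEncode_smul]
    rfl
  rw [← e, card_pi_zmod_four] at h
  have hq : (0 : ℝ) < 4 ^ n := by positivity
  refine le_of_mul_le_mul_left ?_ hq
  rw [h]
  refine (mul_le_mul_of_nonneg_left (sum_typInd_smul_le hρ ha A B) (Nat.cast_nonneg _)).trans
    (le_of_eq ?_)
  ring

/-- The messages that agree with a multiple of `u` modulo two. -/
def evenCosets (u : Fin k → ZMod 4) : Finset (Fin k → ZMod 4) :=
  Finset.univ.image fun p : ZMod 4 × (Fin k → Bool) =>
    p.1 • u + (2 : ZMod 4) • fun i => if p.2 i then 1 else 0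

/-- The multiples of `u`. -/
def multiples (u : Fin k → ZMod 4) : Finset (Fin k → ZMod 4) :=
  Finset.univ.image fun a : ZMod 4 => a • u

theorem card_evenCosets_le (u : Fin k → ZMod 4) : (evenCosets u).card ≤ 4 * 2 ^ k :=
  Finset.card_image_le.trans (by simp [ZMod.card])

theorem card_multiples_le (u : Fin k → ZMod 4) : (multiples u).card ≤ 4 :=
  Finset.card_image_le.trans (by simp [ZMod.card])

theorem confusion_le (hA : 0 < A) (hB : 0 < B) (hρ0 : 0 ≤ ρ) (hρ : W.MultiplesDetected ρ)
    {u u' : Fin k → ZMod 4} {j : Fin k} (hj : IsOdd4 (u j)) (hu : u' ≠ u) :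
    W.confusion n A B u u' ≤ Fintype.card (Fin k → Fin n → ZMod 4) * (1 / A +
      (if u' ∈ evenCosets u then 1 / B else 0) + if u' ∈ multiples u then ρ ^ n else 0) := by
  set N : ℝ := ((Fintype.card (Fin k → Fin n → ZMod 4) : ℕ) : ℝ) with hN
  have hN0 : 0 ≤ N := Nat.cast_nonneg _
  have hA' : 0 ≤ 1 / A := by positivity
  have hB' : 0 ≤ (if u' ∈ evenCosets u then 1 / B else 0) := by split_ifs <;> positivity
  have hρ' : 0 ≤ (if u' ∈ multiples u then ρ ^ n else 0) := by split_ifs <;> positivity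
  -- An odd residue is its own inverse, so this a makes β vanish at coordinate j.
  set a := u j * u' j with ha
  set β := u' - a • u with hβdef
  have hu' : u' = a • u + β := by rw [hβdef, add_sub_cancel]
  have hβ : β j = 0 := by
    have : a * u j = u' j := by
      rw [ha, mul_comm, ← mul_assoc, hj.mul_self, one_mul]
    rw [hβdef, Pi.sub_apply, Pi.smul_apply, smul_eq_mul, this, sub_self]
  by_cases hodd : ∃ i, IsOdd4 (β i)
  · obtain ⟨i, hi⟩ := hodd
    have h := confusion_le_of_odd (W := W) (n := n) (B := B) hA hj hβ hi a
    rw [← hu', ← hN, div_eq_mul_one_div] at h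
    exact h.trans (mul_le_mul_of_nonneg_left (by linarith) hN0)
  obtain ⟨γ, hγ⟩ := exists_two_smul (not_exists.1 hodd)
  by_cases h0 : ∃ i, γ i = true
  · obtain ⟨i, hi⟩ := h0
    have hγj : (if γ j then (1 : ZMod 4) else 0) = 0 := by
      have h1 : β j = 2 * if γ j then 1 else 0 := congrFun hγ j
      rw [hβ] at h1
      by_cases h2 : γ j = true
      · rw [h2] at h1; exact absurd h1 (by decide)
      · rw [if_neg h2]
    have h := confusion_le_of_even (W := W) (n := n) (A := A) hB hj
      (γ := fun i => if γ i then 1 else 0) hγj (i := i) (by rw [if_pos hi]; exact Or.inl rfl) a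
    rw [← hγ, ← hu', ← hN, div_eq_mul_one_div] at h
    have hmem : u' ∈ evenCosets u :=
      Finset.mem_image.2 ⟨(a, γ), Finset.mem_univ _, by rw [← hγ, ← hu']⟩
    rw [if_pos hmem]
    exact h.trans (mul_le_mul_of_nonneg_left (by linarith) hN0)
  · have hβ0 : β = 0 := by
      rw [hγ]
      funext i
      simp [not_exists.1 h0 i]
    rw [hβ0, add_zero] at hu'
    have ha1 : a ≠ 1 := fun h1 => hu (by rw [hu', h1, one_smul])
    have h := confusion_le_of_smul (n := n) (A := A) (B := B) hρ hj ha1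
    rw [← hu', ← hN] at h
    have hmem : u' ∈ multiples u := Finset.mem_image.2 ⟨a, Finset.mem_univ _, hu'.symm⟩
    rw [if_pos hmem]
    exact h.trans (mul_le_mul_of_nonneg_left (by linarith) hN0)

theorem sum_confusion_le (hA : 0 < A) (hB : 0 < B) (hρ0 : 0 ≤ ρ) (hρ : W.MultiplesDetected ρ)
    {u : Fin k → ZMod 4} {j : Fin k} (hj : IsOdd4 (u j)) :
    ∑ u' ∈ Finset.univ.erase u, W.confusion n A B u u' ≤
      Fintype.card (Fin k → Fin n → ZMod 4) * (4 ^ k / A + 4 * 2 ^ k / B + 4 * ρ ^ n) := by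
  refine (Finset.sum_le_sum fun u' hu' =>
    confusion_le hA hB hρ0 hρ hj (Finset.mem_erase.1 hu').1).trans ?_
  rw [← Finset.mul_sum]
  refine mul_le_mul_of_nonneg_left ?_ (Nat.cast_nonneg _)
  refine (Finset.sum_le_univ_sum_of_nonneg fun u' => ?_).trans ?_
  · have : 0 ≤ ρ ^ n := by positivity
    split_ifs <;> positivity
  rw [Finset.sum_add_distrib, Finset.sum_add_distrib, Finset.sum_ite_mem, Finset.sum_ite_mem,
    Finset.univ_inter, Finset.univ_inter, Finset.sum_const, Finset.sum_const, Finset.sum_const,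
    nsmul_eq_mul, nsmul_eq_mul, nsmul_eq_mul, Finset.card_univ, card_pi_zmod_four]
  have h1 : ((evenCosets u).card : ℝ) ≤ 4 * 2 ^ k := by exact_mod_cast card_evenCosets_le u
  have h2 : ((multiples u).card : ℝ) ≤ 4 := by exact_mod_cast card_multiples_le u
  rw [mul_one_div, mul_one_div]
  gcongr

end Channel

/-! ### The random coding bound -/

namespace Channel

variable (W : Channel.{u} (ZMod 4)) {n : ℕ}

theorem sum_prob_div_four : ∑ s : ZMod 4 × W.Out, W.prob s.1 s.2 / 4 = 1 := by
  rw [Fintype.sum_prod_type]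
  simp [← Finset.sum_div, W.sum_prob, ZMod.card]

theorem mean_symmetricCapacity : ∑ s : ZMod 4 × W.Out, W.prob s.1 s.2 / 4 *
    Real.logb 2 (W.prob s.1 s.2 / W.outProb s.2) = W.symmetricCapacity := by
  rw [symmetricCapacity_eq, Fintype.sum_prod_type, Finset.sum_comm]
  refine Finset.sum_congr rfl fun y _ => Finset.sum_congr rfl fun x _ => ?_
  rw [outProb, div_div_eq_mul_div, mul_comm (W.prob x y) 4]
  ring

theorem mean_I2Sum : ∑ s : ZMod 4 × W.Out, W.prob s.1 s.2 / 4 *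
    Real.logb 2 (W.prob s.1 s.2 / W.cosetProb s.1 s.2) = W.I2Sum / 2 := by
  have h : ∀ x, ∑ y, W.prob x y / 4 * Real.logb 2 (W.prob x y / W.cosetProb x y) =
      W.cosetInfo x / 4 := fun x => by
    rw [cosetInfo, Finset.sum_div]
    exact Finset.sum_congr rfl fun y _ => by ring
  rw [Fintype.sum_prod_type]
  simp only [h]
  rw [sum_zmod_four fun x => W.cosetInfo x / 4, I2Sum]
  have h0 := W.cosetInfo_add_zero
  have h1 := W.cosetInfo_add_one
  linarith

/-- The sum of the variances of the information densities for the uniform input, relative to the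
uniform input and to the uniform input on a known coset. -/
def densityVariance : ℝ :=
  (∑ s : ZMod 4 × W.Out, W.prob s.1 s.2 / 4 *
      (Real.logb 2 (W.prob s.1 s.2 / W.outProb s.2) - W.symmetricCapacity) ^ 2) +
    ∑ s : ZMod 4 × W.Out, W.prob s.1 s.2 / 4 *
      (Real.logb 2 (W.prob s.1 s.2 / W.cosetProb s.1 s.2) - W.I2Sum / 2) ^ 2

theorem sum_logb_lt_of_blockProb_lt {x : Fin n → ZMod 4} {y : Fin n → W.Out}
    (h0 : 0 < W.blockProb x y) {q : Fin n → ℝ} (hq : ∀ i, 0 ≤ q i)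
    (hWq : ∀ i, q i = 0 → W.prob (x i) (y i) = 0) {r : ℝ}
    (h : W.blockProb x y < 2 ^ r * ∏ i, q i) :
    ∑ i, Real.logb 2 (W.prob (x i) (y i) / q i) < r := by
  have h1 : ∀ i, W.prob (x i) (y i) ≠ 0 := fun i =>
    (Finset.prod_ne_zero_iff.1 h0.ne') i (Finset.mem_univ i)
  have h2 : ∀ i, 0 < q i := fun i => lt_of_le_of_ne (hq i) fun h => h1 i (hWq i h.symm)
  have h3 : 0 < ∏ i, q i := Finset.prod_pos fun i _ => h2 i
  rw [← Real.logb_prod _ _ fun i _ => div_ne_zero (h1 i) (h2 i).ne', Finset.prod_div_distrib]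
  change Real.logb 2 (W.blockProb x y / ∏ i, q i) < r
  rw [Real.logb_lt_iff_lt_rpow (by norm_num) (by positivity), div_lt_iff₀ h3]
  exact h

/-- Failure of typicality at positive likelihood means that one of two sums of information densities
falls below its mean by nδ; Chebyshev's inequality bounds both events. -/
theorem sum_not_typInd_le {δ : ℝ} (hδ : 0 < δ) (hn : 0 < n) :
    ∑ x : Fin n → ZMod 4, ∑ y, W.blockProb x y *
      (1 - W.typInd (2 ^ (n * (W.symmetricCapacity - δ))) (2 ^ (n * (W.I2Sum / 2 - δ))) x y) ≤
      4 ^ n * (W.densityVariance / (n * δ ^ 2)) := by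
  classical
  set f₁ : ZMod 4 × W.Out → ℝ := fun s => Real.logb 2 (W.prob s.1 s.2 / W.outProb s.2)
  set f₂ : ZMod 4 × W.Out → ℝ := fun s => Real.logb 2 (W.prob s.1 s.2 / W.cosetProb s.1 s.2)
  have hp : ∀ s : ZMod 4 × W.Out, 0 ≤ W.prob s.1 s.2 / 4 := fun s =>
    div_nonneg (W.prob_nonneg _ _) (by norm_num)
  have c₁ := sum_lower_deviation_le hp W.sum_prob_div_four f₁ W.mean_symmetricCapacity hδ hn
  have c₂ := sum_lower_deviation_le hp W.sum_prob_div_four f₂ W.mean_I2Sum hδ hn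
  have hterm : ∀ s : Fin n → ZMod 4 × W.Out,
      W.blockProb (fun i => (s i).1) (fun i => (s i).2) *
      (1 - W.typInd (2 ^ (n * (W.symmetricCapacity - δ))) (2 ^ (n * (W.I2Sum / 2 - δ)))
        (fun i => (s i).1) (fun i => (s i).2)) ≤
      4 ^ n * ((if ∑ i, f₁ (s i) < n * (W.symmetricCapacity - δ) then
          ∏ i, W.prob (s i).1 (s i).2 / 4 else 0) +
        (if ∑ i, f₂ (s i) < n * (W.I2Sum / 2 - δ) then
          ∏ i, W.prob (s i).1 (s i).2 / 4 else 0)) := by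
    intro s
    have hprod : (4 : ℝ) ^ n * ∏ i, W.prob (s i).1 (s i).2 / 4 =
        W.blockProb (fun i => (s i).1) (fun i => (s i).2) := by
      rw [Finset.prod_div_distrib, Finset.prod_const, Finset.card_univ, Fintype.card_fin,
        mul_div_cancel₀ _ (by positivity)]
      rfl
    have hW := W.blockProb_nonneg (fun i => (s i).1) (fun i => (s i).2)
    rw [mul_add, mul_ite, mul_ite, hprod, mul_zero]
    rcases hW.eq_or_lt with h0 | h0
    · rw [← h0]; simp
    by_cases hT : W.JointTypical (2 ^ (n * (W.symmetricCapacity - δ)))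
        (2 ^ (n * (W.I2Sum / 2 - δ))) (fun i => (s i).1) (fun i => (s i).2)
    · rw [typInd, if_pos hT, sub_self, mul_zero]
      split_ifs <;> linarith
    · rw [typInd, if_neg hT, sub_zero, mul_one]
      have hor : ∑ i, f₁ (s i) < n * (W.symmetricCapacity - δ) ∨
          ∑ i, f₂ (s i) < n * (W.I2Sum / 2 - δ) := by
        by_contra! hcon
        refine hT ⟨h0, ?_, ?_⟩
        · by_contra! hlt
          exact absurd (W.sum_logb_lt_of_blockProb_lt h0 (fun i => W.outProb_nonneg _)
            (fun i hi => le_antisymm (by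
              have := W.prob_le_outProb (s i).1 (s i).2
              rwa [hi, mul_zero] at this) (W.prob_nonneg _ _)) hlt) (not_lt.2 hcon.1)
        · by_contra! hlt
          exact absurd (W.sum_logb_lt_of_blockProb_lt h0 (fun i => W.cosetProb_nonneg _ _)
            (fun i hi => le_antisymm (by
              have := W.prob_le_two_mul_cosetProb (s i).1 (s i).2
              rwa [hi, mul_zero] at this) (W.prob_nonneg _ _)) hlt) (not_lt.2 hcon.2)
      rcases hor with h | h
      · rw [if_pos h]; split_ifs <;> linarith
      · rw [if_pos h]; split_ifs <;> linarith
  have hsum := Finset.sum_le_sum fun s (_ : s ∈ Finset.univ) => hterm s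
  rw [← Finset.mul_sum, Finset.sum_add_distrib] at hsum
  rw [← Fintype.sum_prod_type', ← Equiv.sum_comp
    (Equiv.arrowProdEquivProdArrow (Fin n) (fun _ => ZMod 4) fun _ => W.Out)]
  refine hsum.trans (mul_le_mul_of_nonneg_left ?_ (by positivity))
  rw [densityVariance, add_div]
  exact add_le_add c₁ c₂

variable {W} {k : ℕ} {A B ρ : ℝ}

/-- The error indicator of the threshold decoder for the code generated by `g` and the message
`u`: an upper bound that counts the confusable messages. -/
def missCount (W : Channel.{u} (ZMod 4)) (A B : ℝ) (g : Fin k → Fin n → ZMod 4)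
    (u : Fin k → ZMod 4) (y : Fin n → W.Out) : ℝ :=
  (1 - W.typInd A B (linEncode g u) y) +
    ∑ u' ∈ Finset.univ.erase u, W.typInd A B (linEncode g u') y

open Classical in
/-- The threshold decoder does not find `u` as the only typical message. -/
def missInd (W : Channel.{u} (ZMod 4)) (A B : ℝ) (g : Fin k → Fin n → ZMod 4)
    (u : Fin k → ZMod 4) (y : Fin n → W.Out) : ℝ :=
  if ∀ u', W.JointTypical A B (linEncode g u') y ↔ u' = u then 0 else 1

theorem missInd_le_missCount (g : Fin k → Fin n → ZMod 4)
    (u : Fin k → ZMod 4) (y : Fin n → W.Out) : W.missInd A B g u y ≤ W.missCount A B g u y := by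
  have h0 : W.typInd A B (linEncode g u) y ≤ 1 := by rw [typInd]; split_ifs <;> norm_num
  have h1 : 0 ≤ ∑ u' ∈ Finset.univ.erase u, W.typInd A B (linEncode g u') y :=
    Finset.sum_nonneg fun u' _ => W.typInd_nonneg _ _ _ _
  rw [missInd, missCount]
  split_ifs with h
  · linarith
  · obtain ⟨u', hu'⟩ := not_forall.1 h
    by_cases he : u' = u
    · subst he
      have : ¬ W.JointTypical A B (linEncode g u') y := fun hT => hu' ⟨fun _ => rfl, fun _ => hT⟩
      rw [typInd, if_neg this]
      linarith
    · have hT : W.JointTypical A B (linEncode g u') y := by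
        by_contra hT
        exact hu' ⟨fun h => absurd h hT, fun h => absurd h he⟩
      have h2 := Finset.single_le_sum (f := fun u' => W.typInd A B (linEncode g u') y)
        (fun u' _ => W.typInd_nonneg _ _ _ _) (Finset.mem_erase.2 ⟨he, Finset.mem_univ u'⟩)
      have h3 : W.typInd A B (linEncode g u') y = 1 := if_pos hT
      simp only [h3] at h2
      linarith

theorem sum_missCount_le (hA : 0 < A) (hB : 0 < B) (hρ0 : 0 ≤ ρ) (hρ : W.MultiplesDetected ρ)
    {η : ℝ} (hη : ∑ x : Fin n → ZMod 4, ∑ y, W.blockProb x y * (1 - W.typInd A B x y) ≤ 4 ^ n * η)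
    {u : Fin k → ZMod 4} {j : Fin k} (hj : IsOdd4 (u j)) :
    ∑ g : Fin k → Fin n → ZMod 4, ∑ y, W.blockProb (linEncode g u) y * W.missCount A B g u y ≤
      Fintype.card (Fin k → Fin n → ZMod 4) *
        (η + (4 ^ k / A + 4 * 2 ^ k / B + 4 * ρ ^ n)) := by
  have h1 : ∑ g : Fin k → Fin n → ZMod 4, ∑ y, W.blockProb (linEncode g u) y *
      (1 - W.typInd A B (linEncode g u) y) ≤ Fintype.card (Fin k → Fin n → ZMod 4) * η := by
    have h := card_mul_sum_comp _ (evalRows_surjective (n := n) hj)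
      fun x => ∑ y, W.blockProb x y * (1 - W.typInd A B x y)
    simp only [evalRows_apply] at h
    rw [card_pi_zmod_four] at h
    have hq : (0 : ℝ) < 4 ^ n := by positivity
    refine le_of_mul_le_mul_left ?_ hq
    rw [h]
    refine (mul_le_mul_of_nonneg_left hη (Nat.cast_nonneg _)).trans (le_of_eq ?_)
    ring
  have h2 := sum_confusion_le (n := n) hA hB hρ0 hρ hj
  have h3 : ∑ u' ∈ Finset.univ.erase u, W.confusion n A B u u' =
      ∑ g : Fin k → Fin n → ZMod 4, ∑ y, W.blockProb (linEncode g u) y *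
        ∑ u' ∈ Finset.univ.erase u, W.typInd A B (linEncode g u') y := by
    simp only [confusion]
    rw [Finset.sum_comm]
    refine Finset.sum_congr rfl fun g _ => ?_
    rw [Finset.sum_comm]
    exact Finset.sum_congr rfl fun y _ => by rw [Finset.mul_sum]
  rw [h3] at h2
  simp only [missCount, mul_add, Finset.sum_add_distrib] at h1 h2 ⊢
  linarith

theorem missInd_le_one (g : Fin k → Fin n → ZMod 4) (u : Fin k → ZMod 4) (y : Fin n → W.Out) :
    W.missInd A B g u y ≤ 1 := by
  rw [missInd]; split_ifs <;> norm_num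

theorem missInd_nonneg (g : Fin k → Fin n → ZMod 4) (u : Fin k → ZMod 4) (y : Fin n → W.Out) :
    0 ≤ W.missInd A B g u y := by
  rw [missInd]; split_ifs <;> norm_num

/-- The random coding bound. -/
theorem exists_sum_missInd_le (hA : 0 < A) (hB : 0 < B) (hρ0 : 0 ≤ ρ)
    (hρ : W.MultiplesDetected ρ) {η : ℝ}
    (hη : ∑ x : Fin n → ZMod 4, ∑ y, W.blockProb x y * (1 - W.typInd A B x y) ≤ 4 ^ n * η)
    (hη0 : 0 ≤ η) (k : ℕ) : ∃ g : Fin k → Fin n → ZMod 4,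
      ∑ u, ∑ y, W.blockProb (linEncode g u) y * W.missInd A B g u y ≤
        4 ^ k * (η + (4 ^ k / A + 4 * 2 ^ k / B + 4 * ρ ^ n)) + 2 ^ k := by
  classical
  set N : ℝ := ((Fintype.card (Fin k → Fin n → ZMod 4) : ℕ) : ℝ) with hN
  set T : ℝ := η + (4 ^ k / A + 4 * 2 ^ k / B + 4 * ρ ^ n) with hT
  have hT0 : 0 ≤ T := by positivity
  have hN0 : 0 ≤ N := Nat.cast_nonneg _
  let E : Finset (Fin k → ZMod 4) :=
    Finset.univ.image fun γ : Fin k → Bool => (2 : ZMod 4) • fun i => if γ i then 1 else 0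
  have hE : (E.card : ℝ) ≤ 2 ^ k := by
    have : E.card ≤ 2 ^ k := Finset.card_image_le.trans (by simp)
    exact_mod_cast this
  have hu : ∀ u : Fin k → ZMod 4, ∑ g : Fin k → Fin n → ZMod 4, ∑ y,
      W.blockProb (linEncode g u) y * W.missInd A B g u y ≤ N * (T + if u ∈ E then 1 else 0) := by
    intro u
    by_cases hodd : ∃ j, IsOdd4 (u j)
    · obtain ⟨j, hj⟩ := hodd
      refine le_trans (Finset.sum_le_sum fun g _ => Finset.sum_le_sum fun y _ =>
        mul_le_mul_of_nonneg_left (missInd_le_missCount g u y) (W.blockProb_nonneg _ _)) ?_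
      refine (sum_missCount_le hA hB hρ0 hρ hη hj).trans (mul_le_mul_of_nonneg_left ?_ hN0)
      split_ifs <;> linarith
    -- Messages without odd entry do not have uniform codewords. They are counted as errors; there
    -- are at most 2^k of them among 4^k.
    · obtain ⟨γ, hγ⟩ := exists_two_smul (not_exists.1 hodd)
      have hmem : u ∈ E := Finset.mem_image.2 ⟨γ, Finset.mem_univ _, hγ.symm⟩
      rw [if_pos hmem]
      have h1 : ∀ g : Fin k → Fin n → ZMod 4,
          ∑ y, W.blockProb (linEncode g u) y * W.missInd A B g u y ≤ 1 := fun g => by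
        rw [← W.sum_blockProb (linEncode g u)]
        exact Finset.sum_le_sum fun y _ =>
          mul_le_of_le_one_right (W.blockProb_nonneg _ _) (missInd_le_one g u y)
      refine (Finset.sum_le_sum fun g _ => h1 g).trans ?_
      rw [Finset.sum_const, nsmul_eq_mul, mul_one, Finset.card_univ, ← hN]
      exact le_mul_of_one_le_right hN0 (by linarith)
  have htot : ∑ g : Fin k → Fin n → ZMod 4, ∑ u, ∑ y,
      W.blockProb (linEncode g u) y * W.missInd A B g u y ≤
      ∑ _g : Fin k → Fin n → ZMod 4, (4 ^ k * T + 2 ^ k) := by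
    rw [Finset.sum_comm]
    refine (Finset.sum_le_sum fun u _ => hu u).trans ?_
    rw [← Finset.mul_sum, Finset.sum_add_distrib, Finset.sum_const, nsmul_eq_mul,
      Finset.sum_const, nsmul_eq_mul, Finset.card_univ, Finset.card_univ, card_pi_zmod_four,
      Finset.sum_ite_mem, Finset.univ_inter, Finset.sum_const, nsmul_eq_mul, mul_one, ← hN]
    gcongr
  obtain ⟨g, _, hg⟩ := Finset.exists_le_of_sum_le Finset.univ_nonempty htot
  exact ⟨g, hg⟩

end Channel

/-! ### From a good encoder to a group code -/

namespace Channel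

variable {W : Channel.{u} (ZMod 4)} {n k : ℕ} {A B ρ : ℝ}

/-- A nonzero kernel element gives every message a twin with the same codeword. No message is then
ever the only typical one, and the average of `missInd` is 1. -/
theorem linEncode_injective_of_sum_missInd_lt {g : Fin k → Fin n → ZMod 4}
    (h : ∑ u, ∑ y, W.blockProb (linEncode g u) y * W.missInd A B g u y < 4 ^ k) :
    Function.Injective (linEncode g) := by
  rw [injective_iff_map_eq_zero]
  intro w hw
  by_contra hw0
  have h1 : ∀ u y, W.missInd A B g u y = 1 := by
    intro u y
    refine if_neg fun hall => hw0 ?_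
    have hu := (hall u).2 rfl
    have := (hall (u + w)).1 (by rwa [map_add, hw, add_zero])
    simpa using this
  simp only [h1, mul_one, W.sum_blockProb, Finset.sum_const, nsmul_eq_mul, Finset.card_univ,
    card_pi_zmod_four, lt_irrefl] at h

theorem exists_groupCode {ε : ℝ} (hε : ε < 1) {g : Fin k → Fin n → ZMod 4}
    (h : ∑ u, ∑ y, W.blockProb (linEncode g u) y * W.missInd A B g u y ≤ 4 ^ k * ε) :
    ∃ (C : AddSubgroup (Fin n → ZMod 4)) (e : Fin (4 ^ k) → Fin n → ZMod 4)
      (d : (Fin n → W.Out) → Fin (4 ^ k)), Function.Injective e ∧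
      Set.range e = (C : Set (Fin n → ZMod 4)) ∧ blockErrorProb W e d ≤ ε := by
  classical
  have hpos : (0 : ℝ) < 4 ^ k := by positivity
  have hinj : Function.Injective (linEncode g) :=
    linEncode_injective_of_sum_missInd_lt (h.trans_lt (by
      have := mul_lt_mul_of_pos_left hε hpos
      rwa [mul_one] at this))
  let Φ : Fin (4 ^ k) ≃ (Fin k → ZMod 4) :=
    (Fintype.equivFinOfCardEq (by simp [ZMod.card])).symm
  let dec : (Fin n → W.Out) → Fin k → ZMod 4 := fun y =>
    if h : ∃ u, W.JointTypical A B (linEncode g u) y then h.choose else 0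
  refine ⟨(linEncode g).range, fun m => linEncode g (Φ m), fun y => Φ.symm (dec y),
    hinj.comp Φ.injective, ?_, ?_⟩
  · rw [AddMonoidHom.coe_range]
    exact Φ.surjective.range_comp _
  · have hcast : ((4 ^ k : ℕ) : ℝ) = 4 ^ k := by norm_num
    rw [blockErrorProb, hcast, one_div_mul_eq_div, div_le_iff₀' hpos]
    refine le_trans ?_ h
    rw [← Equiv.sum_comp Φ]
    refine Finset.sum_le_sum fun m _ => Finset.sum_le_sum fun y _ => ?_
    have hW := W.blockProb_nonneg (linEncode g (Φ m)) y
    by_cases hall : ∀ u', W.JointTypical A B (linEncode g u') y ↔ u' = Φ m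
    · have hex : ∃ u, W.JointTypical A B (linEncode g u) y := ⟨_, (hall (Φ m)).2 rfl⟩
      have hd : dec y = Φ m := by
        have : dec y = hex.choose := dif_pos hex
        rw [this]
        exact (hall _).1 hex.choose_spec
      rw [hd, Φ.symm_apply_apply, if_neg (fun hne => hne rfl)]
      exact mul_nonneg hW (missInd_nonneg g _ y)
    · rw [missInd, if_neg hall, mul_one]
      split_ifs <;> linarith

/-- Since 2k ≤ n(c - 4δ), the odd competitors cost at most 2^(-3nδ) and the even ones at most 4 ·
2^(-nδ); the even messages make up the fraction 2^(-k). -/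
theorem eventually_randomCoding_bound_le {c ρ V δ I : ℝ} (hρ0 : 0 ≤ ρ) (hρ1 : ρ < 1) (hδ : 0 < δ)
    (hc : 4 * δ < c) (hI : c ≤ I) {ε : ℝ} (hε : 0 < ε) :
    ∀ᶠ n : ℕ in atTop, ∀ k : ℕ, k = ⌊(n : ℝ) * (c - 4 * δ) / 2⌋₊ →
      V / (n * δ ^ 2) + (4 ^ k / (2 : ℝ) ^ (n * (I - δ)) +
        4 * 2 ^ k / (2 : ℝ) ^ (n * (c / 2 - δ)) + 4 * ρ ^ n) + (1 / 2) ^ k ≤ ε := by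
  have t1 : Tendsto (fun n : ℕ => V / (n * δ ^ 2)) atTop (nhds 0) := by
    have := (tendsto_const_div_atTop_nhds_zero_nat V).div_const (δ ^ 2)
    rw [zero_div] at this
    exact this.congr fun n => by rw [div_div]
  set r : ℝ := 2 ^ (-δ) with hr
  have hr0 : 0 ≤ r := by positivity
  have hr1 : r < 1 := Real.rpow_lt_one_of_one_lt_of_neg (by norm_num) (by linarith)
  have t2 : Tendsto (fun n : ℕ => r ^ n) atTop (nhds 0) := tendsto_pow_atTop_nhds_zero_of_lt_one hr0 hr1
  have t3 : Tendsto (fun n : ℕ => ρ ^ n) atTop (nhds 0) := tendsto_pow_atTop_nhds_zero_of_lt_one hρ0 hρ1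
  have t4 : Tendsto (fun n : ℕ => (1 / 2 : ℝ) ^ ⌊(n : ℝ) * (c - 4 * δ) / 2⌋₊) atTop (nhds 0) := by
    refine (tendsto_pow_atTop_nhds_zero_of_lt_one (by norm_num) (by norm_num)).comp
      (tendsto_nat_floor_atTop.comp ?_)
    exact (tendsto_natCast_atTop_atTop.atTop_mul_const (by linarith)).atTop_div_const (by norm_num)
  have tt := (t1.add (((t2.add (t2.const_mul 4)).add (t3.const_mul 4)))).add t4
  simp only [mul_zero, add_zero] at tt
  filter_upwards [tt.eventually (gt_mem_nhds hε)] with n hn k hk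
  refine le_trans ?_ hn.le
  have hnn : (0 : ℝ) ≤ n := Nat.cast_nonneg n
  have hkle : (k : ℝ) ≤ n * (c - 4 * δ) / 2 := by
    rw [hk]
    exact Nat.floor_le (by
      have := mul_nonneg hnn (sub_nonneg.2 hc.le)
      linarith)
  have hrn : r ^ n = (2 : ℝ) ^ (-(n * δ)) := by
    rw [hr, ← Real.rpow_natCast, ← Real.rpow_mul (by norm_num)]
    congr 1
    ring
  have hnδ : 0 ≤ n * δ := mul_nonneg hnn hδ.le
  have h4 : (4 : ℝ) ^ k / (2 : ℝ) ^ (n * (I - δ)) ≤ r ^ n := by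
    have e : (4 : ℝ) ^ k = (2 : ℝ) ^ (2 * (k : ℝ)) := by
      rw [Real.rpow_mul (by norm_num), Real.rpow_natCast]
      norm_num
    rw [e, ← Real.rpow_sub (by norm_num), hrn]
    refine Real.rpow_le_rpow_of_exponent_le (by norm_num) ?_
    have := mul_le_mul_of_nonneg_left hI hnn
    linarith
  have h2 : 4 * (2 : ℝ) ^ k / (2 : ℝ) ^ (n * (c / 2 - δ)) ≤ 4 * r ^ n := by
    rw [mul_div_assoc, ← Real.rpow_natCast 2 k, ← Real.rpow_sub (by norm_num), hrn]
    refine mul_le_mul_of_nonneg_left ?_ (by norm_num)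
    refine Real.rpow_le_rpow_of_exponent_le (by norm_num) ?_
    linarith
  rw [hk] at *
  gcongr

theorem isGroupAchievable_I2Sum (hρ0 : 0 ≤ ρ) (hρ1 : ρ < 1) (hρ : W.MultiplesDetected ρ)
    (hpos : 0 < W.I2Sum) (hI : W.I2Sum ≤ W.symmetricCapacity) :
    IsGroupAchievable W W.I2Sum := by
  intro ε hε
  -- A rate of 4δ is given up in the exponent and, for large n, at most another 4δ to the floor in
  -- k; the minimum with `W.I2Sum` keeps k growing.
  set δ := min ε W.I2Sum / 8 with hδdef
  have hδ : 0 < δ := by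
    have : 0 < min ε W.I2Sum := lt_min hε hpos
    positivity
  have hδε : 8 * δ ≤ ε := by
    have := min_le_left ε W.I2Sum
    rw [hδdef]; linarith
  have hδc : 4 * δ < W.I2Sum := by
    have := min_le_right ε W.I2Sum
    have : 8 * δ ≤ W.I2Sum := by rw [hδdef]; linarith
    linarith
  have hV : 0 ≤ W.densityVariance := by
    have hp : ∀ s : ZMod 4 × W.Out, 0 ≤ W.prob s.1 s.2 / 4 := fun s =>
      div_nonneg (W.prob_nonneg _ _) (by norm_num)
    exact add_nonneg (Finset.sum_nonneg fun s _ => mul_nonneg (hp s) (sq_nonneg _))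
      (Finset.sum_nonneg fun s _ => mul_nonneg (hp s) (sq_nonneg _))
  have hasym := eventually_randomCoding_bound_le (V := W.densityVariance) hρ0 hρ1 hδ hδc hI
    (ε := min ε (1 / 2)) (by positivity)
  have hlarge : ∀ᶠ n : ℕ in atTop, 2 ≤ (n : ℝ) * (4 * δ) :=
    (tendsto_natCast_atTop_atTop.atTop_mul_const (by positivity)).eventually_ge_atTop 2
  filter_upwards [hasym, hlarge, eventually_gt_atTop 0] with n hn hn2 hn0
  have hn' : (0 : ℝ) < n := by exact_mod_cast hn0
  set k := ⌊(n : ℝ) * (W.I2Sum - 4 * δ) / 2⌋₊ with hk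
  obtain ⟨g, hg⟩ := exists_sum_missInd_le (W := W) (n := n) (by positivity) (by positivity) hρ0 hρ
    (W.sum_not_typInd_le hδ hn0) (by positivity) k
  have hbound := hn k rfl
  have hg' : ∑ u, ∑ y, W.blockProb (linEncode g u) y *
      W.missInd (2 ^ (n * (W.symmetricCapacity - δ))) (2 ^ (n * (W.I2Sum / 2 - δ))) g u y ≤
      4 ^ k * min ε (1 / 2) := by
    refine hg.trans ?_
    have h4 : (4 : ℝ) ^ k * (1 / 2) ^ k = 2 ^ k := by rw [← mul_pow]; norm_num
    have h5 := mul_le_mul_of_nonneg_left hbound (show (0 : ℝ) ≤ 4 ^ k by positivity)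
    rw [mul_add, h4] at h5
    exact h5
  obtain ⟨C, e, d, he, hC, herr⟩ :=
    exists_groupCode ((min_le_right _ _).trans_lt (by norm_num)) hg'
  refine ⟨C, 4 ^ k, e, d, he, hC, ?_, herr.trans (min_le_left _ _)⟩
  have hlog : Real.logb 2 ((4 ^ k : ℕ) : ℝ) = 2 * k := by
    have : ((4 ^ k : ℕ) : ℝ) = (2 : ℝ) ^ (2 * (k : ℝ)) := by
      rw [Real.rpow_mul (by norm_num), Real.rpow_natCast]
      norm_num
    rw [this, Real.logb_rpow (by norm_num) (by norm_num)]
  rw [hlog, le_div_iff₀ hn']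
  have hfl := Nat.lt_floor_add_one ((n : ℝ) * (W.I2Sum - 4 * δ) / 2)
  rw [← hk] at hfl
  have := mul_le_mul_of_nonneg_left hδε hn'.le
  linarith

end Channel

/-! ### Group capacity of Channel 3 and the strict gap -/

namespace Channel3

/-- The sum is 2 for a = 0 and 19/5 = 4 · 19/20 for a = 2 and a = 3. In the last two cases the
noise-free inputs 0 and 1 expose a false multiple with probability 1/5 when the input is 2 or 3,
respectively. -/
theorem multiplesDetected : channel3At.MultiplesDetected (19 / 20) := by
  intro a ha
  have e4 : (2 * 2 : ZMod 4) = 0 := by decide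
  have e5 : (2 * 3 : ZMod 4) = 2 := by decide
  have e6 : (3 * 2 : ZMod 4) = 2 := by decide
  have e7 : (3 * 3 : ZMod 4) = 1 := by decide
  have hx : a = 0 ∨ a = 1 ∨ a = 2 ∨ a = 3 := by revert a; decide
  rcases hx with rfl | rfl | rfl | rfl
  · simp only [sum_zmod_four, sum_out, zero_mul, prob_00, prob_01, prob_10, prob_11, prob_20,
      prob_21, prob_30, prob_31]
    norm_num
  · exact absurd rfl ha
  · simp only [sum_zmod_four, sum_out, mul_zero, mul_one, e4, e5, prob_00, prob_01, prob_10,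
      prob_11, prob_20, prob_21, prob_30, prob_31]
    norm_num
  · simp only [sum_zmod_four, sum_out, mul_zero, mul_one, e6, e7, prob_00, prob_01, prob_10,
      prob_11, prob_20, prob_21, prob_30, prob_31]
    norm_num

theorem isGroupCapacity : IsGroupCapacity channel3At channel3At.I2Sum := by
  have hpos : 0 < channel3At.I2Sum := by
    have := (abs_lt.1 I2Sum_approx).1
    norm_num at this
    linarith
  exact ⟨Channel.isGroupAchievable_I2Sum (by norm_num) (by norm_num) multiplesDetected hpos
    I2Sum_le_symmetricCapacity, fun R hR => IsGroupAchievable.le (I2_eq.trans I2'_eq.symm) hR⟩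

theorem mean_lt : (channel3At.minus.I2Sum + channel3At.plus.I2Sum) / 2 < channel3At.I2Sum := by
  have h1 := (abs_lt.1 mean_approx).2
  have h2 := (abs_lt.1 I2Sum_approx).1
  norm_num at h1 h2
  linarith

end Channel3

end

/-- `(I₂ + I₂')ⁿ` is a supermartingale for every channel with input `ℤ/4`; for Channel 3 with
`λ = 0.2` this bounds the rates of standard polar codes strictly below the group capacity. -/
theorem mainTheorem9 {Ω : Type v} [MeasurableSpace Ω] (μ : Measure Ω) [IsProbabilityMeasure μ]
    (B : ℕ → Ω → Bool) (hB : ∀ k, Measurable (B k)) (hindep : iIndepFun B μ)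
    (hfair : ∀ k, μ {ω | B k ω = true} = 1 / 2) :
    (∀ W : Channel.{u} (ZMod 4), Supermartingale (I2SumSeq W B) (bitFiltration B hB) μ) ∧
    (|channel3At.symmetricCapacity - 0.6390| < 0.00005 ∧
      IsGroupCapacity channel3At channel3At.I2Sum ∧
      |channel3At.I2Sum - 0.2161| < 0.00005 ∧
      |(∫ ω, I2SumSeq channel3At B 1 ω ∂μ) - 0.2053| < 0.00005 ∧
      (∀ R, IsStandardPolarRate channel3At R → R ≤ ∫ ω, I2SumSeq channel3At B 1 ω ∂μ) ∧
      (∀ R, IsSCPolarAchievable channel3At R → R ≤ ∫ ω, I2SumSeq channel3At B 1 ω ∂μ) ∧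
      (∫ ω, I2SumSeq channel3At B 1 ω ∂μ) < channel3At.I2Sum) ∧
    (∃ (W : Channel.{0} (ZMod 4)) (C : ℝ), IsGroupCapacity W C ∧
      ¬ IsStandardPolarRate W C ∧ ¬ IsSCPolarAchievable W C) := by
  have hmean : ∫ ω, I2SumSeq channel3At B 1 ω ∂μ =
      (channel3At.minus.I2Sum + channel3At.plus.I2Sum) / 2 :=
    integral_I2SumSeq_one channel3At hB hfair
  refine ⟨fun W => supermartingale_I2SumSeq W hB hindep hfair, ?_, channel3At, channel3At.I2Sum,
    Channel3.isGroupCapacity, fun h => ?_, fun h => ?_⟩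
  · rw [hmean]
    exact ⟨Channel3.symmetricCapacity_approx, Channel3.isGroupCapacity, Channel3.I2Sum_approx,
      Channel3.mean_approx, fun R hR => hR.le, fun R hR => hR.le, Channel3.mean_lt⟩
  · exact absurd h.le (not_le.2 Channel3.mean_lt)
  · exact absurd h.le (not_le.2 Channel3.mean_lt)
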